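/- Let $k,d\ge 1$ be integers with $k>d/2$ and let $1\le q\le\infty$. Functions on the torus $\mathbb T^d=\mathbb R^d/\mathbb Z^d$ are identified with periodic functions, $H^k_0(\mathbb T^d)$ is the space of mean-zero Sobolev functions of order $k$ (identified with their continuous representatives), with inner product $\langle u,v\rangle_{H^k_0}=\int_{\mathbb T^d}D^ku\cdot D^kv\,dx$, where $D^k$ is the tensor of all $k$-th order weak derivatives, and with norm $\|u\|_{H^k_0}=\|D^ku\|_{L^2}$. For $n=m^d$, $m\in\mathbb N$, let $\Gamma_n=\{(\tau_1/m,\dots,\tau_d/m):\tau_i\in\{0,\dots,m-1\}\}$, and let $S_n g=(g(x))_{x\in\Gamma_n}$ be the sampling operator on $H^k_0(\mathbb T^d)$, with adjoint $S_n^*:\mathbb R^{\Gamma_n}\to H^k_0(\mathbb T^d)$ with respect to $\langle\cdot,\cdot\rangle_{H^k_0}$ (and the standard inner product on $\mathbb R^{\Gamma_n}$). A cube is a set $B=\prod_{i=1}^d[a_i,a_i+h)\subseteq[0,1]^d$ with $0<h\le1$, and $|B|=h^d$. Let $\mathcal B$ be a normal system of cubes: there is $c>1$ such that every cube $B$ contains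 some $\tilde B\in\mathcal B$ with $|\tilde B|\ge|B|/c$. For $y,w\in\mathbb R^{\Gamma_n}$ put $$\|y\|_{\mathcal B}=\sup_{B\in\mathcal B}\frac{1}{\sqrt{\#(\Gamma_n\cap B)}}\Bigl|\sum_{x\in\Gamma_n\cap B}y(x)\Bigr|,\qquad \|w\|_{\mathcal B^*}=\sup\Bigl\{\sum_{x\in\Gamma_n}w(x)v(x):\|v\|_{\mathcal B}\le1\Bigr\}\in[0,\infty]$$ (a cube with $\Gamma_n\cap B=\emptyset$ contributes $0$). For $f\in H^k_0(\mathbb T^d)$ let $$d_n(t)=\min_{\|w\|_{\mathcal B^*}\le t}\|S_n^*w-f\|_{H^k_0}\qquad(t\ge0).$$ Let $f\in H^k_0(\mathbb T^d)$ and let the data be $y_n(x)=f(x)+\xi_n(x)$, $x\in\Gamma_n$, where all $\xi_n(x)$ are defined on one probability space and, for each $n=m^d$, the variables $(\xi_n(x))_{x\in\Gamma_n}$ are i.i.d. and sub-Gaussian with parameter $\sigma>0$, i.e. $\mathbb E\,e^{\tau\xi_n(x)}\le e^{\tau^2\sigma^2/2}$ for all $\tau\in\mathbb R$; nothing is assumed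 on the joint law for different $n$. Let $\gamma_n=C_\gamma(\log n)^r$ with $r\ge1/2$ and $C_\gamma>0$, where $C_\gamma>\sigma\sqrt{5+2k/d}$ if $r=1/2$, and let $\hat f_{\gamma_n}$ be the MIND estimator, i.e. the minimizer of $\frac12\|D^kg\|_{L^2}^2$ over all $g\in H^k_0(\mathbb T^d)$ with $\|S_ng-y_n\|_{\mathcal B}\le\gamma_n$. Assume that, for some $0\le\mu<1/2$, $$\min_{t\ge0}\bigl(d_n(t)+(\log n)^{r/2}t^{1/2}\bigr)=O(n^{-\mu})\qquad\text{as } n=m^d\to\infty.$$ Put $$\vartheta=\begin{cases}\dfrac{k}{2k+d}&\text{if } q\le\dfrac{4k+2d}{d},\\[2mm]\dfrac{k-d/2+d/q}{2k}&\text{if } q>\dfrac{4k+2d}{d}\end{cases}\qquad(d/q=0\text{ for }q=\infty).$$ Then there is a (deterministic) constant $C<\infty$ such that, almost surely, $$\limsup_{n=m^d\to\infty}\; n^{\mu(1-2\vartheta)+\vartheta}(\log n)^{-2r\vartheta}\,\|\hat f_{\gamma_n}-f\|_{L^q(\mathbb T^d)}\le C.$$ -/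

import Mathlib

open MeasureTheory ProbabilityTheory Filter Asymptotics
open scoped NNReal ENNReal

namespace MIND

noncomputable section

/-! ### Functions on the torus

A function on the torus `ℝ^d / ℤ^d` is a `ℤ^d`-periodic function on `ℝ^d`; integrals over the
torus are integrals over the fundamental domain `[0,1)^d`. -/

/-- The half-open unit cube `[0,1)^d`. -/
def unitCube (d : ℕ) : Set (Fin d → ℝ) := Set.univ.pi fun _ => Set.Ico (0 : ℝ) 1

/-- The measure of the torus: Lebesgue measure on `[0,1)^d`. -/
def torusMeasure (d : ℕ) : Measure (Fin d → ℝ) := volume.restrict (unitCube d)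

/-- `f` is `ℤ^d`-periodic. -/
def IsPeriodic {d : ℕ} (f : (Fin d → ℝ) → ℝ) : Prop :=
  ∀ (x : Fin d → ℝ) (z : Fin d → ℤ), f (x + fun l => (z l : ℝ)) = f x

/-- The classical partial derivative `∂_{i 0} ⋯ ∂_{i (j-1)} φ`. -/
def partialDeriv {d j : ℕ} (i : Fin j → Fin d) (φ : (Fin d → ℝ) → ℝ) (x : Fin d → ℝ) : ℝ :=
  iteratedFDeriv ℝ j φ x fun l => Pi.single (i l) (1 : ℝ)

/-- `g ∈ L²` is the weak partial derivative `∂_{i 0} ⋯ ∂_{i (j-1)} f` of `f` on the torus, tested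
against all smooth functions on the torus. -/
def IsWeakDeriv {d j : ℕ} (i : Fin j → Fin d) (f g : (Fin d → ℝ) → ℝ) : Prop :=
  MemLp g 2 (torusMeasure d) ∧
    ∀ φ : (Fin d → ℝ) → ℝ, ContDiff ℝ (⊤ : ℕ∞) φ → IsPeriodic φ →
      ∫ x, f x * partialDeriv i φ x ∂(torusMeasure d)
        = (-1) ^ j * ∫ x, g x * φ x ∂(torusMeasure d)

open Classical in
/-- The weak partial derivative (unique almost everywhere), `0` if there is none in `L²`. -/
def weakDeriv {d j : ℕ} (i : Fin j → Fin d) (f : (Fin d → ℝ) → ℝ) : (Fin d → ℝ) → ℝ :=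
  if h : ∃ g, IsWeakDeriv i f g then h.choose else 0

/-- `f ∈ H^k_0`: mean zero, with all weak derivatives of order at most `k` in `L²`. This is used
for `k > d/2` only, when every class in `H^k_0` has exactly one continuous representative, and
`f` is this representative, so that it can be sampled at points. -/
structure MemHk0 {d : ℕ} (k : ℕ) (f : (Fin d → ℝ) → ℝ) : Prop where
  continuous : Continuous f
  periodic : IsPeriodic f
  mean_zero : ∫ x, f x ∂(torusMeasure d) = 0
  weak_deriv : ∀ j : ℕ, j ≤ k → ∀ i : Fin j → Fin d, ∃ g, IsWeakDeriv i f g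

/-- The inner product `⟨u, v⟩_{H^k_0} = ∫ D^k u · D^k v`, where `D^k` is the tensor of all
partial derivatives `∂_{i 1} ⋯ ∂_{i k}`. -/
def innerHk {d : ℕ} (k : ℕ) (u v : (Fin d → ℝ) → ℝ) : ℝ :=
  ∑ i : Fin k → Fin d, ∫ x, weakDeriv i u x * weakDeriv i v x ∂(torusMeasure d)

/-- The homogeneous Sobolev norm `‖D^k u‖_{L²}`. -/
def normHk {d : ℕ} (k : ℕ) (u : (Fin d → ℝ) → ℝ) : ℝ := Real.sqrt (innerHk k u u)

/-! ### The grid and the multiresolution norm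

`m` is the number of grid points per axis, so that the sample size is `n = m ^ d`. -/

/-- The grid point with index `τ ∈ {0, …, m-1}^d`, that is `(τ_1 / m, …, τ_d / m)`. -/
def gridPoint {d m : ℕ} (τ : Fin d → Fin m) : Fin d → ℝ := fun l => ((τ l : ℕ) : ℝ) / (m : ℝ)

/-- The sampling operator `S_n`. -/
def sample {d : ℕ} (m : ℕ) (f : (Fin d → ℝ) → ℝ) : (Fin d → Fin m) → ℝ := fun τ => f (gridPoint τ)

/-- A cube `∏ [a_l, a_l + h)` contained in `[0,1]^d`, with `0 < h ≤ 1`. -/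
structure Cube (d : ℕ) where
  corner : Fin d → ℝ
  side : ℝ
  side_pos : 0 < side
  side_le_one : side ≤ 1
  corner_nonneg : ∀ l, 0 ≤ corner l
  corner_add_side_le : ∀ l, corner l + side ≤ 1

/-- The point set of a cube. -/
def Cube.toSet {d : ℕ} (B : Cube d) : Set (Fin d → ℝ) :=
  Set.univ.pi fun l => Set.Ico (B.corner l) (B.corner l + B.side)

/-- The volume of a cube. -/
def Cube.vol {d : ℕ} (B : Cube d) : ℝ := B.side ^ d

/-- Normal systems of cubes. -/
def IsNormal {d : ℕ} (𝓑 : Set (Cube d)) : Prop :=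
  ∃ c : ℝ, 1 < c ∧ ∀ B : Cube d, ∃ B' ∈ 𝓑, B'.toSet ⊆ B.toSet ∧ B.vol / c ≤ B'.vol

open Classical in
/-- The indices of the grid points in `B`. -/
def gridIn {d : ℕ} (m : ℕ) (B : Cube d) : Finset (Fin d → Fin m) :=
  Finset.univ.filter fun τ => gridPoint τ ∈ B.toSet

/-- The multiresolution norm `sup_B n(B)^{-1/2} |∑_{x ∈ B} y x|`. A cube without grid points
contributes `0`; the supremum is over finitely many values. -/
def mrNorm {d m : ℕ} (𝓑 : Set (Cube d)) (y : (Fin d → Fin m) → ℝ) : ℝ :=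
  ⨆ B : 𝓑, |∑ τ ∈ gridIn m B.1, y τ| / Real.sqrt ((gridIn m B.1).card : ℝ)

/-- The dual multiresolution norm; it takes the value `⊤` exactly where the supremum is
infinite, which cannot happen when the multiresolution norm is definite. -/
def dualMrNorm {d m : ℕ} (𝓑 : Set (Cube d)) (w : (Fin d → Fin m) → ℝ) : EReal :=
  ⨆ v : {v : (Fin d → Fin m) → ℝ // mrNorm 𝓑 v ≤ 1}, ((∑ τ, w τ * v.1 τ : ℝ) : EReal)

/-- `g = S_n^* w`, where `S_n^*` is the adjoint of the sampling operator for the inner product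
of `H^k_0`. -/
def IsSampleAdjoint {d m : ℕ} (k : ℕ) (w : (Fin d → Fin m) → ℝ) (g : (Fin d → ℝ) → ℝ) : Prop :=
  MemHk0 k g ∧ ∀ u, MemHk0 k u → ∑ τ, sample m u τ * w τ = innerHk k u g

/-- The multiscale distance function
`d_n(t) = min {‖S_n^* w - f‖_{H^k_0} : ‖w‖_{𝓑^*} ≤ t}`. -/
def distFun {d : ℕ} (k m : ℕ) (𝓑 : Set (Cube d)) (f : (Fin d → ℝ) → ℝ) (t : ℝ) : ℝ :=
  sInf {ρ : ℝ | ∃ (w : (Fin d → Fin m) → ℝ) (g : (Fin d → ℝ) → ℝ),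
    dualMrNorm 𝓑 w ≤ (t : EReal) ∧ IsSampleAdjoint k w g ∧ ρ = normHk k (g - f)}

/-- `min_{t ≥ 0} (d_n(t) + (log n)^{r/2} t^{1/2})` for `n = m ^ d`. -/
def sourceDefect {d : ℕ} (k m : ℕ) (𝓑 : Set (Cube d)) (f : (Fin d → ℝ) → ℝ) (r : ℝ) : ℝ :=
  sInf ((fun t : ℝ => distFun k m 𝓑 f t + Real.log ((m : ℝ) ^ d) ^ (r / 2) * Real.sqrt t) ''
    Set.Ici 0)

/-- `g` is the MIND estimator for the data `y` and the threshold `γ`: it minimizes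
`½ ‖D^k g‖²` over `H^k_0` subject to `‖S_n g - y‖_𝓑 ≤ γ`. -/
def IsMIND {d m : ℕ} (k : ℕ) (𝓑 : Set (Cube d)) (y : (Fin d → Fin m) → ℝ) (γ : ℝ)
    (g : (Fin d → ℝ) → ℝ) : Prop :=
  MemHk0 k g ∧ mrNorm 𝓑 (sample m g - y) ≤ γ ∧
    ∀ h, MemHk0 k h → mrNorm 𝓑 (sample m h - y) ≤ γ →
      (1 / 2 : ℝ) * normHk k g ^ 2 ≤ (1 / 2 : ℝ) * normHk k h ^ 2

open Classical in
/-- The exponent `ϑ(k, d, q)`, with `1 / q = 0` for `q = ∞`. -/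
def vartheta (k d : ℕ) (q : ℝ≥0∞) : ℝ :=
  if q ≤ ENNReal.ofReal ((4 * k + 2 * d) / d) then (k : ℝ) / (2 * k + d)
  else ((k : ℝ) - d / 2 + d * (q⁻¹).toReal) / (2 * k)

end

end MIND

/-! Write g for the error, the estimator minus f. Two weak bounds on g are proved, one on its
samples and one on its energy, and the rate follows by interpolating between them.

If the noise has multiresolution norm at most γ_n, then f is feasible. So the samples of g have norm
at most 2γ_n, and minimality gives ‖g‖² ≤ -2⟨f, g⟩. Write f = S*w - (S*w - f): the first part pairs
w with the samples of g and costs at most 2γ_n t, and the second is handled by Cauchy-Schwarz.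
Optimising over w and t yields ‖D^k g‖ = O(n^{-μ}) (`IsMIND.normHk_sub_le_sourceDefect`). The noise
event holds almost surely for all large n: a cube meets the grid in a product of intervals, so
(m+1)^{2d} sums suffice, and sub-Gaussian tails with Borel-Cantelli conclude
(`ae_eventually_mrNorm_le`).

The interpolation (`exists_interpolation`) is deterministic. Let ρ = 2γ_n n^{-1/2}, let D bound ‖D^k
g‖, and let E(Q) be the integral of |D^k g|² over Q. On a cube Q of side h, not too small for the
grid, |g| ≲ ρ h^{-d/2} + h^{k-d/2} E(Q)^{1/2} (`exists_local_estimate`). Indeed a Taylor polynomial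
is controlled by its means over small subcubes, and its remainder, averaged over the base point, is
controlled by E(Q) because k > d/2. Call Q good if E(Q) ≤ ρ² h^{-2k}; then the first term dominates.
For p = (4k+2d)/d the integral of |g|^p over a good cube is ≲ ρ^{p-2} · ρ² h^{-2k}, the threshold
for E up to the factor ρ^{p-2}. Since E is additive, splitting bad dyadic cubes until they are good
(`tree_bound`) gives ∫|g|^p ≲ ρ^{p-2} D². All cubes with h^{-k} ≥ D/ρ are good, which bounds sup
|g|. The case q ≤ p follows by monotonicity of L^q norms, and q > p by interpolating with the
supremum. -/

namespace MIND

noncomputable section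

/-! ### The torus as a quotient -/

/-- The normalised Haar measure on the circle. -/
abbrev unitAddCircleMeasureSpace : MeasureSpace UnitAddCircle :=
  ⟨AddCircle.haarAddCircle⟩

attribute [local instance] unitAddCircleMeasureSpace

lemma unitAddCircleIsAddHaar : Measure.IsAddHaarMeasure (volume : Measure UnitAddCircle) :=
  inferInstanceAs (Measure.IsAddHaarMeasure AddCircle.haarAddCircle)

attribute [local instance] unitAddCircleIsAddHaar

instance torusMeasure_isProbabilityMeasure (d : ℕ) : IsProbabilityMeasure (torusMeasure d) := by
  constructor
  simp [torusMeasure, unitCube, Real.volume_pi_Ico]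

/-- The projection from `ℝ^d` to the torus. -/
def toTorus {d : ℕ} (x : Fin d → ℝ) : UnitAddTorus (Fin d) := fun l => (x l : UnitAddCircle)

/-- The section of the projection with values in the unit cube. -/
def ofTorus {d : ℕ} (t : UnitAddTorus (Fin d)) : Fin d → ℝ :=
  fun l => (AddCircle.equivIco 1 0 (t l) : ℝ)

lemma toTorus_ofTorus {d : ℕ} (t : UnitAddTorus (Fin d)) : toTorus (ofTorus t) = t := by
  funext l
  exact (AddCircle.equivIco (1 : ℝ) 0).symm_apply_apply (t l)

lemma ofTorus_toTorus {d : ℕ} {x : Fin d → ℝ} (hx : x ∈ unitCube d) :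
    ofTorus (toTorus x) = x := by
  funext l
  have h : x l ∈ Set.Ico (0 : ℝ) (0 + 1) := by simpa using hx l (Set.mem_univ l)
  have := (AddCircle.equivIco (1 : ℝ) 0).apply_symm_apply ⟨x l, h⟩
  exact congrArg Subtype.val this

lemma measurable_ofTorus {d : ℕ} : Measurable (ofTorus (d := d)) := by
  refine measurable_pi_lambda _ fun l => ?_
  exact measurable_subtype_coe.comp
    ((AddCircle.measurableEquivIco (1 : ℝ) 0).measurable.comp (measurable_pi_apply l))

lemma measurePreserving_toTorus (d : ℕ) :
    MeasurePreserving (toTorus (d := d)) (torusMeasure d) volume := by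
  have h1 : torusMeasure d
      = Measure.pi fun _ : Fin d => (volume : Measure ℝ).restrict (Set.Ioc 0 (0 + 1)) := by
    rw [torusMeasure, unitCube, volume_pi, Measure.restrict_pi_pi]
    congr 1
    funext l
    rw [zero_add]
    exact Measure.restrict_congr_set Ico_ae_eq_Ioc
  have h2 : ∀ _ : Fin d, MeasurePreserving (QuotientAddGroup.mk : ℝ → UnitAddCircle)
      ((volume : Measure ℝ).restrict (Set.Ioc 0 (0 + 1)))
      (volume : Measure UnitAddCircle) := by
    intro _
    have := AddCircle.measurePreserving_mk 1 0
    rw [AddCircle.volume_eq_smul_haarAddCircle, ENNReal.ofReal_one, one_smul] at this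
    exact this
  rw [h1]
  exact measurePreserving_pi _ _ h2

lemma ae_mem_unitCube (d : ℕ) : ∀ᵐ x ∂torusMeasure d, x ∈ unitCube d :=
  ae_restrict_mem (MeasurableSet.univ_pi fun _ => measurableSet_Ico)

/-- The section inverts the projection only on the unit cube, which carries all the mass. It lets
functions known only there, such as weak derivatives, be moved to the torus without any periodicity.
-/
lemma measurePreserving_ofTorus (d : ℕ) :
    MeasurePreserving (ofTorus (d := d)) volume (torusMeasure d) := by
  refine ⟨measurable_ofTorus, ?_⟩
  rw [← (measurePreserving_toTorus d).map_eq,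
    Measure.map_map measurable_ofTorus (measurePreserving_toTorus d).measurable]
  conv_rhs => rw [← Measure.map_id (μ := torusMeasure d)]
  refine Measure.map_congr ?_
  filter_upwards [ae_mem_unitCube d] with x hx
  exact ofTorus_toTorus hx

/-! ### Fourier coefficients -/

/-- The phase `2π n · x`. -/
def phase {d : ℕ} (n : Fin d → ℤ) (x : Fin d → ℝ) : ℝ := ∑ l, 2 * Real.pi * n l * x l

/-- The Fourier coefficient of a function on the unit cube. -/
def fourierCoef {d : ℕ} (w : (Fin d → ℝ) → ℝ) (n : Fin d → ℤ) : ℂ :=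
  ∫ x, (w x : ℂ) * Complex.exp (-(phase n x * Complex.I)) ∂torusMeasure d

lemma mFourier_toTorus {d : ℕ} (n : Fin d → ℤ) (x : Fin d → ℝ) :
    UnitAddTorus.mFourier n (toTorus x) = Complex.exp (phase n x * Complex.I) := by
  simp only [UnitAddTorus.mFourier, ContinuousMap.coe_mk, toTorus, fourier_coe_apply, phase,
    ← Complex.exp_sum]
  congr 1
  push_cast
  rw [Finset.sum_mul]
  refine Finset.sum_congr rfl fun l _ => ?_
  ring

lemma mFourierCoeff_comp_ofTorus {d : ℕ} (w : (Fin d → ℝ) → ℝ) (n : Fin d → ℤ) :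
    UnitAddTorus.mFourierCoeff (fun t => ((w (ofTorus t) : ℝ) : ℂ)) n = fourierCoef w n := by
  rw [UnitAddTorus.mFourierCoeff, UnitAddTorus.integral_preimage _ 0, fourierCoef]
  have : (volume : Measure (Fin d → ℝ)).restrict
      {x | ∀ i, x i ∈ Set.Ioc ((0 : Fin d → ℝ) i) ((0 : Fin d → ℝ) i + 1)} = torusMeasure d := by
    rw [torusMeasure, unitCube, volume_pi, Measure.restrict_pi_pi]
    have e : {x : Fin d → ℝ | ∀ i, x i ∈ Set.Ioc ((0 : Fin d → ℝ) i) ((0 : Fin d → ℝ) i + 1)}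
      = Set.univ.pi fun _ => Set.Ioc 0 1 := by ext; simp
    rw [e, Measure.restrict_pi_pi]
    congr 1
    funext l
    exact Measure.restrict_congr_set Ico_ae_eq_Ioc.symm
  rw [this]
  refine integral_congr_ae ?_
  filter_upwards [ae_mem_unitCube d] with x hx
  have h1 := mFourier_toTorus (-n) x
  have h2 := ofTorus_toTorus hx
  change UnitAddTorus.mFourier (-n) (toTorus x) • ((w (ofTorus (toTorus x)) : ℝ) : ℂ) = _
  rw [h1, h2, smul_eq_mul, mul_comm]
  congr 2
  simp only [phase]
  push_cast
  rw [← neg_mul, ← Finset.sum_neg_distrib]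
  congr 1
  refine Finset.sum_congr rfl fun l _ => ?_
  simp

/-- The trigonometric polynomial with the Fourier coefficients of `w` at the frequencies in
`S`. -/
def partialSum {d : ℕ} (c : (Fin d → ℤ) → ℂ) (S : Finset (Fin d → ℤ)) (x : Fin d → ℝ) : ℝ :=
  (∑ n ∈ S, c n * Complex.exp (phase n x * Complex.I)).re

lemma continuous_phase {d : ℕ} (n : Fin d → ℤ) : Continuous (phase n) := by
  unfold phase; fun_prop

lemma continuous_partialSum {d : ℕ} (c : (Fin d → ℤ) → ℂ) (S : Finset (Fin d → ℤ)) :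
    Continuous (partialSum c S) := by
  have := fun n : Fin d → ℤ => continuous_phase n
  unfold partialSum; fun_prop

/-- The L² convergence of Fourier series on the torus is pulled back along the measure-preserving
projection. Since w is real, taking real parts does not increase the error. -/
theorem tendsto_eLpNorm_partialSum {d : ℕ} {w : (Fin d → ℝ) → ℝ}
    (hw : MemLp w 2 (torusMeasure d)) :
    Tendsto (fun S : Finset (Fin d → ℤ) =>
      eLpNorm (fun x => partialSum (fourierCoef w) S x - w x) 2 (torusMeasure d)) atTop (nhds 0) := by
  have hW : MemLp (fun t : UnitAddTorus (Fin d) => ((w (ofTorus t) : ℝ) : ℂ)) 2 volume :=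
    (hw.comp_measurePreserving (measurePreserving_ofTorus d)).ofReal
  have hs := UnitAddTorus.hasSum_mFourier_series_L2 hW.toLp
  have hc : ∀ n, UnitAddTorus.mFourierCoeff (hW.toLp) n = fourierCoef w n := by
    intro n
    rw [← mFourierCoeff_comp_ofTorus]
    refine integral_congr_ae ?_
    filter_upwards [hW.coeFn_toLp] with t ht
    rw [ht]
  simp only [hc] at hs
  have h3 := (tendsto_iff_norm_sub_tendsto_zero.1 hs)
  have h4 : Tendsto (fun S : Finset (Fin d → ℤ) => eLpNorm (fun t : UnitAddTorus (Fin d) =>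
      (∑ n ∈ S, fourierCoef w n * UnitAddTorus.mFourier n t) - ((w (ofTorus t) : ℝ) : ℂ)) 2 volume)
      atTop (nhds 0) := by
    have h5 := ENNReal.tendsto_ofReal h3
    rw [ENNReal.ofReal_zero] at h5
    refine h5.congr fun S => ?_
    rw [Lp.norm_def, ENNReal.ofReal_toReal (Lp.eLpNorm_ne_top _)]
    refine eLpNorm_congr_ae ?_
    have h6 : ∀ᵐ t ∂(volume : Measure (UnitAddTorus (Fin d))), ∀ n : Fin d → ℤ,
        UnitAddTorus.mFourierLp 2 n t = UnitAddTorus.mFourier n t :=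
      ae_all_iff.2 fun n => UnitAddTorus.coeFn_mFourierLp 2 n
    have h7 : ∀ᵐ t ∂(volume : Measure (UnitAddTorus (Fin d))), ∀ n : Fin d → ℤ,
        (fourierCoef w n • UnitAddTorus.mFourierLp (d := Fin d) 2 n :
          Lp ℂ 2 (volume : Measure (UnitAddTorus (Fin d)))) t
          = fourierCoef w n * UnitAddTorus.mFourierLp 2 n t :=
      ae_all_iff.2 fun n => Lp.coeFn_smul _ _
    filter_upwards [h6, h7, hW.coeFn_toLp, Lp.coeFn_sub
      (∑ n ∈ S, fourierCoef w n • UnitAddTorus.mFourierLp (d := Fin d) 2 n) hW.toLp,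
      Lp.coeFn_finsetSum S fun n => fourierCoef w n • UnitAddTorus.mFourierLp (d := Fin d) 2 n]
      with t t6 t7 t8 t9 t10
    rw [t9, Pi.sub_apply, t10, t8, Finset.sum_apply]
    congr 1
    exact Finset.sum_congr rfl fun n _ => by rw [t7, t6]
  refine tendsto_of_tendsto_of_tendsto_of_le_of_le tendsto_const_nhds h4 (fun _ => zero_le) ?_
  intro S
  have hm : AEStronglyMeasurable (fun t : UnitAddTorus (Fin d) =>
      (∑ n ∈ S, fourierCoef w n * UnitAddTorus.mFourier n t) - ((w (ofTorus t) : ℝ) : ℂ)) volume := by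
    refine AEStronglyMeasurable.sub ?_ hW.1
    exact Continuous.aestronglyMeasurable (by fun_prop)
  have := eLpNorm_comp_measurePreserving (p := 2) hm (measurePreserving_toTorus d)
  change _ ≤ eLpNorm _ _ _
  rw [← this]
  refine eLpNorm_mono_ae ?_
  filter_upwards [ae_mem_unitCube d] with x hx
  simp only [Function.comp, mFourier_toTorus, ofTorus_toTorus hx, partialSum]
  rw [Real.norm_eq_abs]
  refine le_trans (le_of_eq ?_) (Complex.abs_re_le_norm _)
  simp

theorem ae_eq_of_fourierCoef_eq {d : ℕ} {v w : (Fin d → ℝ) → ℝ}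
    (hv : MemLp v 2 (torusMeasure d)) (hw : MemLp w 2 (torusMeasure d))
    (h : ∀ n, fourierCoef v n = fourierCoef w n) : v =ᵐ[torusMeasure d] w := by
  have h1 := tendsto_eLpNorm_partialSum hv
  have h2 := tendsto_eLpNorm_partialSum hw
  rw [show fourierCoef v = fourierCoef w from funext h] at h1
  have h3 := h1.add h2
  rw [add_zero] at h3
  have h4 : eLpNorm (fun x => v x - w x) 2 (torusMeasure d) ≤ 0 := by
    refine ge_of_tendsto' h3 fun S => ?_
    have hp := (continuous_partialSum (fourierCoef w) S).aestronglyMeasurable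
      (μ := torusMeasure d)
    have e : (fun x => v x - w x) = (fun x => partialSum (fourierCoef w) S x - w x)
        - (fun x => partialSum (fourierCoef w) S x - v x) := by
      funext x; simp
    rw [e, add_comm (eLpNorm _ _ _)]
    refine (eLpNorm_sub_le (hp.sub hw.1) (hp.sub hv.1) (by norm_num)).trans ?_
    exact le_rfl
  have h5 := (eLpNorm_eq_zero_iff (hv.1.sub hw.1) (by norm_num)).1 (le_antisymm h4 zero_le)
  filter_upwards [h5] with x hx
  simpa [sub_eq_zero] using hx

/-! ### Real trigonometric waves -/

/-- The wave `Re (c e^{2π i n · x})`. -/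
def wave {d : ℕ} (c : ℂ) (n : Fin d → ℤ) (x : Fin d → ℝ) : ℝ :=
  (c * Complex.exp (phase n x * Complex.I)).re

/-- The phase as a continuous linear functional. -/
def phaseCLM {d : ℕ} (n : Fin d → ℤ) : (Fin d → ℝ) →L[ℝ] ℝ :=
  ∑ l, (2 * Real.pi * n l) • ContinuousLinearMap.proj l

lemma phaseCLM_apply {d : ℕ} (n : Fin d → ℤ) (x : Fin d → ℝ) : phaseCLM n x = phase n x := by
  simp [phaseCLM, phase]

lemma hasDerivAt_re_mul_cexp (c : ℂ) (t : ℝ) :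
    HasDerivAt (fun t : ℝ => (c * Complex.exp (t * Complex.I)).re)
      (Complex.I * c * Complex.exp (t * Complex.I)).re t := by
  have h1 : HasDerivAt (fun t : ℝ => c * Complex.exp (t * Complex.I))
      (c * (Complex.exp (t * Complex.I) * (1 * Complex.I))) t :=
    (((Complex.ofRealCLM.hasDerivAt (x := t)).mul_const Complex.I).cexp).const_mul c
  have h2 := Complex.reCLM.hasFDerivAt.comp_hasDerivAt t h1
  refine h2.congr_deriv ?_
  rw [Complex.reCLM_apply]
  congr 1
  ring

lemma iteratedDeriv_re_mul_cexp (c : ℂ) (j : ℕ) :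
    iteratedDeriv j (fun t : ℝ => (c * Complex.exp (t * Complex.I)).re)
      = fun t : ℝ => (Complex.I ^ j * c * Complex.exp (t * Complex.I)).re := by
  induction j with
  | zero => simp
  | succ j ih =>
    rw [iteratedDeriv_succ, ih]
    funext t
    rw [(hasDerivAt_re_mul_cexp (Complex.I ^ j * c) t).deriv]
    congr 2
    ring

lemma contDiff_re_mul_cexp (c : ℂ) (N : WithTop ℕ∞) :
    ContDiff ℝ N (fun t : ℝ => (c * Complex.exp (t * Complex.I)).re) := by
  have h1 : ContDiff ℝ N fun t : ℝ => c * Complex.exp (t * Complex.I) :=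
    contDiff_const.mul ((Complex.ofRealCLM.contDiff.mul contDiff_const).cexp)
  exact Complex.reCLM.contDiff.comp h1

lemma wave_eq_comp {d : ℕ} (c : ℂ) (n : Fin d → ℤ) :
    wave c n = (fun t : ℝ => (c * Complex.exp (t * Complex.I)).re) ∘ phaseCLM n := by
  funext x
  simp [wave, phaseCLM_apply]

lemma contDiff_wave {d : ℕ} (c : ℂ) (n : Fin d → ℤ) (N : WithTop ℕ∞) :
    ContDiff ℝ N (wave c n) := by
  rw [wave_eq_comp]
  exact (contDiff_re_mul_cexp c N).comp (phaseCLM n).contDiff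

lemma phase_add_int {d : ℕ} (n : Fin d → ℤ) (x : Fin d → ℝ) (z : Fin d → ℤ) :
    phase n (x + fun l => (z l : ℝ)) = phase n x + ((∑ l, n l * z l : ℤ) : ℝ) * (2 * Real.pi) := by
  simp only [phase, Pi.add_apply]
  push_cast
  rw [Finset.sum_mul, ← Finset.sum_add_distrib]
  exact Finset.sum_congr rfl fun l _ => by ring

lemma isPeriodic_wave {d : ℕ} (c : ℂ) (n : Fin d → ℤ) : IsPeriodic (wave c n) := by
  intro x z
  simp only [wave, phase_add_int]
  congr 2
  have := Complex.exp_periodic.int_mul (∑ l, n l * z l) (phase n x * Complex.I)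
  rw [← this]
  congr 1
  push_cast
  ring

lemma partialDeriv_wave {d j : ℕ} (i : Fin j → Fin d) (c : ℂ) (n : Fin d → ℤ) :
    partialDeriv i (wave c n)
      = wave ((∏ l, (2 * Real.pi * n (i l) : ℂ)) * Complex.I ^ j * c) n := by
  funext x
  have h1 := (phaseCLM n).iteratedFDeriv_comp_right (contDiff_re_mul_cexp c j) x le_rfl
  rw [partialDeriv, wave_eq_comp, h1, ContinuousMultilinearMap.compContinuousLinearMap_apply,
    iteratedFDeriv_apply_eq_iteratedDeriv_mul_prod, iteratedDeriv_re_mul_cexp, phaseCLM_apply]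
  have h2 : ∀ l, phaseCLM n (Pi.single (i l) (1 : ℝ)) = 2 * Real.pi * n (i l) := by
    intro l
    rw [phaseCLM_apply, phase, Finset.sum_eq_single (i l)]
    · simp
    · intro b _ hb
      simp [hb]
    · simp
  simp only [h2, wave, smul_eq_mul]
  rw [← Complex.re_ofReal_mul]
  congr 1
  push_cast
  ring

lemma partialSum_eq_sum_wave {d : ℕ} (c : (Fin d → ℤ) → ℂ) (S : Finset (Fin d → ℤ)) :
    partialSum c S = fun x => ∑ n ∈ S, wave (c n) n x := by
  funext x
  simp [partialSum, wave]

lemma contDiff_partialSum {d : ℕ} (c : (Fin d → ℤ) → ℂ) (S : Finset (Fin d → ℤ))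
    (N : WithTop ℕ∞) : ContDiff ℝ N (partialSum c S) := by
  rw [partialSum_eq_sum_wave]
  exact ContDiff.sum fun n _ => contDiff_wave _ _ _

lemma partialDeriv_partialSum {d j : ℕ} (i : Fin j → Fin d) (c : (Fin d → ℤ) → ℂ)
    (S : Finset (Fin d → ℤ)) :
    partialDeriv i (partialSum c S)
      = partialSum (fun n => (∏ l, (2 * Real.pi * n (i l) : ℂ)) * Complex.I ^ j * c n) S := by
  funext x
  rw [partialSum_eq_sum_wave, partialSum_eq_sum_wave, partialDeriv,
    iteratedFDeriv_sum fun n _ => contDiff_wave _ _ _, Finset.sum_apply,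
    _root_.sum_apply]
  refine Finset.sum_congr rfl fun n _ => ?_
  rw [← partialDeriv_wave]
  rfl

/-! ### Fourier coefficients of weak derivatives -/

lemma integral_mul_wave {d : ℕ} {w : (Fin d → ℝ) → ℝ} (hw : Integrable w (torusMeasure d))
    (c : ℂ) (n : Fin d → ℤ) :
    ∫ x, w x * wave c n x ∂torusMeasure d = (c * star (fourierCoef w n)).re := by
  have hint : Integrable (fun x => (w x : ℂ) * (c * Complex.exp (phase n x * Complex.I)))
      (torusMeasure d) := by
    refine hw.ofReal.mul_bdd (c := ‖c‖) ?_ (Eventually.of_forall fun x => ?_)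
    · have := continuous_phase n
      exact Continuous.aestronglyMeasurable (by fun_prop)
    · rw [norm_mul, Complex.norm_exp_ofReal_mul_I, mul_one]
  have h1 : c * star (fourierCoef w n)
      = ∫ x, (w x : ℂ) * (c * Complex.exp (phase n x * Complex.I)) ∂torusMeasure d := by
    rw [fourierCoef, Complex.star_def, ← integral_conj, ← integral_const_mul]
    refine integral_congr_ae (Eventually.of_forall fun x => ?_)
    simp only [map_mul, Complex.conj_ofReal, ← Complex.exp_conj, map_neg, Complex.conj_I]
    rw [mul_neg, neg_neg]
    ring
  rw [h1]
  have h2 := integral_re hint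
  simp only [RCLike.re_to_complex] at h2
  rw [← h2]
  refine integral_congr_ae (Eventually.of_forall fun x => ?_)
  simp only [wave, Complex.re_ofReal_mul]

/-- Waves are smooth periodic test functions, and differentiation only multiplies their amplitude;
the sign (-1)^j is absorbed by conjugating I^j. -/
theorem IsWeakDeriv.fourierCoef_eq {d j : ℕ} {i : Fin j → Fin d} {f w : (Fin d → ℝ) → ℝ}
    (hf : Integrable f (torusMeasure d)) (h : IsWeakDeriv i f w) (n : Fin d → ℤ) :
    fourierCoef w n = (∏ l, (2 * Real.pi * n (i l) : ℂ)) * Complex.I ^ j * fourierCoef f n := by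
  have hw : Integrable w (torusMeasure d) := h.1.integrable (by norm_num)
  have key : ∀ c : ℂ, (c * star (fourierCoef w n)).re = (c * star
      ((∏ l, (2 * Real.pi * n (i l) : ℂ)) * Complex.I ^ j * fourierCoef f n)).re := by
    intro c
    have h1 := h.2 (wave c n) (contDiff_wave _ _ _) (isPeriodic_wave _ _)
    rw [partialDeriv_wave, integral_mul_wave hf, integral_mul_wave hw] at h1
    have h2 : ((-1 : ℝ) ^ j) * (-1) ^ j = 1 := by rw [← mul_pow]; norm_num
    have h3 : (c * star (fourierCoef w n)).re
        = (-1) ^ j * ((-1) ^ j * (c * star (fourierCoef w n)).re) := by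
      rw [← mul_assoc, h2, one_mul]
    rw [h3, ← h1, show ((-1 : ℝ) ^ j) = ((-1 : ℝ) ^ j : ℝ) from rfl, ← Complex.re_ofReal_mul]
    congr 1
    simp only [Complex.star_def, map_mul, map_pow, Complex.conj_I, map_prod, Complex.conj_ofReal,
      Complex.conj_ofNat, map_intCast]
    push_cast
    rw [neg_pow Complex.I]
    ring
  -- Test functions are real, so two amplitudes are needed: 1 for the real part and I for the
  -- imaginary part.
  have e1 := key 1
  have e2 := key Complex.I
  have : star (fourierCoef w n)
      = star ((∏ l, (2 * Real.pi * n (i l) : ℂ)) * Complex.I ^ j * fourierCoef f n) := by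
    refine Complex.ext (by simpa using e1) ?_
    simp only [Complex.I_mul_re] at e2
    linarith
  exact star_injective this

/-- Since `weakDeriv` is picked by choice, its linearity holds only almost everywhere and rests on
this uniqueness. -/
theorem IsWeakDeriv.ae_unique {d j : ℕ} {i : Fin j → Fin d} {f v w : (Fin d → ℝ) → ℝ}
    (hf : Integrable f (torusMeasure d)) (hv : IsWeakDeriv i f v) (hw : IsWeakDeriv i f w) :
    v =ᵐ[torusMeasure d] w :=
  ae_eq_of_fourierCoef_eq hv.1 hw.1 fun n => by
    rw [hv.fourierCoef_eq hf, hw.fourierCoef_eq hf]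

lemma summable_sq_fourierCoef {d : ℕ} {w : (Fin d → ℝ) → ℝ} (hw : MemLp w 2 (torusMeasure d)) :
    Summable fun n => ‖fourierCoef w n‖ ^ 2 := by
  let _ : MeasureSpace UnitAddCircle := unitAddCircleMeasureSpace
  have hW : MemLp (fun t : UnitAddTorus (Fin d) => ((w (ofTorus t) : ℝ) : ℂ)) 2 volume :=
    (hw.comp_measurePreserving (measurePreserving_ofTorus d)).ofReal
  have hs := (UnitAddTorus.hasSum_sq_mFourierCoeff hW.toLp).summable
  refine hs.congr fun n => ?_
  rw [← mFourierCoeff_comp_ofTorus]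
  congr 2
  refine integral_congr_ae ?_
  filter_upwards [hW.coeFn_toLp] with t ht
  rw [ht]

lemma summable_int_norm_inv_pow {d p : ℕ} (hp : d < p) :
    Summable fun n : Fin d → ℤ => (‖n‖⁻¹) ^ p := by
  let b := Pi.basisFun ℝ (Fin d)
  let L : Submodule ℤ (Fin d → ℝ) := Submodule.span ℤ (Set.range b)
  have hL : Module.finrank ℤ L = d := by
    rw [ZLattice.rank ℝ L]; simp
  have hs := ZLattice.summable_norm_pow_inv L p (by rw [hL]; exact hp)
  let e : (Fin d → ℤ) → L := fun n => ⟨fun l => (n l : ℝ), by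
    have : (fun l => (n l : ℝ)) = ∑ l, n l • b l := by
      funext l
      simp [b, Finset.sum_apply, Pi.single_apply]
    rw [this]
    exact Submodule.sum_mem _ fun l _ => Submodule.smul_mem _ _
      (Submodule.subset_span ⟨l, rfl⟩)⟩
  have he : Function.Injective e := by
    intro m n h
    funext l
    have : (m l : ℝ) = n l := congrFun (congrArg Subtype.val h) l
    exact_mod_cast this
  refine (hs.comp_injective he).congr fun n => ?_
  have h1 : ‖fun l => (n l : ℝ)‖ = ‖n‖ := by
    simp only [Pi.norm_def]
    congr 2
  have h2 : ‖e n‖ = ‖n‖ := h1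
  simp only [Function.comp, h2]

/-! ### Trigonometric approximation in `H^k_0` -/

lemma integrable_torus_of_continuous {d : ℕ} {f : (Fin d → ℝ) → ℝ} (hf : Continuous f) :
    Integrable f (torusMeasure d) := by
  have h : IntegrableOn f (Set.univ.pi fun _ : Fin d => Set.Icc (0 : ℝ) 1) volume :=
    hf.continuousOn.integrableOn_compact (isCompact_univ_pi fun _ => isCompact_Icc)
  exact h.mono_set (Set.pi_mono fun _ _ => Set.Ico_subset_Icc_self)

lemma MemHk0.integrable {d k : ℕ} {f : (Fin d → ℝ) → ℝ} (hf : MemHk0 k f) :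
    Integrable f (torusMeasure d) :=
  integrable_torus_of_continuous hf.continuous

lemma MemHk0.isWeakDeriv {d k : ℕ} {f : (Fin d → ℝ) → ℝ} (hf : MemHk0 k f) {j : ℕ} (hj : j ≤ k)
    (i : Fin j → Fin d) : IsWeakDeriv i f (weakDeriv i f) := by
  have h := hf.weak_deriv j hj i
  rw [weakDeriv, dif_pos h]
  exact h.choose_spec

lemma MemHk0.fourierCoef_zero {d k : ℕ} {f : (Fin d → ℝ) → ℝ} (hf : MemHk0 k f) :
    fourierCoef f 0 = 0 := by
  have : (∫ x, (f x : ℂ) ∂torusMeasure d) = 0 := by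
    rw [integral_complex_ofReal, hf.mean_zero]; simp
  simpa [fourierCoef, phase] using this

/-- A coefficient is at most ‖n‖^{-k} times that of a pure k-th derivative, and the product is
dominated by the sum of squares. The sum of ‖n‖^{-2k} converges because 2k > d; the frequency 0
drops out by the zero mean. -/
lemma MemHk0.summable_fourierCoef {d k : ℕ} (hk : (d : ℝ) / 2 < k) {f : (Fin d → ℝ) → ℝ}
    (hf : MemHk0 k f) : Summable (fourierCoef f) := by
  have hk' : d < 2 * k := by
    have : (d : ℝ) < 2 * k := by linarith
    exact_mod_cast this
  have hs1 := summable_int_norm_inv_pow hk'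
  have hs2 : Summable fun n : Fin d → ℤ =>
      ∑ l : Fin d, ‖fourierCoef (weakDeriv (fun _ : Fin k => l) f) n‖ ^ 2 :=
    summable_sum fun l _ => summable_sq_fourierCoef (hf.isWeakDeriv le_rfl _).1
  refine Summable.of_norm_bounded (hs1.add hs2) fun n => ?_
  rcases eq_or_ne n 0 with rfl | hn
  · rw [hf.fourierCoef_zero, norm_zero]
    positivity
  have hne : Nonempty (Fin d) := by
    by_contra h
    rw [not_nonempty_iff] at h
    exact hn (Subsingleton.elim _ _)
  -- In the direction where the sup norm is attained, the k-fold derivative multiplies the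
  -- coefficient by exactly (2π‖n‖)^k in modulus.
  obtain ⟨l, hl⟩ : ∃ l, ‖n‖ = ‖n l‖ := by
    obtain ⟨l, -, hl⟩ := Finset.exists_mem_eq_sup Finset.univ Finset.univ_nonempty
      (fun b => ‖n b‖₊)
    refine ⟨l, ?_⟩
    rw [Pi.norm_def, hl]
    rfl
  have hpos : 0 < ‖n‖ := norm_pos_iff.2 hn
  have h1 := (hf.isWeakDeriv le_rfl (fun _ : Fin k => l)).fourierCoef_eq hf.integrable n
  have h2 : ‖fourierCoef (weakDeriv (fun _ : Fin k => l) f) n‖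
      = (2 * Real.pi) ^ k * ‖n‖ ^ k * ‖fourierCoef f n‖ := by
    rw [h1, hl]
    simp only [Finset.prod_const, Finset.card_univ, Fintype.card_fin, norm_mul, norm_pow,
      Complex.norm_I, one_pow, mul_one, Complex.norm_intCast, Complex.norm_ofNat,
      Complex.norm_real, Real.norm_eq_abs, abs_of_pos Real.pi_pos, mul_pow]
    simp [Int.norm_eq_abs]
  have h3 : ‖fourierCoef f n‖
      ≤ ‖n‖⁻¹ ^ k * ‖fourierCoef (weakDeriv (fun _ : Fin k => l) f) n‖ := by
    rw [h2]
    have : (1 : ℝ) ≤ (2 * Real.pi) ^ k := one_le_pow₀ (by linarith [Real.pi_gt_three])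
    have e : ‖n‖⁻¹ ^ k * ((2 * Real.pi) ^ k * ‖n‖ ^ k * ‖fourierCoef f n‖)
        = (2 * Real.pi) ^ k * ‖fourierCoef f n‖ := by
      rw [inv_pow]
      field_simp
    rw [e]
    exact le_mul_of_one_le_left (norm_nonneg _) this
  have h4 : ‖fourierCoef (weakDeriv (fun _ : Fin k => l) f) n‖ ^ 2
      ≤ ∑ l : Fin d, ‖fourierCoef (weakDeriv (fun _ : Fin k => l) f) n‖ ^ 2 :=
    Finset.single_le_sum (f := fun l : Fin d =>
      ‖fourierCoef (weakDeriv (fun _ : Fin k => l) f) n‖ ^ 2)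
      (fun _ _ => by positivity) (Finset.mem_univ l)
  rw [mul_comm 2 k, pow_mul]
  refine h3.trans ?_
  nlinarith [sq_nonneg (‖n‖⁻¹ ^ k - ‖fourierCoef (weakDeriv (fun _ : Fin k => l) f) n‖),
    sq_nonneg (‖n‖⁻¹ ^ k + ‖fourierCoef (weakDeriv (fun _ : Fin k => l) f) n‖)]

lemma isOpenQuotientMap_toTorus (d : ℕ) : IsOpenQuotientMap (toTorus (d := d)) :=
  IsOpenQuotientMap.piMap fun _ => QuotientAddGroup.isOpenQuotientMap_mk

lemma IsPeriodic.comp_ofTorus_toTorus {d : ℕ} {f : (Fin d → ℝ) → ℝ} (hf : IsPeriodic f)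
    (x : Fin d → ℝ) : f (ofTorus (toTorus x)) = f x := by
  have h : ∀ l, ∃ z : ℤ, ofTorus (toTorus x) l = x l + z := by
    intro l
    have h1 : ((ofTorus (toTorus x) l : ℝ) : UnitAddCircle) = (x l : UnitAddCircle) :=
      congrFun (toTorus_ofTorus (toTorus x)) l
    rw [← sub_eq_zero, ← AddCircle.coe_sub, AddCircle.coe_eq_zero_iff] at h1
    obtain ⟨z, hz⟩ := h1
    refine ⟨z, ?_⟩
    rw [zsmul_eq_mul, mul_one] at hz
    linarith
  choose z hz using h
  rw [← hf x z]
  congr 1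
  funext l
  exact hz l

/-- A continuous periodic function descends to a continuous function on the quotient, and summable
coefficients then give convergence at every point. Almost everywhere convergence would not do, as
values on the grid are needed. -/
lemma MemHk0.hasSum_wave {d k : ℕ} (hk : (d : ℝ) / 2 < k) {f : (Fin d → ℝ) → ℝ}
    (hf : MemHk0 k f) (x : Fin d → ℝ) : HasSum (fun n => wave (fourierCoef f n) n x) (f x) := by
  let _ : MeasureSpace UnitAddCircle := unitAddCircleMeasureSpace
  have hc : Continuous fun t : UnitAddTorus (Fin d) => ((f (ofTorus t) : ℝ) : ℂ) := by
    rw [(isOpenQuotientMap_toTorus d).continuous_comp_iff.symm]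
    have : (fun t : UnitAddTorus (Fin d) => ((f (ofTorus t) : ℝ) : ℂ)) ∘ toTorus
        = fun x => ((f x : ℝ) : ℂ) := by
      funext x
      simp only [Function.comp, hf.periodic.comp_ofTorus_toTorus]
    rw [this]
    exact Complex.continuous_ofReal.comp hf.continuous
  let F : C(UnitAddTorus (Fin d), ℂ) := ⟨_, hc⟩
  have hco : UnitAddTorus.mFourierCoeff F = fourierCoef f := by
    funext n
    exact mFourierCoeff_comp_ofTorus f n
  have hs := UnitAddTorus.hasSum_mFourier_series_apply_of_summable (f := F)
    (by rw [hco]; exact hf.summable_fourierCoef hk) (toTorus x)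
  have h1 := Complex.hasSum_re hs
  simp only [hco, mFourier_toTorus] at h1
  have h2 : (F (toTorus x)).re = f x := by
    simp [F, hf.periodic.comp_ofTorus_toTorus]
  rw [h2] at h1
  exact h1

/-- The partial Fourier sums of `f`. -/
def fourierPartialSum {d : ℕ} (f : (Fin d → ℝ) → ℝ) (S : Finset (Fin d → ℤ)) :
    (Fin d → ℝ) → ℝ := partialSum (fourierCoef f) S

theorem MemHk0.tendsto_fourierPartialSum {d k : ℕ} (hk : (d : ℝ) / 2 < k)
    {f : (Fin d → ℝ) → ℝ} (hf : MemHk0 k f) (x : Fin d → ℝ) :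
    Tendsto (fun S => fourierPartialSum f S x) atTop (nhds (f x)) := by
  have := hf.hasSum_wave hk x
  refine Tendsto.congr (fun S => ?_) this
  rw [fourierPartialSum, partialSum_eq_sum_wave]

/-- The derivative of a Fourier partial sum is the partial sum for the weak derivative. Together
with pointwise convergence this passes local estimates from smooth functions to all of H^k_0. -/
theorem MemHk0.tendsto_partialDeriv_fourierPartialSum {d k : ℕ} {f : (Fin d → ℝ) → ℝ}
    (hf : MemHk0 k f) (i : Fin k → Fin d) :
    Tendsto (fun S => eLpNorm (fun x => partialDeriv i (fourierPartialSum f S) x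
      - weakDeriv i f x) 2 (torusMeasure d)) atTop (nhds 0) := by
  have h := hf.isWeakDeriv le_rfl i
  have h1 := tendsto_eLpNorm_partialSum h.1
  refine h1.congr fun S => ?_
  rw [fourierPartialSum, partialDeriv_partialSum]
  have : fourierCoef (weakDeriv i f)
      = fun n => (∏ l, (2 * Real.pi * n (i l) : ℂ)) * Complex.I ^ k * fourierCoef f n :=
    funext fun n => h.fourierCoef_eq hf.integrable n
  rw [this]

/-! ### The Hilbert space structure -/

lemma IsWeakDeriv.sub {d j : ℕ} {i : Fin j → Fin d} {f g v w : (Fin d → ℝ) → ℝ}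
    (hf : Continuous f) (hg : Continuous g)
    (hv : IsWeakDeriv i f v) (hw : IsWeakDeriv i g w) : IsWeakDeriv i (f - g) (v - w) := by
  refine ⟨hv.1.sub hw.1, fun φ hφ hφp => ?_⟩
  have hφc : Continuous φ := hφ.continuous
  have hdc : Continuous (partialDeriv i φ) := by
    have h1 : Continuous (iteratedFDeriv ℝ j φ) :=
      hφ.continuous_iteratedFDeriv (by exact_mod_cast le_top)
    unfold partialDeriv
    fun_prop
  have hb : MemLp φ 2 (torusMeasure d) :=
    (memLp_two_iff_integrable_sq hφc.aestronglyMeasurable).2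
      (integrable_torus_of_continuous (hφc.pow 2))
  have i1 : Integrable (fun x => f x * partialDeriv i φ x) (torusMeasure d) := integrable_torus_of_continuous (hf.mul hdc)
  have i2 : Integrable (fun x => g x * partialDeriv i φ x) (torusMeasure d) :=
    integrable_torus_of_continuous (hg.mul hdc)
  have i3 : Integrable (fun x => v x * φ x) (torusMeasure d) := hv.1.integrable_mul hb
  have i4 : Integrable (fun x => w x * φ x) (torusMeasure d) := hw.1.integrable_mul hb
  simp only [Pi.sub_apply, sub_mul]
  rw [integral_sub i1 i2, integral_sub i3 i4, hv.2 φ hφ hφp, hw.2 φ hφ hφp]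
  ring

lemma MemHk0.sub {d k : ℕ} {f g : (Fin d → ℝ) → ℝ} (hf : MemHk0 k f) (hg : MemHk0 k g) :
    MemHk0 k (f - g) where
  continuous := hf.continuous.sub hg.continuous
  periodic x z := by simp only [Pi.sub_apply, hf.periodic x z, hg.periodic x z]
  mean_zero := by
    simp only [Pi.sub_apply]
    rw [integral_sub hf.integrable hg.integrable, hf.mean_zero, hg.mean_zero, sub_zero]
  weak_deriv j hj i := ⟨_, (hf.isWeakDeriv hj i).sub hf.continuous hg.continuous
    (hg.isWeakDeriv hj i)⟩

lemma weakDeriv_sub {d k : ℕ} {f g : (Fin d → ℝ) → ℝ} (hf : MemHk0 k f) (hg : MemHk0 k g)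
    (i : Fin k → Fin d) :
    weakDeriv i (f - g) =ᵐ[torusMeasure d] weakDeriv i f - weakDeriv i g :=
  ((hf.sub hg).isWeakDeriv le_rfl i).ae_unique (hf.sub hg).integrable
    ((hf.isWeakDeriv le_rfl i).sub hf.continuous hg.continuous (hg.isWeakDeriv le_rfl i))

lemma innerHk_comm {d k : ℕ} (f g : (Fin d → ℝ) → ℝ) : innerHk k f g = innerHk k g f := by
  unfold innerHk
  simp only [mul_comm]

lemma MemHk0.integrable_mul_weakDeriv {d k : ℕ} {f g : (Fin d → ℝ) → ℝ} (hf : MemHk0 k f)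
    (hg : MemHk0 k g) (i : Fin k → Fin d) :
    Integrable (fun x => weakDeriv i f x * weakDeriv i g x) (torusMeasure d) :=
  (hf.isWeakDeriv le_rfl i).1.integrable_mul (hg.isWeakDeriv le_rfl i).1

lemma innerHk_sub_left {d k : ℕ} {f g u : (Fin d → ℝ) → ℝ} (hf : MemHk0 k f) (hg : MemHk0 k g)
    (hu : MemHk0 k u) : innerHk k (f - g) u = innerHk k f u - innerHk k g u := by
  unfold innerHk
  rw [← Finset.sum_sub_distrib]
  refine Finset.sum_congr rfl fun i _ => ?_
  rw [← integral_sub (hf.integrable_mul_weakDeriv hu i) (hg.integrable_mul_weakDeriv hu i)]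
  refine integral_congr_ae ?_
  filter_upwards [weakDeriv_sub hf hg i] with x hx
  rw [hx, Pi.sub_apply, sub_mul]

lemma innerHk_sub_right {d k : ℕ} {f g u : (Fin d → ℝ) → ℝ} (hf : MemHk0 k f) (hg : MemHk0 k g)
    (hu : MemHk0 k u) : innerHk k u (f - g) = innerHk k u f - innerHk k u g := by
  rw [innerHk_comm, innerHk_sub_left hf hg hu, innerHk_comm f, innerHk_comm g]

lemma innerHk_self_nonneg {d k : ℕ} (f : (Fin d → ℝ) → ℝ) : 0 ≤ innerHk k f f :=
  Finset.sum_nonneg fun _ _ => integral_nonneg fun _ => mul_self_nonneg _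

lemma normHk_sq {d k : ℕ} (f : (Fin d → ℝ) → ℝ) : normHk k f ^ 2 = innerHk k f f :=
  Real.sq_sqrt (innerHk_self_nonneg f)

lemma normHk_nonneg {d k : ℕ} (f : (Fin d → ℝ) → ℝ) : 0 ≤ normHk k f := Real.sqrt_nonneg _

/-- The discriminant of this quadratic in t is the Cauchy-Schwarz inequality. -/
lemma integral_lincomb_sq_nonneg {d k : ℕ} {f g : (Fin d → ℝ) → ℝ} (hf : MemHk0 k f)
    (hg : MemHk0 k g) (t : ℝ) :
    0 ≤ innerHk k g g * (t * t) + 2 * innerHk k f g * t + innerHk k f f := by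
  have : innerHk k g g * (t * t) + 2 * innerHk k f g * t + innerHk k f f
      = ∑ i : Fin k → Fin d, ∫ x, (t * weakDeriv i g x + weakDeriv i f x) ^ 2 ∂torusMeasure d := by
    unfold innerHk
    rw [Finset.sum_mul, Finset.mul_sum, Finset.sum_mul, ← Finset.sum_add_distrib,
      ← Finset.sum_add_distrib]
    refine Finset.sum_congr rfl fun i _ => ?_
    have i1 := (hg.integrable_mul_weakDeriv hg i).mul_const (t * t)
    have i2 := ((hf.integrable_mul_weakDeriv hg i).const_mul 2).mul_const t
    have i3 := hf.integrable_mul_weakDeriv hf i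
    rw [← integral_mul_const, ← integral_const_mul, ← integral_mul_const, ← integral_add i1 i2]
    refine (integral_add (i1.add i2) i3).symm.trans ?_
    refine integral_congr_ae (Eventually.of_forall fun x => ?_)
    simp only [Pi.add_apply]
    ring
  rw [this]
  exact Finset.sum_nonneg fun _ _ => integral_nonneg fun _ => sq_nonneg _

lemma innerHk_le_mul_normHk {d k : ℕ} {f g : (Fin d → ℝ) → ℝ} (hf : MemHk0 k f)
    (hg : MemHk0 k g) : innerHk k f g ≤ normHk k f * normHk k g := by
  have h := discrim_le_zero (integral_lincomb_sq_nonneg hf hg)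
  rw [discrim, ← normHk_sq f, ← normHk_sq g] at h
  have h2 : innerHk k f g ^ 2 ≤ (normHk k f * normHk k g) ^ 2 := by nlinarith
  exact le_of_abs_le (abs_le_of_sq_le_sq h2 (mul_nonneg (normHk_nonneg _) (normHk_nonneg _)))

/-! ### The multiresolution norm -/

lemma bddAbove_mrNorm {d m : ℕ} (𝓑 : Set (Cube d)) (y : (Fin d → Fin m) → ℝ) :
    BddAbove (Set.range fun B : 𝓑 =>
      |∑ τ ∈ gridIn m B.1, y τ| / Real.sqrt ((gridIn m B.1).card : ℝ)) := by
  refine ((Set.finite_range fun S : Finset (Fin d → Fin m) =>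
    |∑ τ ∈ S, y τ| / Real.sqrt (S.card : ℝ)).subset ?_).bddAbove
  rintro _ ⟨B, rfl⟩
  exact ⟨gridIn m B.1, rfl⟩

lemma abs_sum_gridIn_le {d m : ℕ} {𝓑 : Set (Cube d)} {y : (Fin d → Fin m) → ℝ} {γ : ℝ}
    (h : mrNorm 𝓑 y ≤ γ) {B : Cube d} (hB : B ∈ 𝓑) :
    |∑ τ ∈ gridIn m B, y τ| ≤ γ * Real.sqrt ((gridIn m B).card : ℝ) := by
  -- Without grid points the quotient is 0 / 0 = 0 and carries no information, but both sides of the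
  -- claim vanish.
  rcases (gridIn m B).eq_empty_or_nonempty with h0 | h0
  · simp [h0]
  · rw [← div_le_iff₀ (Real.sqrt_pos.2 (by exact_mod_cast h0.card_pos))]
    exact (le_ciSup (bddAbove_mrNorm 𝓑 y) ⟨B, hB⟩).trans h

lemma mrNorm_le {d m : ℕ} {𝓑 : Set (Cube d)} {y : (Fin d → Fin m) → ℝ} {γ : ℝ} (hγ : 0 ≤ γ)
    (h : ∀ B ∈ 𝓑, |∑ τ ∈ gridIn m B, y τ| ≤ γ * Real.sqrt ((gridIn m B).card : ℝ)) :
    mrNorm 𝓑 y ≤ γ := by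
  refine Real.iSup_le (fun B => ?_) hγ
  exact div_le_of_le_mul₀ (Real.sqrt_nonneg _) hγ (h B.1 B.2)

lemma mrNorm_nonneg {d m : ℕ} (𝓑 : Set (Cube d)) (y : (Fin d → Fin m) → ℝ) : 0 ≤ mrNorm 𝓑 y :=
  Real.iSup_nonneg fun _ => by positivity

lemma mrNorm_sub_le {d m : ℕ} {𝓑 : Set (Cube d)} {y z : (Fin d → Fin m) → ℝ} {a b : ℝ}
    (hy : mrNorm 𝓑 y ≤ a) (hz : mrNorm 𝓑 z ≤ b) : mrNorm 𝓑 (y - z) ≤ a + b := by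
  refine mrNorm_le (add_nonneg ((mrNorm_nonneg 𝓑 y).trans hy) ((mrNorm_nonneg 𝓑 z).trans hz))
    fun B hB => ?_
  simp only [Pi.sub_apply, Finset.sum_sub_distrib]
  refine (abs_sub _ _).trans ?_
  rw [add_mul]
  exact add_le_add (abs_sum_gridIn_le hy hB) (abs_sum_gridIn_le hz hB)

lemma mrNorm_smul_le {d m : ℕ} {𝓑 : Set (Cube d)} {y : (Fin d → Fin m) → ℝ} {a : ℝ}
    (hy : mrNorm 𝓑 y ≤ a) (c : ℝ) : mrNorm 𝓑 (c • y) ≤ |c| * a := by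
  refine mrNorm_le (mul_nonneg (abs_nonneg _) ((mrNorm_nonneg 𝓑 y).trans hy)) fun B hB => ?_
  simp only [Pi.smul_apply, smul_eq_mul, ← Finset.mul_sum, abs_mul, mul_assoc]
  exact mul_le_mul_of_nonneg_left (abs_sum_gridIn_le hy hB) (abs_nonneg _)

lemma sum_mul_le_of_dualMrNorm_le {d m : ℕ} {𝓑 : Set (Cube d)} {w v : (Fin d → Fin m) → ℝ}
    {t a : ℝ} (hw : dualMrNorm 𝓑 w ≤ (t : EReal)) (ha : 0 < a) (hv : mrNorm 𝓑 v ≤ a) :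
    ∑ τ, w τ * v τ ≤ a * t := by
  have h1 : mrNorm 𝓑 (a⁻¹ • v) ≤ 1 := by
    refine (mrNorm_smul_le hv _).trans ?_
    rw [abs_of_pos (inv_pos.2 ha), inv_mul_cancel₀ ha.ne']
  have h2 := (le_iSup (fun v : {v : (Fin d → Fin m) → ℝ // mrNorm 𝓑 v ≤ 1} =>
    ((∑ τ, w τ * v.1 τ : ℝ) : EReal)) ⟨_, h1⟩).trans hw
  have h3 : ∑ τ, w τ * (a⁻¹ • v) τ ≤ t := EReal.coe_le_coe_iff.1 h2
  have h4 : ∑ τ, w τ * (a⁻¹ • v) τ = a⁻¹ * ∑ τ, w τ * v τ := by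
    rw [Finset.mul_sum]
    refine Finset.sum_congr rfl fun τ _ => ?_
    simp only [Pi.smul_apply, smul_eq_mul]
    ring
  rwa [h4, inv_mul_le_iff₀ ha] at h3

/-! ### The energy estimate for the estimator -/

lemma le_of_sq_le_two_mul_add {x a b : ℝ} (ha : 0 ≤ a) (hb : 0 ≤ b)
    (h : x ^ 2 ≤ 2 * a * x + b) : x ≤ 2 * a + Real.sqrt b := by
  have hs := Real.sq_sqrt hb
  have hs0 := Real.sqrt_nonneg b
  by_contra! hc
  nlinarith [mul_nonneg ha hs0]

/-- With e = g - f, feasibility of f gives ‖e‖² ≤ -2⟨f, e⟩ = 2⟨h - f, e⟩ - 2⟨h, e⟩. The last product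
is the pairing of w with the samples of e, bounded by duality; the rest is a quadratic inequality
for ‖e‖. -/
theorem IsMIND.normHk_sub_le {d m k : ℕ} {𝓑 : Set (Cube d)} {f g h : (Fin d → ℝ) → ℝ}
    {ξ w : (Fin d → Fin m) → ℝ} {γ t : ℝ} (hγ : 0 < γ) (ht : 0 ≤ t) (hf : MemHk0 k f)
    (hξ : mrNorm 𝓑 ξ ≤ γ) (hg : IsMIND k 𝓑 (fun τ => sample m f τ + ξ τ) γ g)
    (hw : dualMrNorm 𝓑 w ≤ (t : EReal)) (hh : IsSampleAdjoint k w h) :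
    mrNorm 𝓑 (sample m (g - f)) ≤ 2 * γ ∧
      normHk k (g - f) ≤ 2 * normHk k (h - f) + 2 * Real.sqrt (γ * t) := by
  obtain ⟨hg0, hgc, hgm⟩ := hg
  have hfc : mrNorm 𝓑 (sample m f - fun τ => sample m f τ + ξ τ) ≤ γ := by
    have e : (sample m f - fun τ => sample m f τ + ξ τ) = (-1 : ℝ) • ξ := by
      funext τ; simp
    rw [e]
    simpa using mrNorm_smul_le hξ (-1)
  have hmin := hgm f hf hfc
  rw [normHk_sq, normHk_sq] at hmin
  have he : MemHk0 k (g - f) := hg0.sub hf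
  have hS : mrNorm 𝓑 (sample m (g - f)) ≤ 2 * γ := by
    have e : sample m (g - f) = (sample m g - fun τ => sample m f τ + ξ τ)
        - (sample m f - fun τ => sample m f τ + ξ τ) := by
      funext τ
      simp only [sample, Pi.sub_apply]
      ring
    rw [e, two_mul]
    exact mrNorm_sub_le hgc hfc
  refine ⟨hS, ?_⟩
  have h1 : innerHk k (g - f) (g - f) + 2 * innerHk k f (g - f) ≤ 0 := by
    rw [innerHk_sub_left hg0 hf he, innerHk_sub_right hg0 hf hg0, innerHk_sub_right hg0 hf hf,
      innerHk_comm f g]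
    linarith
  have h2 : innerHk k (h - f) (g - f) ≤ normHk k (h - f) * normHk k (g - f) :=
    innerHk_le_mul_normHk (hh.1.sub hf) he
  rw [innerHk_sub_left hh.1 hf he] at h2
  have h3 : -innerHk k h (g - f) ≤ 2 * γ * t := by
    rw [innerHk_comm, ← hh.2 _ he]
    have h4 : mrNorm 𝓑 ((-1 : ℝ) • sample m (g - f)) ≤ 2 * γ := by
      simpa using mrNorm_smul_le hS (-1)
    refine le_trans (le_of_eq ?_) (sum_mul_le_of_dualMrNorm_le hw (by positivity) h4)
    rw [← Finset.sum_neg_distrib]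
    refine Finset.sum_congr rfl fun τ _ => ?_
    simp only [Pi.smul_apply, smul_eq_mul]
    ring
  have h5 : normHk k (g - f) ^ 2
      ≤ 2 * normHk k (h - f) * normHk k (g - f) + 4 * (γ * t) := by
    rw [normHk_sq]
    linarith
  have h6 := le_of_sq_le_two_mul_add (normHk_nonneg (k := k) (h - f))
    (by positivity : 0 ≤ 4 * (γ * t)) h5
  rwa [Real.sqrt_mul (by norm_num) (γ * t), show Real.sqrt 4 = 2 by
    rw [show (4 : ℝ) = 2 ^ 2 by norm_num, Real.sqrt_sq (by norm_num)]] at h6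

lemma isSampleAdjoint_zero {d m k : ℕ} : 
    IsSampleAdjoint (d := d) (m := m) k 0 (0 : (Fin d → ℝ) → ℝ) := by
  have h0 : MemHk0 k (0 : (Fin d → ℝ) → ℝ) :=
    { continuous := continuous_const
      periodic := fun _ _ => rfl
      mean_zero := by simp
      weak_deriv := fun j _ i => ⟨0, MemLp.zero, by simp⟩ }
  refine ⟨h0, fun u hu => ?_⟩
  -- The chosen weak derivative of 0 need not be literally 0, so the product with 0 is computed by
  -- linearity from 0 = 0 - 0.
  have h1 := innerHk_sub_right h0 h0 hu
  rw [sub_zero] at h1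
  simp only [Pi.zero_apply, mul_zero, Finset.sum_const_zero]
  linarith

lemma dualMrNorm_zero_le {d m : ℕ} (𝓑 : Set (Cube d)) {t : ℝ} (ht : 0 ≤ t) :
    dualMrNorm 𝓑 (0 : (Fin d → Fin m) → ℝ) ≤ (t : EReal) := by
  refine iSup_le fun v => ?_
  simpa using ht

/-- Near-minimisers suffice, so attainment of the two infima is never needed; w = 0 makes the inner
set nonempty. -/
lemma exists_near_sourceDefect {d : ℕ} (k m : ℕ) (𝓑 : Set (Cube d)) (f : (Fin d → ℝ) → ℝ) (r : ℝ)
    {ε : ℝ} (hε : 0 < ε) :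
    ∃ t : ℝ, 0 ≤ t ∧ ∃ (w : (Fin d → Fin m) → ℝ) (g : (Fin d → ℝ) → ℝ),
      dualMrNorm 𝓑 w ≤ (t : EReal) ∧ IsSampleAdjoint k w g ∧
      normHk k (g - f) + Real.log ((m : ℝ) ^ d) ^ (r / 2) * Real.sqrt t
        ≤ sourceDefect k m 𝓑 f r + ε := by
  obtain ⟨_, ⟨t, ht, rfl⟩, h1⟩ := Real.lt_sInf_add_pos (s := (fun t : ℝ => distFun k m 𝓑 f t
    + Real.log ((m : ℝ) ^ d) ^ (r / 2) * Real.sqrt t) '' Set.Ici 0)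
    ((Set.nonempty_Ici).image _) (half_pos hε)
  obtain ⟨_, ⟨w, g, hw, hg, rfl⟩, h2⟩ := Real.lt_sInf_add_pos (s := {ρ : ℝ |
    ∃ (w : (Fin d → Fin m) → ℝ) (g : (Fin d → ℝ) → ℝ), dualMrNorm 𝓑 w ≤ (t : EReal) ∧
      IsSampleAdjoint k w g ∧ ρ = normHk k (g - f)})
    ⟨_, 0, 0, dualMrNorm_zero_le 𝓑 ht, isSampleAdjoint_zero, rfl⟩ (half_pos hε)
  refine ⟨t, ht, w, g, hw, hg, ?_⟩
  change _ < sourceDefect k m 𝓑 f r + ε / 2 at h1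
  change _ < distFun k m 𝓑 f t + ε / 2 at h2
  simp only at h1
  linarith

theorem IsMIND.normHk_sub_le_sourceDefect {d m k : ℕ} {𝓑 : Set (Cube d)} {f g : (Fin d → ℝ) → ℝ}
    {ξ : (Fin d → Fin m) → ℝ} {r Cγ : ℝ} (hCγ : 0 < Cγ) (hlog : 0 < Real.log ((m : ℝ) ^ d))
    (hf : MemHk0 k f) (hξ : mrNorm 𝓑 ξ ≤ Cγ * Real.log ((m : ℝ) ^ d) ^ r)
    (hg : IsMIND k 𝓑 (fun τ => sample m f τ + ξ τ) (Cγ * Real.log ((m : ℝ) ^ d) ^ r) g) :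
    mrNorm 𝓑 (sample m (g - f)) ≤ 2 * (Cγ * Real.log ((m : ℝ) ^ d) ^ r) ∧
    ∀ ε, 0 < ε → normHk k (g - f)
      ≤ 2 * (1 + Real.sqrt Cγ) * (sourceDefect k m 𝓑 f r + ε) := by
  have hγ : 0 < Cγ * Real.log ((m : ℝ) ^ d) ^ r := by positivity
  -- The bound on the samples does not involve w, so w = 0 and t = 0 serve.
  refine ⟨(IsMIND.normHk_sub_le hγ le_rfl hf hξ hg (dualMrNorm_zero_le 𝓑 le_rfl)
    isSampleAdjoint_zero).1, fun ε hε => ?_⟩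
  obtain ⟨t, ht, w, h, hw, hh, hle⟩ := exists_near_sourceDefect k m 𝓑 f r hε
  have h1 := (IsMIND.normHk_sub_le hγ ht hf hξ hg hw hh).2
  have h2 : Real.sqrt (Cγ * Real.log ((m : ℝ) ^ d) ^ r * t)
      = Real.sqrt Cγ * (Real.log ((m : ℝ) ^ d) ^ (r / 2) * Real.sqrt t) := by
    rw [mul_assoc, Real.sqrt_mul hCγ.le, Real.sqrt_mul (by positivity),
      Real.sqrt_eq_rpow (_ ^ r), ← Real.rpow_mul hlog.le]
    congr 3
    ring
  rw [h2] at h1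
  have h3 := normHk_nonneg (k := k) (h - f)
  have h4 : 0 ≤ Real.log ((m : ℝ) ^ d) ^ (r / 2) * Real.sqrt t := by positivity
  have h5 := Real.sqrt_nonneg Cγ
  have h6 := mul_le_mul_of_nonneg_left hle (by positivity : 0 ≤ 2 * (1 + Real.sqrt Cγ))
  nlinarith [mul_nonneg h5 h3]

/-! ### Taylor expansion with a remainder in `L²` -/

/-- The Taylor polynomial of order `k - 1` of `G` at `y`, evaluated at `x`. -/
def taylorPoly {d : ℕ} (k : ℕ) (G : (Fin d → ℝ) → ℝ) (y x : Fin d → ℝ) : ℝ :=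
  ∑ j ∈ Finset.range k, ((j.factorial : ℝ)⁻¹) *
    ∑ i : Fin j → Fin d, (∏ l, (x (i l) - y (i l))) * partialDeriv i G y

/-- The sum of the absolute values of all partial derivatives of order `k`. -/
def absDeriv {d : ℕ} (k : ℕ) (G : (Fin d → ℝ) → ℝ) (z : Fin d → ℝ) : ℝ :=
  ∑ i : Fin k → Fin d, |partialDeriv i G z|

lemma continuous_partialDeriv {d j : ℕ} {G : (Fin d → ℝ) → ℝ} (hG : ContDiff ℝ (⊤ : ℕ∞) G)
    (i : Fin j → Fin d) : Continuous (partialDeriv i G) := by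
  have h1 : Continuous (iteratedFDeriv ℝ j G) :=
    hG.continuous_iteratedFDeriv (by exact_mod_cast le_top)
  unfold partialDeriv
  fun_prop

lemma continuous_absDeriv {d : ℕ} (k : ℕ) {G : (Fin d → ℝ) → ℝ} (hG : ContDiff ℝ (⊤ : ℕ∞) G) :
    Continuous (absDeriv k G) := by
  unfold absDeriv
  exact continuous_finsetSum _ fun i _ => (continuous_partialDeriv hG i).abs

lemma iteratedFDeriv_apply_eq_sum_partialDeriv {d j : ℕ} (G : (Fin d → ℝ) → ℝ)
    (z v : Fin d → ℝ) :
    iteratedFDeriv ℝ j G z (fun _ => v)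
      = ∑ i : Fin j → Fin d, (∏ l, v (i l)) * partialDeriv i G z := by
  have hv : v = ∑ l, v l • (Pi.single l (1 : ℝ) : Fin d → ℝ) := by
    funext a
    simp [Finset.sum_apply, Pi.single_apply]
  conv_lhs => rw [hv]
  rw [ContinuousMultilinearMap.map_sum]
  refine Finset.sum_congr rfl fun i _ => ?_
  rw [ContinuousMultilinearMap.map_smul_univ]
  rfl

lemma iteratedDeriv_comp_segment {d : ℕ} {G : (Fin d → ℝ) → ℝ} (hG : ContDiff ℝ (⊤ : ℕ∞) G)
    (y v : Fin d → ℝ) (j : ℕ) (s : ℝ) :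
    iteratedDeriv j (fun s : ℝ => G (y + s • v)) s
      = ∑ i : Fin j → Fin d, (∏ l, v (i l)) * partialDeriv i G (y + s • v) := by
  rw [← iteratedFDeriv_apply_eq_sum_partialDeriv, iteratedDeriv_eq_iteratedFDeriv]
  have h1 := (ContinuousLinearMap.toSpanSingleton ℝ v).iteratedFDeriv_comp_right
    (f := fun z => G (y + z)) (n := j) (i := j)
    ((hG.of_le (by exact_mod_cast le_top)).comp (contDiff_const.add contDiff_id)) s le_rfl
  have h2 : (fun s : ℝ => G (y + s • v))
      = (fun z => G (y + z)) ∘ (ContinuousLinearMap.toSpanSingleton ℝ v) := by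
    funext s; simp
  rw [h2, h1, iteratedFDeriv_comp_add_left]
  simp

/-- Integral form of the remainder along the segment from y to x. Coordinates of x - y are at most h
in the sup norm, and the factor 1/(k-1)! is dropped. -/
lemma abs_sub_taylorPoly_le {d k : ℕ} (hk : 0 < k) {G : (Fin d → ℝ) → ℝ}
    (hG : ContDiff ℝ (⊤ : ℕ∞) G) {x y : Fin d → ℝ} {h : ℝ} (hxy : ‖x - y‖ ≤ h) :
    ‖G x - taylorPoly k G y x‖ₑ ≤ ∫⁻ s in Set.Ioo (0 : ℝ) 1, ENNReal.ofReal (h ^ k) *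
      (ENNReal.ofReal ((1 - s) ^ (k - 1)) * ‖absDeriv k G (y + s • (x - y))‖ₑ) := by
  obtain ⟨n, rfl⟩ : ∃ n, k = n + 1 := ⟨k - 1, by omega⟩
  have hG' : ContDiff ℝ (⊤ : ℕ∞) (fun s : ℝ => G (y + s • (x - y))) :=
    hG.comp (contDiff_const.add (contDiff_id.smul contDiff_const))
  have hu : UniqueDiffOn ℝ (Set.uIcc (0 : ℝ) 1) := by
    rw [Set.uIcc_of_le zero_le_one]; exact uniqueDiffOn_Icc zero_lt_one
  have hder : ∀ j : ℕ, ∀ s ∈ Set.uIcc (0 : ℝ) 1,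
      iteratedDerivWithin j (fun s : ℝ => G (y + s • (x - y))) (Set.uIcc 0 1) s
        = ∑ i : Fin j → Fin d, (∏ l, (x - y) (i l)) * partialDeriv i G (y + s • (x - y)) := by
    intro j s hs
    rw [iteratedDerivWithin_eq_iteratedDeriv hu
      ((hG'.of_le (by exact_mod_cast le_top)).contDiffAt) hs, iteratedDeriv_comp_segment hG]
  have ht := taylor_integral_remainder (f := fun s : ℝ => G (y + s • (x - y))) (x := 1) (x₀ := 0)
    (n := n) ((hG'.of_le (by exact_mod_cast le_top)).contDiffOn)
  have hT : taylorWithinEval (fun s : ℝ => G (y + s • (x - y))) n (Set.uIcc 0 1) 0 1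
      = taylorPoly (n + 1) G y x := by
    rw [taylor_within_apply, taylorPoly]
    refine Finset.sum_congr rfl fun j _ => ?_
    rw [hder j 0 Set.left_mem_uIcc]
    simp
  rw [hT] at ht
  simp only [one_smul, add_sub_cancel] at ht
  rw [ht, intervalIntegral.integral_of_le zero_le_one, integral_Ioc_eq_integral_Ioo]
  refine (enorm_integral_le_lintegral_enorm _).trans ?_
  refine setLIntegral_mono' measurableSet_Ioo fun s hs => ?_
  have hs' : s ∈ Set.uIcc (0 : ℝ) 1 := by
    rw [Set.uIcc_of_le zero_le_one]; exact Set.Ioo_subset_Icc_self hs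
  have h0 : 0 ≤ h := (norm_nonneg _).trans hxy
  rw [hder (n + 1) s hs']
  have hb : |∑ i : Fin (n + 1) → Fin d, (∏ l, (x - y) (i l)) * partialDeriv i G (y + s • (x - y))|
      ≤ h ^ (n + 1) * absDeriv (n + 1) G (y + s • (x - y)) := by
    rw [absDeriv, Finset.mul_sum]
    refine (Finset.abs_sum_le_sum_abs _ _).trans (Finset.sum_le_sum fun i _ => ?_)
    rw [abs_mul, Finset.abs_prod]
    refine mul_le_mul_of_nonneg_right ?_ (abs_nonneg _)
    calc ∏ l, |(x - y) (i l)| ≤ ∏ _l : Fin (n + 1), h :=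
          Finset.prod_le_prod (fun _ _ => abs_nonneg _)
            fun l _ => (norm_le_pi_norm (x - y) (i l)).trans hxy
      _ = h ^ (n + 1) := by simp
  have hA : 0 ≤ absDeriv (n + 1) G (y + s • (x - y)) :=
    Finset.sum_nonneg fun _ _ => abs_nonneg _
  have hs1 : 0 ≤ (1 - s) ^ n := pow_nonneg (by linarith [hs.2]) _
  rw [Real.enorm_eq_ofReal hA, ← ENNReal.ofReal_mul (by simpa using hs1),
    ← ENNReal.ofReal_mul (by positivity), Real.enorm_eq_ofReal_abs]
  refine ENNReal.ofReal_le_ofReal ?_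
  rw [smul_eq_mul, abs_mul, abs_of_nonneg (by positivity), Nat.add_sub_cancel]
  calc (1 - s) ^ n / (n.factorial : ℝ) * _ ≤ (1 - s) ^ n * (h ^ (n + 1) *
        absDeriv (n + 1) G (y + s • (x - y))) := by
        refine mul_le_mul ?_ hb (abs_nonneg _) hs1
        exact div_le_self hs1 (by exact_mod_cast Nat.one_le_iff_ne_zero.2 n.factorial_ne_zero)
    _ = _ := by ring

/-- The map y ↦ (1-s)y + sx sends the convex set Q into itself and scales volume by (1-s)^d. -/
lemma setLIntegral_comp_contraction_le {d : ℕ} {Q : Set (Fin d → ℝ)} (hQm : MeasurableSet Q)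
    (hQ : Convex ℝ Q) {x : Fin d → ℝ} (hx : x ∈ Q) {s : ℝ} (hs : s ∈ Set.Ioo (0 : ℝ) 1)
    {F : (Fin d → ℝ) → ℝ≥0∞} (hF : Measurable F) :
    ∫⁻ y in Q, F (y + s • (x - y)) ≤ ENNReal.ofReal (((1 - s) ^ d)⁻¹) * ∫⁻ y in Q, F y := by
  have h1s : 0 < 1 - s := by linarith [hs.2]
  have hFi : Measurable (Q.indicator F) := hF.indicator hQm
  calc ∫⁻ y in Q, F (y + s • (x - y))
      ≤ ∫⁻ y in Q, Q.indicator F ((1 - s) • y + s • x) := by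
        refine setLIntegral_mono' hQm fun y hy => ?_
        have hmem : (1 - s) • y + s • x ∈ Q := hQ hy hx h1s.le hs.1.le (by ring)
        rw [Set.indicator_of_mem hmem]
        refine le_of_eq (congrArg F ?_)
        rw [smul_sub, sub_smul, one_smul]
        abel
    _ ≤ ∫⁻ y, Q.indicator F ((1 - s) • y + s • x) := setLIntegral_le_lintegral _ _
    _ = ∫⁻ z, Q.indicator F (z + s • x) ∂Measure.map (fun y => (1 - s) • y) volume := by
        rw [lintegral_map (by fun_prop) (by fun_prop)]
    _ = ENNReal.ofReal (((1 - s) ^ d)⁻¹) * ∫⁻ z, Q.indicator F (z + s • x) := by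
        rw [Measure.map_addHaar_smul _ h1s.ne', lintegral_smul_measure, smul_eq_mul]
        simp [abs_of_pos h1s]
    _ = _ := by
        rw [lintegral_add_right_eq_self, lintegral_indicator hQm]

lemma lintegral_le_rpow_measure_mul {α : Type*} [MeasurableSpace α] {μ : Measure α}
    {F : α → ℝ≥0∞} (hF : AEMeasurable F μ) :
    ∫⁻ a, F a ∂μ ≤ μ Set.univ ^ (1 / 2 : ℝ) * (∫⁻ a, F a ^ 2 ∂μ) ^ (1 / 2 : ℝ) := by
  have h := ENNReal.lintegral_mul_le_Lp_mul_Lq μ (p := 2) (q := 2)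
    Real.HolderConjugate.two_two (f := fun _ => 1) (g := F) aemeasurable_const hF
  simpa using h

/-- The constant in the Taylor estimate. -/
def taylorConst (k d : ℕ) : ℝ≥0∞ :=
  ∫⁻ s in Set.Ioo (0 : ℝ) 1, ENNReal.ofReal ((1 - s) ^ (k - 1)) *
    ENNReal.ofReal (((1 - s) ^ d)⁻¹) ^ (1 / 2 : ℝ)

/-- The integrand is (1-s)^{k-1-d/2}, integrable at s = 1 because k > d/2. -/
lemma taylorConst_ne_top {k d : ℕ} (hk : (d : ℝ) / 2 < k) : taylorConst k d ≠ ⊤ := by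
  have hk0 : 1 ≤ k := by
    have : (0 : ℝ) < k := lt_of_le_of_lt (by positivity) hk
    exact_mod_cast this
  have hint : IntegrableOn (fun x : ℝ => x ^ ((k : ℝ) - 1 - d / 2)) (Set.Ioo 0 1) volume :=
    (intervalIntegral.integrableOn_Ioo_rpow_iff zero_lt_one).2 (by linarith)
  have h1 : taylorConst k d
      = ∫⁻ s, (Set.Ioo (0 : ℝ) 1).indicator
          (fun t => ENNReal.ofReal (t ^ ((k : ℝ) - 1 - d / 2))) (1 - s) := by
    rw [taylorConst, ← lintegral_indicator measurableSet_Ioo]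
    refine lintegral_congr fun s => ?_
    by_cases hs : s ∈ Set.Ioo (0 : ℝ) 1
    · have hs' : 1 - s ∈ Set.Ioo (0 : ℝ) 1 := ⟨by linarith [hs.2], by linarith [hs.1]⟩
      rw [Set.indicator_of_mem hs, Set.indicator_of_mem hs',
        ENNReal.ofReal_rpow_of_pos (by have := hs'.1; positivity),
        ← ENNReal.ofReal_mul (by have := hs'.1; positivity)]
      congr 1
      rw [← Real.rpow_natCast, ← Real.rpow_natCast, ← Real.rpow_neg hs'.1.le,
        ← Real.rpow_mul hs'.1.le, ← Real.rpow_add hs'.1]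
      congr 1
      push_cast [hk0]
      ring
    · have hs' : 1 - s ∉ Set.Ioo (0 : ℝ) 1 := by
        intro h; exact hs ⟨by linarith [h.2], by linarith [h.1]⟩
      rw [Set.indicator_of_notMem hs, Set.indicator_of_notMem hs']
  rw [h1, lintegral_sub_left_eq_self (fun t => (Set.Ioo (0 : ℝ) 1).indicator
    (fun t => ENNReal.ofReal (t ^ ((k : ℝ) - 1 - d / 2))) t), lintegral_indicator measurableSet_Ioo]
  exact hint.lintegral_lt_top.ne

/-- Averaging over the base point y, with x fixed, is what allows D^k G to be controlled only in L².
For each s, Cauchy-Schwarz in y and the contraction towards x cost a factor (1-s)^{-d/2}. -/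
theorem lintegral_taylor_remainder_le {d k : ℕ} (hk : 0 < k) {G : (Fin d → ℝ) → ℝ}
    (hG : ContDiff ℝ (⊤ : ℕ∞) G) {Q : Set (Fin d → ℝ)} (hQm : MeasurableSet Q)
    (hQ : Convex ℝ Q) {h : ℝ} (hQh : ∀ x ∈ Q, ∀ y ∈ Q, ‖x - y‖ ≤ h) {x : Fin d → ℝ} (hx : x ∈ Q) :
    ∫⁻ y in Q, ‖G x - taylorPoly k G y x‖ₑ ≤ ENNReal.ofReal (h ^ k) * (taylorConst k d *
      (volume Q ^ (1 / 2 : ℝ) * (∫⁻ y in Q, ‖absDeriv k G y‖ₑ ^ 2) ^ (1 / 2 : ℝ))) := by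
  have hAc := continuous_absDeriv k hG
  have hmeas : Measurable (Function.uncurry fun (y : Fin d → ℝ) (s : ℝ) =>
      ENNReal.ofReal (h ^ k) *
      (ENNReal.ofReal ((1 - s) ^ (k - 1)) * ‖absDeriv k G (y + s • (x - y))‖ₑ)) := by
    have h1 : Continuous fun p : (Fin d → ℝ) × ℝ => absDeriv k G (p.1 + p.2 • (x - p.1)) :=
      hAc.comp (by fun_prop)
    have h2 := h1.measurable.enorm
    unfold Function.uncurry
    fun_prop
  have hmA : Measurable fun z => ‖absDeriv k G z‖ₑ := hAc.measurable.enorm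
  calc ∫⁻ y in Q, ‖G x - taylorPoly k G y x‖ₑ
      ≤ ∫⁻ y in Q, ∫⁻ s in Set.Ioo (0 : ℝ) 1, ENNReal.ofReal (h ^ k) *
      (ENNReal.ofReal ((1 - s) ^ (k - 1)) * ‖absDeriv k G (y + s • (x - y))‖ₑ) :=
        setLIntegral_mono' hQm fun y hy => abs_sub_taylorPoly_le hk hG (hQh x hx y hy)
    _ = ∫⁻ s in Set.Ioo (0 : ℝ) 1, ∫⁻ y in Q, ENNReal.ofReal (h ^ k) *
      (ENNReal.ofReal ((1 - s) ^ (k - 1)) * ‖absDeriv k G (y + s • (x - y))‖ₑ) :=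
        lintegral_lintegral_swap hmeas.aemeasurable
    _ ≤ ∫⁻ s in Set.Ioo (0 : ℝ) 1, ENNReal.ofReal (h ^ k) *
      (ENNReal.ofReal ((1 - s) ^ (k - 1)) * ENNReal.ofReal (((1 - s) ^ d)⁻¹) ^ (1 / 2 : ℝ) *
        (volume Q ^ (1 / 2 : ℝ) * (∫⁻ y in Q, ‖absDeriv k G y‖ₑ ^ 2) ^ (1 / 2 : ℝ))) := by
        refine setLIntegral_mono' measurableSet_Ioo fun s hs => ?_
        have hc : Continuous fun y : Fin d → ℝ => absDeriv k G (y + s • (x - y)) :=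
          hAc.comp (by fun_prop)
        have hcm := hc.measurable.enorm
        rw [lintegral_const_mul _ (by fun_prop), lintegral_const_mul _ hcm]
        refine mul_le_mul_right ?_ _
        rw [mul_assoc]
        refine mul_le_mul_right ?_ _
        refine (lintegral_le_rpow_measure_mul hcm.aemeasurable).trans ?_
        rw [Measure.restrict_apply_univ, mul_left_comm]
        refine mul_le_mul_right ?_ _
        rw [← ENNReal.mul_rpow_of_nonneg _ _ (by norm_num)]
        refine ENNReal.rpow_le_rpow ?_ (by norm_num)
        exact setLIntegral_comp_contraction_le hQm hQ hx hs (F := fun z => ‖absDeriv k G z‖ₑ ^ 2)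
          (by fun_prop)
    _ = _ := by
        rw [lintegral_const_mul _ (by fun_prop), lintegral_mul_const _ (by fun_prop)]
        rfl

/-! ### Oscillation of polynomials -/

lemma exists_abs_equivFun_le {E : Type*} [NormedAddCommGroup E] [NormedSpace ℝ E] {ι : Type*}
    [Fintype ι] (b : Module.Basis ι ℝ E) :
    ∃ C > 0, ∀ (v : E) (i : ι), |b.equivFun v i| ≤ C * ‖v‖ := by
  have : FiniteDimensional ℝ E := b.finiteDimensional_of_finite
  let φ : E →L[ℝ] (ι → ℝ) := LinearMap.toContinuousLinearMap b.equivFun.toLinearMap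
  obtain ⟨C, hC, hφ⟩ := φ.bound
  exact ⟨C, hC, fun v i => (norm_le_pi_norm (φ v) i).trans (hφ v)⟩

/-- Coordinates in a basis are bounded by the norm, and the finitely many basis functions are
uniformly continuous on the compact space. -/
lemma exists_equicontinuity_of_finiteDimensional {K : Type*} [MetricSpace K] [CompactSpace K]
    (V : Submodule ℝ C(K, ℝ)) [FiniteDimensional ℝ V] {ε : ℝ} (hε : 0 < ε) :
    ∃ δ > 0, ∀ P ∈ V, ∀ x y : K, dist x y < δ → |P x - P y| ≤ ε * ‖P‖ := by
  obtain ⟨n, ⟨b⟩⟩ : ∃ n : ℕ, Nonempty (Module.Basis (Fin n) ℝ V) := ⟨_, ⟨Module.finBasis ℝ V⟩⟩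
  obtain ⟨C, hC, hφ⟩ := exists_abs_equivFun_le (E := V) b
  -- The summand 1 keeps the denominator positive when V = 0.
  have hη : 0 < ε / (C * (n + 1)) := by positivity
  have huc : ∀ i : Fin n, ∃ δ > 0, ∀ x y : K, dist x y < δ →
      |(b i : C(K, ℝ)) x - (b i : C(K, ℝ)) y| ≤ ε / (C * (n + 1)) := by
    intro i
    have h := CompactSpace.uniformContinuous_of_continuous (b i : C(K, ℝ)).continuous
    obtain ⟨δ, hδ, h2⟩ := Metric.uniformContinuous_iff.1 h _ hη
    exact ⟨δ, hδ, fun x y hxy => by simpa [Real.dist_eq] using (h2 hxy).le⟩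
  choose δ hδ hδ2 using huc
  obtain ⟨δ0, hδ0, hle⟩ : ∃ δ0 > 0, ∀ i, δ0 ≤ δ i := by
    rcases isEmpty_or_nonempty (Fin n) with h | h
    · exact ⟨1, one_pos, fun i => (h.false i).elim⟩
    · obtain ⟨i0, hi0⟩ := Finite.exists_min δ
      exact ⟨δ i0, hδ i0, hi0⟩
  refine ⟨δ0, hδ0, fun P hP x y hxy => ?_⟩
  have hrep : ∀ z, P z = ∑ i, b.equivFun ⟨P, hP⟩ i * (b i : C(K, ℝ)) z := by
    intro z
    have h1 := b.sum_equivFun ⟨P, hP⟩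
    have h2 := congrArg (fun v : V => (v : C(K, ℝ)) z) h1
    simp only [Submodule.coe_sum, Submodule.coe_smul, ContinuousMap.coe_sum, Finset.sum_apply,
      ContinuousMap.coe_smul, Pi.smul_apply, smul_eq_mul] at h2
    exact h2.symm
  rw [hrep x, hrep y, ← Finset.sum_sub_distrib]
  calc |∑ i, (b.equivFun ⟨P, hP⟩ i * (b i : C(K, ℝ)) x - b.equivFun ⟨P, hP⟩ i * (b i : C(K, ℝ)) y)|
      ≤ ∑ i : Fin n, C * ‖P‖ * (ε / (C * (n + 1))) := by
        refine (Finset.abs_sum_le_sum_abs _ _).trans (Finset.sum_le_sum fun i _ => ?_)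
        rw [← mul_sub, abs_mul]
        refine mul_le_mul ?_ (hδ2 i x y (hxy.trans_le (hle i))) (abs_nonneg _) (by positivity)
        exact hφ ⟨P, hP⟩ i
    _ = ε * ‖P‖ * (n / (n + 1)) := by
        simp only [Finset.sum_const, Finset.card_univ, Fintype.card_fin, nsmul_eq_mul]
        field_simp
    _ ≤ ε * ‖P‖ := by
        refine mul_le_of_le_one_right (by positivity) ?_
        rw [div_le_one (by positivity)]
        linarith

/-- The functions on the unit cube given by polynomials of degree less than `k`. -/
def polySpace (k d : ℕ) : Submodule ℝ C(Set.Icc (0 : Fin d → ℝ) 1, ℝ) :=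
  Submodule.span ℝ (Set.range fun p : (Σ j : Fin k, (Fin j → Fin d) × Finset (Fin j)) =>
    (⟨fun u => ∏ l ∈ p.2.2, u.1 (p.2.1 l), continuous_finsetProd _ fun l _ =>
      (continuous_apply (p.2.1 l)).comp continuous_subtype_val⟩ : C(Set.Icc (0 : Fin d → ℝ) 1, ℝ)))

instance finiteDimensional_polySpace (k d : ℕ) : FiniteDimensional ℝ (polySpace k d) :=
  FiniteDimensional.span_of_finite ℝ (Set.finite_range _)

/-- The Taylor polynomial in the coordinates of the cube with corner `c` and side `h`. -/
def taylorPolyMap {d : ℕ} (k : ℕ) (G : (Fin d → ℝ) → ℝ) (y c : Fin d → ℝ) (h : ℝ) :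
    C(Set.Icc (0 : Fin d → ℝ) 1, ℝ) :=
  ⟨fun u => taylorPoly k G y (c + h • u.1), by unfold taylorPoly; fun_prop⟩

/-- In rescaled coordinates all Taylor polynomials lie in one fixed finite-dimensional space, so the
subdivision number depends only on k and d. The monomials arise by expanding each product of h·u +
(c - y). -/
lemma taylorPolyMap_mem {d : ℕ} (k : ℕ) (G : (Fin d → ℝ) → ℝ) (y c : Fin d → ℝ) (h : ℝ) :
    taylorPolyMap k G y c h ∈ polySpace k d := by
  have key : taylorPolyMap k G y c h = ∑ j : Fin k, (((j : ℕ).factorial : ℝ)⁻¹) •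
      ∑ i : Fin j → Fin d, partialDeriv i G y • ∑ t : Finset (Fin j),
        (h ^ t.card * ∏ l ∈ Finset.univ \ t, (c (i l) - y (i l))) •
        (⟨fun u => ∏ l ∈ t, u.1 (i l), continuous_finsetProd _ fun l _ =>
          (continuous_apply (i l)).comp continuous_subtype_val⟩ : C(Set.Icc (0 : Fin d → ℝ) 1, ℝ)) := by
    ext u
    simp only [taylorPolyMap, taylorPoly, ContinuousMap.coe_mk, ContinuousMap.coe_sum,
      Finset.sum_apply, ContinuousMap.coe_smul, Pi.smul_apply, smul_eq_mul, Pi.add_apply]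
    rw [Finset.sum_range]
    refine Finset.sum_congr rfl fun j _ => ?_
    congr 1
    refine Finset.sum_congr rfl fun i _ => ?_
    rw [mul_comm]
    congr 1
    have e : ∀ l : Fin j, c (i l) + h * u.1 (i l) - y (i l)
        = h * u.1 (i l) + (c (i l) - y (i l)) := fun l => by ring
    simp only [e]
    rw [Finset.prod_add, Finset.powerset_univ]
    refine Finset.sum_congr rfl fun t _ => ?_
    rw [Finset.prod_mul_distrib, Finset.prod_const]
    ring
  rw [key]
  refine Submodule.sum_mem _ fun j _ => Submodule.smul_mem _ _ (Submodule.sum_mem _ fun i _ =>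
    Submodule.smul_mem _ _ (Submodule.sum_mem _ fun t _ => Submodule.smul_mem _ _
      (Submodule.subset_span ⟨⟨j, i, t⟩, rfl⟩)))

/-- A number of subdivisions for which Taylor polynomials oscillate by at most half of their
supremum on each of the small cubes. -/
theorem exists_subdivision (k d : ℕ) : ∃ N : ℕ, 0 < N ∧
    ∀ (G : (Fin d → ℝ) → ℝ) (y c : Fin d → ℝ) (h : ℝ), 0 < h →
      ∃ p0 ∈ Set.Icc c (c + fun _ => h),
        (∀ p ∈ Set.Icc c (c + fun _ => h), |taylorPoly k G y p| ≤ |taylorPoly k G y p0|) ∧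
        ∀ p ∈ Set.Icc c (c + fun _ => h), (∀ l, |p0 l - p l| ≤ h / N) →
          |taylorPoly k G y p0 - taylorPoly k G y p| ≤ |taylorPoly k G y p0| / 2 := by
  obtain ⟨δ, hδ, hV⟩ := exists_equicontinuity_of_finiteDimensional (polySpace k d)
    (ε := 1 / 2) (by norm_num)
  obtain ⟨N, hN⟩ := exists_nat_gt (1 / δ)
  have hN0 : (0 : ℝ) < N := (by positivity : 0 < 1 / δ).trans hN
  refine ⟨N, by exact_mod_cast hN0, fun G y c h hh => ?_⟩
  set T := taylorPolyMap k G y c h with hT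
  have hTv : ∀ p, ∀ hp : h⁻¹ • (p - c) ∈ Set.Icc (0 : Fin d → ℝ) 1,
      T ⟨_, hp⟩ = taylorPoly k G y p := by
    intro p hp
    simp only [hT, taylorPolyMap, ContinuousMap.coe_mk, smul_inv_smul₀ hh.ne', add_sub_cancel]
  have hmem : ∀ p ∈ Set.Icc c (c + fun _ => h), h⁻¹ • (p - c) ∈ Set.Icc (0 : Fin d → ℝ) 1 := by
    intro p hp
    constructor
    · intro l
      have := hp.1 l
      simp only [Pi.zero_apply, Pi.smul_apply, Pi.sub_apply, smul_eq_mul]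
      exact mul_nonneg (by positivity) (by linarith)
    · intro l
      have := hp.2 l
      simp only [Pi.add_apply] at this
      simp only [Pi.one_apply, Pi.smul_apply, Pi.sub_apply, smul_eq_mul]
      rw [inv_mul_le_iff₀ hh]
      linarith
  have hne : (Set.Icc (0 : Fin d → ℝ) 1).Nonempty := ⟨0, by simp⟩
  have hne' : Nonempty (Set.Icc (0 : Fin d → ℝ) 1) := hne.to_subtype
  -- At a maximum point of |T| the oscillation bound by half the norm becomes half of |T| at that
  -- point.
  obtain ⟨u0, -, hu0⟩ := isCompact_univ.exists_isMaxOn Set.univ_nonempty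
    (f := fun u => |T u|) T.continuous.abs.continuousOn
  have hmax : ∀ u, |T u| ≤ |T u0| := fun u => hu0 (Set.mem_univ u)
  have hnorm : ‖T‖ ≤ |T u0| := (ContinuousMap.norm_le _ (abs_nonneg _)).2 hmax
  have hp0 : taylorPoly k G y (c + h • u0.1) = T u0 := rfl
  refine ⟨c + h • u0.1, ⟨fun l => ?_, fun l => ?_⟩, fun p hp => ?_, fun p hp hpd => ?_⟩
  · have := u0.2.1 l
    simp only [Pi.zero_apply] at this
    simp only [Pi.add_apply, Pi.smul_apply, smul_eq_mul]
    nlinarith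
  · have := u0.2.2 l
    simp only [Pi.one_apply] at this
    simp only [Pi.add_apply, Pi.smul_apply, smul_eq_mul]
    nlinarith
  · rw [hp0, ← hTv p (hmem p hp)]
    exact hmax _
  · have hd : dist u0 ⟨_, hmem p hp⟩ < δ := by
      rw [Subtype.dist_eq]
      refine lt_of_le_of_lt ((dist_pi_le_iff (by positivity : 0 ≤ 1 / (N : ℝ))).2 fun l => ?_) ?_
      · have := hpd l
        simp only [Pi.add_apply, Pi.smul_apply, smul_eq_mul] at this
        rw [Real.dist_eq]
        simp only [Pi.smul_apply, Pi.sub_apply, smul_eq_mul]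
        have e : u0.1 l - h⁻¹ * (p l - c l) = h⁻¹ * (c l + h * u0.1 l - p l) := by
          field_simp
          ring
        rw [e, abs_mul, abs_of_pos (inv_pos.2 hh), inv_mul_le_iff₀ hh]
        rwa [mul_one_div]
      · rw [div_lt_comm₀ hN0 hδ]
        exact hN
    have h1 := hV T (taylorPolyMap_mem k G y c h) _ _ hd
    rw [hTv p] at h1
    rw [hp0]
    linarith

/-! ### The local estimate for smooth functions -/

/-- The half-open cube with corner `c` and side `h`. -/
def box {d : ℕ} (c : Fin d → ℝ) (h : ℝ) : Set (Fin d → ℝ) :=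
  Set.univ.pi fun l => Set.Ico (c l) (c l + h)

lemma mem_box {d : ℕ} {c p : Fin d → ℝ} {h : ℝ} :
    p ∈ box c h ↔ ∀ l, c l ≤ p l ∧ p l < c l + h := by
  simp [box]

lemma measurableSet_box {d : ℕ} (c : Fin d → ℝ) (h : ℝ) : MeasurableSet (box c h) :=
  MeasurableSet.univ_pi fun _ => measurableSet_Ico

lemma convex_box {d : ℕ} (c : Fin d → ℝ) (h : ℝ) : Convex ℝ (box c h) :=
  convex_pi fun _ _ => convex_Ico _ _

lemma volume_box {d : ℕ} (c : Fin d → ℝ) (h : ℝ) :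
    volume (box c h) = ENNReal.ofReal h ^ d := by
  simp [box, Real.volume_pi_Ico]

lemma norm_sub_le_of_mem_box {d : ℕ} {c : Fin d → ℝ} {h : ℝ} (hh : 0 < h) {x y : Fin d → ℝ}
    (hx : x ∈ box c h) (hy : y ∈ box c h) : ‖x - y‖ ≤ h := by
  rw [mem_box] at hx hy
  refine (pi_norm_le_iff_of_nonneg hh.le).2 fun l => ?_
  rw [Pi.sub_apply, Real.norm_eq_abs, abs_le]
  constructor <;> linarith [hx l, hy l]

/-- The corner of a subcube. -/
def subCorner {d N : ℕ} (c : Fin d → ℝ) (h : ℝ) (z : Fin d → Fin N) : Fin d → ℝ :=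
  fun l => c l + h * ((z l : ℕ) : ℝ) / N

lemma subBox_subset {d N : ℕ} {c : Fin d → ℝ} {h : ℝ} (hh : 0 < h) (hN : 0 < N)
    (z : Fin d → Fin N) : box (subCorner c h z) (h / N) ⊆ box c h := by
  intro p hp
  rw [mem_box] at hp ⊢
  intro l
  have h1 := hp l
  have hN' : (0 : ℝ) < N := by exact_mod_cast hN
  have h2 : ((z l : ℕ) : ℝ) + 1 ≤ N := by exact_mod_cast (z l).2
  have h3 : 0 ≤ h * ((z l : ℕ) : ℝ) / N := by positivity
  have h4 : h * ((z l : ℕ) : ℝ) / N + h / N ≤ h := by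
    rw [← add_div, div_le_iff₀ hN']
    nlinarith
  simp only [subCorner] at h1
  constructor <;> linarith

lemma exists_fin_mul_div_le {N : ℕ} (hN : 0 < N) {h u : ℝ} (hh : 0 < h) (hu0 : 0 ≤ u)
    (hu : u ≤ h) : ∃ z : Fin N, h * ((z : ℕ) : ℝ) / N ≤ u ∧ u ≤ h * ((z : ℕ) : ℝ) / N + h / N := by
  have hN' : (0 : ℝ) < N := by exact_mod_cast hN
  rcases hu.lt_or_eq with h1 | h1
  · have h2 : 0 ≤ u * N / h := by positivity
    refine ⟨⟨⌊u * N / h⌋₊, ?_⟩, ?_, ?_⟩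
    · rw [Nat.floor_lt h2, div_lt_iff₀ hh]
      nlinarith
    · have := Nat.floor_le h2
      rw [le_div_iff₀ hh] at this
      rw [div_le_iff₀ hN']
      simp only
      linarith
    · have := (Nat.lt_floor_add_one (u * N / h)).le
      rw [div_le_iff₀ hh] at this
      rw [← add_div, le_div_iff₀ hN']
      simp only
      linarith
  · refine ⟨⟨N - 1, by omega⟩, ?_, ?_⟩
    · rw [div_le_iff₀ hN', h1]
      push_cast [Nat.cast_sub (Nat.one_le_iff_ne_zero.2 hN.ne')]
      nlinarith
    · rw [← add_div, le_div_iff₀ hN', h1]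
      push_cast [Nat.cast_sub (Nat.one_le_iff_ne_zero.2 hN.ne')]
      linarith

/-- The mean of `G` over the grid points with indices in `S`. -/
def gridMean {d m : ℕ} (S : Finset (Fin d → Fin m)) (G : (Fin d → ℝ) → ℝ) : ℝ :=
  (S.card : ℝ)⁻¹ * ∑ τ ∈ S, G (gridPoint τ)

/-- The property of `N` provided by `exists_subdivision`. -/
def IsSubdivision (k d N : ℕ) : Prop :=
  0 < N ∧ ∀ (G : (Fin d → ℝ) → ℝ) (y c : Fin d → ℝ) (h : ℝ), 0 < h →
    ∃ p0 ∈ Set.Icc c (c + fun _ => h),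
      (∀ p ∈ Set.Icc c (c + fun _ => h), |taylorPoly k G y p| ≤ |taylorPoly k G y p0|) ∧
      ∀ p ∈ Set.Icc c (c + fun _ => h), (∀ l, |p0 l - p l| ≤ h / N) →
        |taylorPoly k G y p0 - taylorPoly k G y p| ≤ |taylorPoly k G y p0| / 2

/-- In the subcube containing a maximum point p0 of |T|, the values of T stay within |T p0|/2 of T
p0, so |T p0| is at most twice its grid mean there. Replacing T by G in the mean costs remainders at
grid points. As p0 depends on y, the bound sums over all subcubes. -/
lemma abs_le_gridMean_add {k d m N : ℕ} (hN : IsSubdivision k d N) (G : (Fin d → ℝ) → ℝ)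
    (y : Fin d → ℝ) {c : Fin d → ℝ} {h : ℝ} (hh : 0 < h)
    (S : (Fin d → Fin N) → Finset (Fin d → Fin m)) (hS : ∀ z, (S z).Nonempty)
    (hSb : ∀ z, ∀ τ ∈ S z, gridPoint τ ∈ box (subCorner c h z) (h / N)) {x : Fin d → ℝ}
    (hx : x ∈ box c h) :
    |G x| ≤ |G x - taylorPoly k G y x| + (2 * ∑ z, |gridMean (S z) G| +
      2 * ∑ z, ((S z).card : ℝ)⁻¹ *
        ∑ τ ∈ S z, |G (gridPoint τ) - taylorPoly k G y (gridPoint τ)|) := by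
  obtain ⟨hN0, hN⟩ := hN
  obtain ⟨p0, hp0, hmax, hosc⟩ := hN G y c h hh
  have hsub : box c h ⊆ Set.Icc c (c + fun _ => h) := by
    intro p hp
    rw [mem_box] at hp
    exact ⟨fun l => (hp l).1, fun l => (hp l).2.le⟩
  have hz : ∀ l, ∃ z : Fin N, h * ((z : ℕ) : ℝ) / N ≤ p0 l - c l ∧
      p0 l - c l ≤ h * ((z : ℕ) : ℝ) / N + h / N := by
    intro l
    refine exists_fin_mul_div_le hN0 hh (by linarith [hp0.1 l]) ?_
    have := hp0.2 l
    simp only [Pi.add_apply] at this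
    linarith
  choose z hz1 hz2 using hz
  set T := taylorPoly k G y with hT
  have hcard : (0 : ℝ) < (S z).card := by exact_mod_cast (hS z).card_pos
  have hd : ∀ τ ∈ S z, |T p0 - T (gridPoint τ)| ≤ |T p0| / 2 := by
    intro τ hτ
    have hb := hSb z τ hτ
    refine hosc _ (hsub (subBox_subset hh hN0 z hb)) fun l => ?_
    rw [mem_box] at hb
    have h1 := hb l
    simp only [subCorner] at h1
    rw [abs_le]
    constructor <;> linarith [hz1 l, hz2 l]
  have hmean : |T p0 - gridMean (S z) T| ≤ |T p0| / 2 := by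
    have e : T p0 - gridMean (S z) T = ((S z).card : ℝ)⁻¹ * ∑ τ ∈ S z, (T p0 - T (gridPoint τ)) := by
      rw [gridMean, Finset.sum_sub_distrib, Finset.sum_const, nsmul_eq_mul, mul_sub,
        inv_mul_cancel_left₀ hcard.ne']
    rw [e, abs_mul, abs_of_pos (inv_pos.2 hcard), inv_mul_le_iff₀ hcard]
    refine (Finset.abs_sum_le_sum_abs _ _).trans ((Finset.sum_le_sum hd).trans ?_)
    rw [Finset.sum_const, nsmul_eq_mul]
  have hdiff : |gridMean (S z) T - gridMean (S z) G|
      ≤ ((S z).card : ℝ)⁻¹ * ∑ τ ∈ S z, |G (gridPoint τ) - T (gridPoint τ)| := by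
    rw [gridMean, gridMean, ← mul_sub, ← Finset.sum_sub_distrib, abs_mul,
      abs_of_pos (inv_pos.2 hcard)]
    refine mul_le_mul_of_nonneg_left ?_ (inv_pos.2 hcard).le
    refine (Finset.abs_sum_le_sum_abs _ _).trans (Finset.sum_le_sum fun τ _ => ?_)
    rw [abs_sub_comm]
  have h1 : |T x| ≤ |T p0| := hmax x (hsub hx)
  have h2 : |G x| ≤ |G x - T x| + |T x| := by
    have := abs_add_le (G x - T x) (T x)
    rwa [sub_add_cancel] at this
  have h3 : |gridMean (S z) G| ≤ ∑ z, |gridMean (S z) G| :=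
    Finset.single_le_sum (f := fun z => |gridMean (S z) G|) (fun _ _ => abs_nonneg _)
      (Finset.mem_univ z)
  have h4 : ((S z).card : ℝ)⁻¹ * ∑ τ ∈ S z, |G (gridPoint τ) - T (gridPoint τ)|
      ≤ ∑ z, ((S z).card : ℝ)⁻¹ * ∑ τ ∈ S z, |G (gridPoint τ) - T (gridPoint τ)| :=
    Finset.single_le_sum (f := fun z => ((S z).card : ℝ)⁻¹ *
      ∑ τ ∈ S z, |G (gridPoint τ) - T (gridPoint τ)|) (fun _ _ => by positivity)
      (Finset.mem_univ z)
  have h5 : |T p0| ≤ |T p0 - gridMean (S z) T| + |gridMean (S z) T - gridMean (S z) G|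
      + |gridMean (S z) G| := by
    have e : T p0 = (T p0 - gridMean (S z) T) + (gridMean (S z) T - gridMean (S z) G)
        + gridMean (S z) G := by ring
    conv_lhs => rw [e]
    exact (abs_add_le _ _).trans (add_le_add_left (abs_add_le _ _) _)
  linarith

lemma continuous_taylorPoly_left {d k : ℕ} {G : (Fin d → ℝ) → ℝ} (hG : ContDiff ℝ (⊤ : ℕ∞) G)
    (x : Fin d → ℝ) : Continuous fun y => taylorPoly k G y x := by
  have := fun (j : ℕ) (i : Fin j → Fin d) => continuous_partialDeriv hG i
  unfold taylorPoly
  fun_prop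

/-- The pointwise bound is integrated over the base point y. The remainder at x counts once and each
of the N^d subcube averages twice, whence 1 + 2N^d. -/
theorem enorm_mul_volume_le {k d m N : ℕ} (hk : 0 < k) (hN : IsSubdivision k d N)
    {G : (Fin d → ℝ) → ℝ} (hG : ContDiff ℝ (⊤ : ℕ∞) G) {c : Fin d → ℝ} {h : ℝ} (hh : 0 < h)
    (S : (Fin d → Fin N) → Finset (Fin d → Fin m)) (hS : ∀ z, (S z).Nonempty)
    (hSb : ∀ z, ∀ τ ∈ S z, gridPoint τ ∈ box (subCorner c h z) (h / N)) {x : Fin d → ℝ}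
    (hx : x ∈ box c h) :
    ‖G x‖ₑ * volume (box c h) ≤ ENNReal.ofReal (2 * ∑ z, |gridMean (S z) G|) * volume (box c h) +
      (1 + 2 * (N : ℝ≥0∞) ^ d) * (ENNReal.ofReal (h ^ k) * (taylorConst k d *
      (volume (box c h) ^ (1 / 2 : ℝ) *
        (∫⁻ y in box c h, ‖absDeriv k G y‖ₑ ^ 2) ^ (1 / 2 : ℝ)))) := by
  set R := ENNReal.ofReal (h ^ k) * (taylorConst k d * (volume (box c h) ^ (1 / 2 : ℝ) *
        (∫⁻ y in box c h, ‖absDeriv k G y‖ₑ ^ 2) ^ (1 / 2 : ℝ))) with hR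
  have hRx : ∀ p ∈ box c h, ∫⁻ y in box c h, ‖G p - taylorPoly k G y p‖ₑ ≤ R := fun p hp =>
    lintegral_taylor_remainder_le hk hG (measurableSet_box c h) (convex_box c h)
      (fun x hx y hy => norm_sub_le_of_mem_box hh hx hy) hp
  have hmeas : ∀ p : Fin d → ℝ, Measurable fun y => ‖G p - taylorPoly k G y p‖ₑ := fun p =>
    (continuous_const.sub (continuous_taylorPoly_left hG p)).measurable.enorm
  have hpt : ∀ y, ‖G x‖ₑ ≤ ‖G x - taylorPoly k G y x‖ₑ +
      (ENNReal.ofReal (2 * ∑ z, |gridMean (S z) G|) + 2 * ∑ z, ENNReal.ofReal ((S z).card : ℝ)⁻¹ *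
        ∑ τ ∈ S z, ‖G (gridPoint τ) - taylorPoly k G y (gridPoint τ)‖ₑ) := by
    intro y
    have h1 := abs_le_gridMean_add hN G y hh S hS hSb hx
    have h2 : ENNReal.ofReal (2 * ∑ z, ((S z).card : ℝ)⁻¹ *
        ∑ τ ∈ S z, |G (gridPoint τ) - taylorPoly k G y (gridPoint τ)|)
        = 2 * ∑ z, ENNReal.ofReal ((S z).card : ℝ)⁻¹ *
        ∑ τ ∈ S z, ‖G (gridPoint τ) - taylorPoly k G y (gridPoint τ)‖ₑ := by
      rw [ENNReal.ofReal_mul (by norm_num), ENNReal.ofReal_ofNat,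
        ENNReal.ofReal_sum_of_nonneg fun _ _ => by positivity]
      congr 1
      refine Finset.sum_congr rfl fun z _ => ?_
      rw [ENNReal.ofReal_mul (by positivity), ENNReal.ofReal_sum_of_nonneg fun _ _ => abs_nonneg _]
      simp only [Real.enorm_eq_ofReal_abs]
    rw [← h2, ← ENNReal.ofReal_add (by positivity) (by positivity), Real.enorm_eq_ofReal_abs,
      Real.enorm_eq_ofReal_abs, ← ENNReal.ofReal_add (by positivity) (by positivity)]
    exact ENNReal.ofReal_le_ofReal h1
  have hmS : ∀ z, Measurable fun y => ∑ τ ∈ S z,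
      ‖G (gridPoint τ) - taylorPoly k G y (gridPoint τ)‖ₑ := fun z =>
    Finset.measurable_fun_sum _ fun τ _ => hmeas _
  calc ‖G x‖ₑ * volume (box c h) = ∫⁻ _y in box c h, ‖G x‖ₑ := by
        rw [setLIntegral_const]
    _ ≤ ∫⁻ y in box c h, (‖G x - taylorPoly k G y x‖ₑ +
      (ENNReal.ofReal (2 * ∑ z, |gridMean (S z) G|) + 2 * ∑ z, ENNReal.ofReal ((S z).card : ℝ)⁻¹ *
        ∑ τ ∈ S z, ‖G (gridPoint τ) - taylorPoly k G y (gridPoint τ)‖ₑ)) :=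
        lintegral_mono fun y => hpt y
    _ = (∫⁻ y in box c h, ‖G x - taylorPoly k G y x‖ₑ) +
      (ENNReal.ofReal (2 * ∑ z, |gridMean (S z) G|) * volume (box c h) +
        2 * ∑ z, ENNReal.ofReal ((S z).card : ℝ)⁻¹ * ∑ τ ∈ S z, ∫⁻ y in box c h,
          ‖G (gridPoint τ) - taylorPoly k G y (gridPoint τ)‖ₑ) := by
        rw [lintegral_add_left (hmeas x), lintegral_add_left measurable_const, setLIntegral_const,
          lintegral_const_mul _ (Finset.measurable_fun_sum _ fun z _ => (hmS z).const_mul _),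
          lintegral_finsetSum _ fun z _ => (hmS z).const_mul _]
        congr 3
        refine Finset.sum_congr rfl fun z _ => ?_
        rw [lintegral_const_mul _ (hmS z), lintegral_finsetSum _ fun τ _ => hmeas _]
    _ ≤ R + (ENNReal.ofReal (2 * ∑ z, |gridMean (S z) G|) * volume (box c h) +
        2 * ∑ z : Fin d → Fin N, R) := by
        refine add_le_add (hRx x hx) (add_le_add le_rfl ?_)
        gcongr with z _
        have hcard : (0 : ℝ) < (S z).card := by exact_mod_cast (hS z).card_pos
        calc ENNReal.ofReal ((S z).card : ℝ)⁻¹ * ∑ τ ∈ S z, ∫⁻ y in box c h,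
              ‖G (gridPoint τ) - taylorPoly k G y (gridPoint τ)‖ₑ
            ≤ ENNReal.ofReal ((S z).card : ℝ)⁻¹ * ∑ τ ∈ S z, R := by
              gcongr with τ hτ
              exact hRx _ (subBox_subset hh hN.1 z (hSb z τ hτ))
          _ = R := by
              rw [Finset.sum_const, nsmul_eq_mul, ← mul_assoc, ← ENNReal.ofReal_natCast,
                ← ENNReal.ofReal_mul (by positivity), inv_mul_cancel₀ hcard.ne',
                ENNReal.ofReal_one, one_mul]
    _ = _ := by
        simp only [Finset.sum_const, Finset.card_univ, Fintype.card_fun, Fintype.card_fin,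
          nsmul_eq_mul]
        push_cast
        ring

/-! ### The local estimate in `H^k_0` -/

/-- The energy of `g` in the set `Q`. -/
def localEnergy {d : ℕ} (k : ℕ) (g : (Fin d → ℝ) → ℝ) (Q : Set (Fin d → ℝ)) : ℝ≥0∞ :=
  ∑ i : Fin k → Fin d, ∫⁻ y in Q, ‖weakDeriv i g y‖ₑ ^ 2

lemma lintegral_sq_rpow_half {α : Type*} [MeasurableSpace α] (μ : Measure α) (F : α → ℝ) :
    (∫⁻ a, ‖F a‖ₑ ^ 2 ∂μ) ^ (1 / 2 : ℝ) = eLpNorm F 2 μ := by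
  rw [eLpNorm_eq_lintegral_rpow_enorm_toReal (by norm_num) (by norm_num)]
  simp

lemma eLpNorm_absDeriv_le {d k : ℕ} {G g : (Fin d → ℝ) → ℝ} (hG : ContDiff ℝ (⊤ : ℕ∞) G)
    (hg : MemHk0 k g) {Q : Set (Fin d → ℝ)} (hQ : Q ⊆ unitCube d) :
    eLpNorm (absDeriv k G) 2 (volume.restrict Q)
      ≤ (∑ i : Fin k → Fin d, eLpNorm (fun x => partialDeriv i G x - weakDeriv i g x) 2
          (torusMeasure d)) + (d : ℝ≥0∞) ^ k * localEnergy k g Q ^ (1 / 2 : ℝ) := by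
  have hle : volume.restrict Q ≤ torusMeasure d := Measure.restrict_mono hQ le_rfl
  have hwm : ∀ i : Fin k → Fin d, AEStronglyMeasurable (weakDeriv i g) (volume.restrict Q) :=
    fun i => ((hg.isWeakDeriv le_rfl i).1.1).mono_measure hle
  have hpm : ∀ i : Fin k → Fin d, AEStronglyMeasurable (partialDeriv i G) (volume.restrict Q) :=
    fun i => (continuous_partialDeriv hG i).aestronglyMeasurable
  have h1 : eLpNorm (absDeriv k G) 2 (volume.restrict Q)
      ≤ ∑ i : Fin k → Fin d, eLpNorm (partialDeriv i G) 2 (volume.restrict Q) := by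
    have e : absDeriv k G = ∑ i : Fin k → Fin d, fun z => ‖partialDeriv i G z‖ := by
      funext z
      simp [absDeriv, Finset.sum_apply]
    rw [e]
    refine (eLpNorm_sum_le (fun i _ => (hpm i).norm) (by norm_num)).trans ?_
    simp only [eLpNorm_norm]
    exact le_rfl
  refine h1.trans ?_
  have h2 : ∀ i : Fin k → Fin d, eLpNorm (partialDeriv i G) 2 (volume.restrict Q)
      ≤ eLpNorm (fun x => partialDeriv i G x - weakDeriv i g x) 2 (torusMeasure d)
        + localEnergy k g Q ^ (1 / 2 : ℝ) := by
    intro i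
    have e : partialDeriv i G = (fun x => partialDeriv i G x - weakDeriv i g x) + weakDeriv i g := by
      funext x; simp
    conv_lhs => rw [e]
    refine (eLpNorm_add_le ((hpm i).sub (hwm i)) (hwm i) (by norm_num)).trans ?_
    refine add_le_add (eLpNorm_mono_measure _ hle) ?_
    rw [← lintegral_sq_rpow_half]
    refine ENNReal.rpow_le_rpow ?_ (by norm_num)
    exact Finset.single_le_sum (f := fun i : Fin k → Fin d =>
      ∫⁻ y in Q, ‖weakDeriv i g y‖ₑ ^ 2) (fun _ _ => zero_le) (Finset.mem_univ i)
  refine (Finset.sum_le_sum fun i _ => h2 i).trans (le_of_eq ?_)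
  rw [Finset.sum_add_distrib]
  congr 1
  simp

lemma tendsto_gridMean {ι : Type*} {l : Filter ι} {d m : ℕ} (S : Finset (Fin d → Fin m))
    {G : ι → (Fin d → ℝ) → ℝ} {g : (Fin d → ℝ) → ℝ} (h : ∀ x, Tendsto (fun a => G a x) l (nhds (g x))) :
    Tendsto (fun a => gridMean S (G a)) l (nhds (gridMean S g)) :=
  (tendsto_finsetSum _ fun _ _ => h _).const_mul _

/-- Limit of the smooth estimate along Fourier partial sums; the factor d^k counts the components of
D^k. Finiteness of the constants is needed for products to be continuous in the extended reals. -/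
theorem MemHk0.enorm_mul_volume_le {k d m N : ℕ} (hk : (d : ℝ) / 2 < k)
    (hN : IsSubdivision k d N) {g : (Fin d → ℝ) → ℝ} (hg : MemHk0 k g) {c : Fin d → ℝ} {h : ℝ}
    (hh : 0 < h) (hQ : box c h ⊆ unitCube d)
    (S : (Fin d → Fin N) → Finset (Fin d → Fin m)) (hS : ∀ z, (S z).Nonempty)
    (hSb : ∀ z, ∀ τ ∈ S z, gridPoint τ ∈ box (subCorner c h z) (h / N)) {x : Fin d → ℝ}
    (hx : x ∈ box c h) :
    ‖g x‖ₑ * volume (box c h) ≤ ENNReal.ofReal (2 * ∑ z, |gridMean (S z) g|) * volume (box c h) +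
      (1 + 2 * (N : ℝ≥0∞) ^ d) * (ENNReal.ofReal (h ^ k) * (taylorConst k d *
      (volume (box c h) ^ (1 / 2 : ℝ) *
        ((d : ℝ≥0∞) ^ k * localEnergy k g (box c h) ^ (1 / 2 : ℝ))))) := by
  have hk0 : 0 < k := by
    have : (0 : ℝ) < k := lt_of_le_of_lt (by positivity) hk
    exact_mod_cast this
  have hV : volume (box c h) ≠ ⊤ := by rw [volume_box]; finiteness
  have hV2 : volume (box c h) ^ (1 / 2 : ℝ) ≠ ⊤ :=
    ENNReal.rpow_ne_top_of_nonneg (by norm_num) hV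
  have hlim : ∀ x, Tendsto (fun F => fourierPartialSum g F x) atTop (nhds (g x)) :=
    hg.tendsto_fourierPartialSum hk
  have hleft : Tendsto (fun F => ‖fourierPartialSum g F x‖ₑ * volume (box c h)) atTop
      (nhds (‖g x‖ₑ * volume (box c h))) :=
    ENNReal.Tendsto.mul_const (hlim x).enorm (Or.inr hV)
  have hr1 : Tendsto (fun F => ENNReal.ofReal (2 * ∑ z, |gridMean (S z) (fourierPartialSum g F)|)
      * volume (box c h)) atTop
      (nhds (ENNReal.ofReal (2 * ∑ z, |gridMean (S z) g|) * volume (box c h))) := by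
    refine ENNReal.Tendsto.mul_const (ENNReal.tendsto_ofReal ?_) (Or.inr hV)
    exact (tendsto_finsetSum _ fun z _ => (tendsto_gridMean (S z) hlim).abs).const_mul _
  have hr2 : Tendsto (fun F => (∑ i : Fin k → Fin d, eLpNorm (fun x =>
      partialDeriv i (fourierPartialSum g F) x - weakDeriv i g x) 2 (torusMeasure d))
      + (d : ℝ≥0∞) ^ k * localEnergy k g (box c h) ^ (1 / 2 : ℝ)) atTop
      (nhds (0 + (d : ℝ≥0∞) ^ k * localEnergy k g (box c h) ^ (1 / 2 : ℝ))) := by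
    refine Tendsto.add ?_ tendsto_const_nhds
    have := tendsto_finsetSum (Finset.univ : Finset (Fin k → Fin d))
      fun i _ => hg.tendsto_partialDeriv_fourierPartialSum i
    simpa using this
  rw [zero_add] at hr2
  have hr3 := ENNReal.Tendsto.const_mul (a := 1 + 2 * (N : ℝ≥0∞) ^ d)
    (ENNReal.Tendsto.const_mul (a := ENNReal.ofReal (h ^ k))
      (ENNReal.Tendsto.const_mul (a := taylorConst k d)
        (ENNReal.Tendsto.const_mul (a := volume (box c h) ^ (1 / 2 : ℝ)) hr2 (Or.inr hV2))
        (Or.inr (taylorConst_ne_top hk))) (Or.inr ENNReal.ofReal_ne_top)) 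
    (Or.inr (by finiteness))
  refine le_of_tendsto_of_tendsto' hleft (hr1.add hr3) fun F => ?_
  have hsm : ContDiff ℝ (⊤ : ℕ∞) (fourierPartialSum g F) := contDiff_partialSum _ _ _
  refine (MIND.enorm_mul_volume_le hk0 hN hsm hh S hS hSb hx).trans ?_
  rw [lintegral_sq_rpow_half]
  gcongr
  exact eLpNorm_absDeriv_le hsm hg hQ

lemma localEnergy_unitCube {d k : ℕ} {g : (Fin d → ℝ) → ℝ} (hg : MemHk0 k g) :
    localEnergy k g (unitCube d) = ENNReal.ofReal (normHk k g ^ 2) := by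
  rw [normHk_sq, innerHk, localEnergy,
    ENNReal.ofReal_sum_of_nonneg fun _ _ => integral_nonneg fun _ => mul_self_nonneg _]
  refine Finset.sum_congr rfl fun i _ => ?_
  rw [ofReal_integral_eq_lintegral_ofReal (hg.integrable_mul_weakDeriv hg i)
    (Eventually.of_forall fun _ => mul_self_nonneg _)]
  refine lintegral_congr fun x => ?_
  rw [Real.enorm_eq_ofReal_abs, ← ENNReal.ofReal_pow (abs_nonneg _), sq_abs, sq]

lemma localEnergy_mono {d k : ℕ} (g : (Fin d → ℝ) → ℝ) {Q Q' : Set (Fin d → ℝ)} (h : Q ⊆ Q') :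
    localEnergy k g Q ≤ localEnergy k g Q' :=
  Finset.sum_le_sum fun _ _ => lintegral_mono_set h

/-! ### Grid points in cubes -/

lemma mem_gridIn {d m : ℕ} {B : Cube d} {τ : Fin d → Fin m} :
    τ ∈ gridIn m B ↔ gridPoint τ ∈ B.toSet := by
  classical
  simp [gridIn]

/-- Along each axis the cube contains at least ⌊m·side⌋ consecutive grid indices, and the floor of a
number at least 1 exceeds its half. -/
lemma half_pow_le_card_gridIn {d m : ℕ} (B : Cube d) (h1 : 1 ≤ m * B.side) :
    (m * B.side / 2) ^ d ≤ ((gridIn m B).card : ℝ) := by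
  classical
  have hs := B.side_pos
  have hm : (0 : ℝ) < m := by
    by_contra hc
    have : (m : ℝ) = 0 := le_antisymm (not_lt.1 hc) (by positivity)
    rw [this] at h1; linarith
  set M := ⌊(m : ℝ) * B.side⌋₊ with hM
  have hM1 : ((m : ℝ) * B.side) / 2 ≤ M := by
    have h2 := Nat.lt_floor_add_one ((m : ℝ) * B.side)
    have h3 : 1 ≤ M := Nat.one_le_floor_iff _ |>.2 h1
    have h4 : (1 : ℝ) ≤ M := by exact_mod_cast h3
    linarith
  have hMle : (M : ℝ) ≤ m * B.side := Nat.floor_le (by positivity)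
  have hlt : ∀ (l : Fin d) (j : Fin M), ((⌈(m : ℝ) * B.corner l⌉₊ + (j : ℕ) : ℕ) : ℝ)
      < m * (B.corner l + B.side) := by
    intro l j
    have h2 := Nat.ceil_lt_add_one (mul_nonneg hm.le (B.corner_nonneg l))
    have h3 : ((j : ℕ) : ℝ) + 1 ≤ M := by exact_mod_cast j.2
    push_cast
    linarith
  let φ : (Fin d → Fin M) → (Fin d → Fin m) := fun z l =>
    ⟨⌈(m : ℝ) * B.corner l⌉₊ + (z l : ℕ), by
      have h2 := hlt l (z l)
      have h3 : (m : ℝ) * (B.corner l + B.side) ≤ m :=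
        mul_le_of_le_one_right hm.le (B.corner_add_side_le l)
      exact_mod_cast h2.trans_le h3⟩
  have hφ : Function.Injective φ := by
    intro z z' h
    funext l
    have := congrArg Fin.val (congrFun h l)
    simp only [φ] at this
    exact Fin.ext (by omega)
  have hcard : (Finset.univ.image φ).card ≤ (gridIn m B).card := by
    refine Finset.card_le_card fun τ hτ => ?_
    obtain ⟨z, -, rfl⟩ := Finset.mem_image.1 hτ
    refine mem_gridIn.2 fun l _ => ⟨?_, ?_⟩
    · simp only [gridPoint, φ]
      rw [le_div_iff₀ hm, mul_comm]
      push_cast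
      exact (Nat.le_ceil _).trans (by linarith [Nat.cast_nonneg (α := ℝ) (z l : ℕ)])
    · simp only [gridPoint, φ]
      rw [div_lt_iff₀ hm, mul_comm (B.corner l + B.side)]
      exact hlt l (z l)
  rw [Finset.card_image_of_injective _ hφ] at hcard
  simp only [Finset.card_univ, Fintype.card_fun, Fintype.card_fin] at hcard
  calc (m * B.side / 2) ^ d ≤ (M : ℝ) ^ d := pow_le_pow_left₀ (by positivity) hM1 d
    _ ≤ _ := by exact_mod_cast hcard

lemma IsNormal.exists_subset {d : ℕ} (hd : 0 < d) {𝓑 : Set (Cube d)} (h𝓑 : IsNormal 𝓑) :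
    ∃ c : ℝ, 1 < c ∧ ∀ B : Cube d, ∃ B' ∈ 𝓑, B'.toSet ⊆ B.toSet ∧ B.side / c ≤ B'.side := by
  obtain ⟨c, hc, h⟩ := h𝓑
  refine ⟨c, hc, fun B => ?_⟩
  obtain ⟨B', hB', hsub, hvol⟩ := h B
  refine ⟨B', hB', hsub, ?_⟩
  have h1 : (B.side / c) ^ d ≤ B'.side ^ d := by
    refine le_trans ?_ hvol
    rw [div_pow]
    exact div_le_div_of_nonneg_left (by have := B.side_pos; positivity)
      (by linarith) (le_self_pow₀ hc.le hd.ne')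
  exact le_of_pow_le_pow_left₀ hd.ne' B'.side_pos.le h1

/-- The data of the local estimate: means over suitable cubes of `𝓑` are controlled by the
multiresolution norm. -/
lemma exists_gridIn_subBox {d m N : ℕ} (hN : 0 < N) {𝓑 : Set (Cube d)} {c₀ : ℝ}
    (hc₀ : 1 < c₀)
    (h𝓑 : ∀ B : Cube d, ∃ B' ∈ 𝓑, B'.toSet ⊆ B.toSet ∧ B.side / c₀ ≤ B'.side)
    {c : Fin d → ℝ} {h : ℝ} (hh : 0 < h) (hc : ∀ l, 0 ≤ c l) (hch : ∀ l, c l + h ≤ 1)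
    (hh1 : h ≤ 1) (hm : N * c₀ ≤ m * h) (z : Fin d → Fin N) :
    ∃ S : Finset (Fin d → Fin m), S.Nonempty ∧
      (∀ τ ∈ S, gridPoint τ ∈ box (subCorner c h z) (h / N)) ∧
      ∀ (g : (Fin d → ℝ) → ℝ) (ρ : ℝ), 0 ≤ ρ →
        mrNorm 𝓑 (sample m g) ≤ ρ * (m : ℝ) ^ ((d : ℝ) / 2) →
        |gridMean S g| ≤ ρ * ((2 * N * c₀) ^ ((d : ℝ) / 2) * h ^ (-((d : ℝ) / 2))) := by
  have hN' : (0 : ℝ) < N := by exact_mod_cast hN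
  have hN1 : (1 : ℝ) ≤ N := by exact_mod_cast hN
  have hmpos : (0 : ℝ) < m := by
    have : 0 < (m : ℝ) * h := lt_of_lt_of_le (by positivity) hm
    exact pos_of_mul_pos_left this hh.le
  have hz0 : ∀ l, 0 ≤ h * ((z l : ℕ) : ℝ) / N := fun l => by positivity
  have hz1 : ∀ l, h * ((z l : ℕ) : ℝ) / N + h / N ≤ h := by
    intro l
    have : ((z l : ℕ) : ℝ) + 1 ≤ N := by exact_mod_cast (z l).2
    rw [← add_div, div_le_iff₀ hN']
    nlinarith
  let B : Cube d :=
    { corner := subCorner c h z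
      side := h / N
      side_pos := by positivity
      side_le_one := by
        rw [div_le_one hN']
        linarith
      corner_nonneg := fun l => add_nonneg (hc l) (hz0 l)
      corner_add_side_le := fun l => by
        simp only [subCorner]
        linarith [hz1 l, hch l] }
  obtain ⟨B', hB', hsub, hside⟩ := h𝓑 B
  have hside' : h / N / c₀ ≤ B'.side := hside
  have hms : m * h / (N * c₀) ≤ m * B'.side := by
    have := mul_le_mul_of_nonneg_left hside' hmpos.le
    refine le_trans (le_of_eq ?_) this
    field_simp
  -- The cube of 𝓑 found inside the subcube has side at least h/(N c₀), so the lower bound on m·h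
  -- makes it at least one grid step wide.
  have h1 : 1 ≤ m * B'.side := by
    refine le_trans ?_ hms
    rw [one_le_div (by positivity)]
    exact hm
  have hcard := half_pow_le_card_gridIn B' h1
  have hcpos : (0 : ℝ) < (gridIn m B').card := lt_of_lt_of_le (by positivity) hcard
  refine ⟨gridIn m B', ?_, ?_, ?_⟩
  · rw [← Finset.card_pos]; exact_mod_cast hcpos
  · intro τ hτ
    exact hsub (mem_gridIn.1 hτ)
  · intro g ρ hρ hg
    have h2 := abs_sum_gridIn_le hg hB'
    set q : ℝ := m * h / (2 * N * c₀) with hq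
    have hq0 : 0 < q := by positivity
    have h3 : q ^ ((d : ℝ) / 2) ≤ Real.sqrt (gridIn m B').card := by
      rw [Real.sqrt_eq_rpow]
      have : q ^ ((d : ℝ) / 2) = (q ^ d) ^ (1 / 2 : ℝ) := by
        rw [← Real.rpow_natCast, ← Real.rpow_mul hq0.le]
        congr 1
        ring
      rw [this]
      refine Real.rpow_le_rpow (by positivity) (le_trans ?_ hcard) (by norm_num)
      refine pow_le_pow_left₀ hq0.le ?_ d
      rw [hq]
      refine le_trans (le_of_eq ?_) (div_le_div_of_nonneg_right hms (by norm_num : (0 : ℝ) ≤ 2))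
      field_simp
    have hqd : 0 < q ^ ((d : ℝ) / 2) := by positivity
    have hsp : 0 < Real.sqrt (gridIn m B').card := Real.sqrt_pos.2 hcpos
    have h4 : |gridMean (gridIn m B') g|
        ≤ ρ * (m : ℝ) ^ ((d : ℝ) / 2) / Real.sqrt (gridIn m B').card := by
      rw [gridMean, abs_mul, abs_of_pos (inv_pos.2 hcpos), inv_mul_le_iff₀ hcpos]
      refine h2.trans (le_of_eq ?_)
      have : ((gridIn m B').card : ℝ) = Real.sqrt (gridIn m B').card * Real.sqrt (gridIn m B').card :=
        (Real.mul_self_sqrt hcpos.le).symm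
      rw [mul_comm, mul_comm ((gridIn m B').card : ℝ), div_mul_eq_mul_div, eq_div_iff hsp.ne']
      conv_rhs => rw [this]
      ring
    refine h4.trans ?_
    have h5 : ρ * (m : ℝ) ^ ((d : ℝ) / 2) / Real.sqrt (gridIn m B').card
        ≤ ρ * (m : ℝ) ^ ((d : ℝ) / 2) / q ^ ((d : ℝ) / 2) :=
      div_le_div_of_nonneg_left (by positivity) hqd h3
    refine h5.trans (le_of_eq ?_)
    rw [hq, Real.div_rpow (by positivity) (by positivity), Real.mul_rpow hmpos.le hh.le,
      Real.rpow_neg hh.le]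
    have e1 : 0 < (m : ℝ) ^ ((d : ℝ) / 2) := by positivity
    have e2 : 0 < h ^ ((d : ℝ) / 2) := by positivity
    have e3 : 0 < (2 * N * c₀) ^ ((d : ℝ) / 2) := by positivity
    field_simp

lemma box_subset_unitCube {d : ℕ} {c : Fin d → ℝ} {h : ℝ} (hc : ∀ l, 0 ≤ c l)
    (hch : ∀ l, c l + h ≤ 1) : box c h ⊆ unitCube d := by
  intro p hp l _
  have h1 := mem_box.1 hp l
  exact ⟨by linarith [hc l], by linarith [hch l]⟩

/-- The constants of the local estimate. -/
theorem exists_local_estimate {k d : ℕ} (hd : 0 < d) (hk : (d : ℝ) / 2 < k)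
    {𝓑 : Set (Cube d)} (h𝓑 : IsNormal 𝓑) :
    ∃ C > 0, ∃ K > 0, ∀ (m : ℕ) (g : (Fin d → ℝ) → ℝ) (ρ : ℝ), MemHk0 k g → 0 ≤ ρ →
      mrNorm 𝓑 (sample m g) ≤ ρ * (m : ℝ) ^ ((d : ℝ) / 2) →
      ∀ (c : Fin d → ℝ) (h : ℝ), 0 < h → (∀ l, 0 ≤ c l) → (∀ l, c l + h ≤ 1) → K ≤ m * h →
        ∀ x ∈ box c h, |g x| ≤ C * (ρ * h ^ (-((d : ℝ) / 2)) +
          h ^ ((k : ℝ) - d / 2) * Real.sqrt (localEnergy k g (box c h)).toReal) := by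
  obtain ⟨N, hN⟩ := exists_subdivision k d
  obtain ⟨c₀, hc₀, h𝓑'⟩ := h𝓑.exists_subset hd
  have hN0 : (0 : ℝ) < N := by exact_mod_cast hN.1
  set C1 : ℝ := 2 * (N : ℝ) ^ d * (2 * N * c₀) ^ ((d : ℝ) / 2) with hC1
  set C2 : ℝ := (1 + 2 * (N : ℝ) ^ d) * ((taylorConst k d).toReal * (d : ℝ) ^ k) with hC2
  have hC1p : 0 < C1 := by positivity
  have hC2p : 0 ≤ C2 := by positivity
  refine ⟨C1 + C2, by positivity, N * c₀, by positivity, ?_⟩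
  intro m g ρ hg hρ hmr c h hh hc hch hm x hx
  have hh1 : h ≤ 1 := by linarith [hc ⟨0, hd⟩, hch ⟨0, hd⟩]
  have hz := fun z => exists_gridIn_subBox (m := m) hN.1 hc₀ h𝓑' hh hc hch hh1 hm z
  choose S hS hSb hSm using hz
  have hQ := box_subset_unitCube hc hch
  have key := hg.enorm_mul_volume_le hk hN hh hQ S hS hSb hx
  have hE : localEnergy k g (box c h) ≠ ⊤ :=
    ne_top_of_le_ne_top (by rw [localEnergy_unitCube hg]; exact ENNReal.ofReal_ne_top)
      (localEnergy_mono g hQ)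
  set E := localEnergy k g (box c h)
  have hmean : 2 * ∑ z, |gridMean (S z) g| ≤ C1 * (ρ * h ^ (-((d : ℝ) / 2))) := by
    have h1 : ∑ z : Fin d → Fin N, |gridMean (S z) g|
        ≤ ∑ _z : Fin d → Fin N, ρ * ((2 * N * c₀) ^ ((d : ℝ) / 2) * h ^ (-((d : ℝ) / 2))) :=
      Finset.sum_le_sum fun z _ => hSm z g ρ hρ hmr
    simp only [Finset.sum_const, Finset.card_univ, Fintype.card_fun, Fintype.card_fin,
      nsmul_eq_mul, Nat.cast_pow] at h1
    rw [hC1]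
    linarith
  have hV : volume (box c h) = ENNReal.ofReal (h ^ d) := by
    rw [volume_box, ENNReal.ofReal_pow hh.le]
  have hE' : E ^ (1 / 2 : ℝ) = ENNReal.ofReal (Real.sqrt E.toReal) := by
    rw [Real.sqrt_eq_rpow, ← ENNReal.ofReal_rpow_of_nonneg ENNReal.toReal_nonneg (by norm_num),
      ENNReal.ofReal_toReal hE]
  have hV' : volume (box c h) ^ (1 / 2 : ℝ) = ENNReal.ofReal (h ^ ((d : ℝ) / 2)) := by
    rw [hV, ENNReal.ofReal_rpow_of_nonneg (by positivity) (by norm_num), ← Real.rpow_natCast,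
      ← Real.rpow_mul hh.le]
    congr 2
    ring
  have hT : taylorConst k d = ENNReal.ofReal (taylorConst k d).toReal :=
    (ENNReal.ofReal_toReal (taylorConst_ne_top hk)).symm
  have hcst : (1 + 2 * (N : ℝ≥0∞) ^ d) = ENNReal.ofReal (1 + 2 * (N : ℝ) ^ d) := by
    rw [ENNReal.ofReal_add (by norm_num) (by positivity), ENNReal.ofReal_mul (by norm_num),
      ENNReal.ofReal_pow (by positivity)]
    simp
  have hdk : (d : ℝ≥0∞) ^ k = ENNReal.ofReal ((d : ℝ) ^ k) := by
    rw [ENNReal.ofReal_pow (by positivity), ENNReal.ofReal_natCast]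
  rw [hV', hE', hV, hT, hcst, hdk, Real.enorm_eq_ofReal_abs, ← ENNReal.ofReal_mul (by positivity),
    ← ENNReal.ofReal_mul (by positivity), ← ENNReal.ofReal_mul (by positivity),
    ← ENNReal.ofReal_mul (by positivity), ← ENNReal.ofReal_mul (by positivity),
    ← ENNReal.ofReal_mul (by positivity), ← ENNReal.ofReal_mul (by positivity),
    ← ENNReal.ofReal_add (by positivity) (by positivity),
    ENNReal.ofReal_le_ofReal_iff (by positivity)] at key
  have hpow : h ^ k * h ^ ((d : ℝ) / 2) = h ^ ((k : ℝ) - d / 2) * h ^ d := by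
    rw [← Real.rpow_natCast, ← Real.rpow_natCast, ← Real.rpow_add hh, ← Real.rpow_add hh]
    congr 1
    ring
  have hsq := Real.sqrt_nonneg E.toReal
  have h2 : (1 + 2 * (N : ℝ) ^ d) * (h ^ k * ((taylorConst k d).toReal * (h ^ ((d : ℝ) / 2) *
      ((d : ℝ) ^ k * Real.sqrt E.toReal))))
      = C2 * (h ^ ((k : ℝ) - d / 2) * Real.sqrt E.toReal) * h ^ d := by
    calc _ = C2 * (h ^ k * h ^ ((d : ℝ) / 2)) * Real.sqrt E.toReal := by rw [hC2]; ring
      _ = _ := by rw [hpow]; ring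
  rw [h2, ← add_mul] at key
  have h3 := le_of_mul_le_mul_right key (by positivity)
  have h4 : 0 ≤ C2 * (ρ * h ^ (-((d : ℝ) / 2))) := by positivity
  have h5 : 0 ≤ C1 * (h ^ ((k : ℝ) - d / 2) * Real.sqrt E.toReal) := by positivity
  nlinarith

/-! ### A stopping time argument on dyadic cubes -/

/-- If `T ≤ a₀ X` wherever `E ≤ X`, with `X` growing by the factor `q` from one generation to the
next, and everything is `E ≤ X` in the last generation, then `T` is controlled by `E` and `X` at
the root. -/
theorem tree_bound {ι : Type*} {β : Type*} [Fintype β] (child : ι → β → ι) (gen : ι → ℕ)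
    (hgen : ∀ z b, gen (child z b) = gen z + 1) {T E : ι → ℝ} {X : ℕ → ℝ} {q a₀ : ℝ} {J : ℕ}
    (hq : 2 ≤ q) (ha₀ : 0 ≤ a₀) (hX0 : ∀ j, 0 ≤ X j) (hX : ∀ j, X (j + 1) = q * X j)
    (hE0 : ∀ z, 0 ≤ E z)
    (hE : ∀ z, gen z < J → ∑ b, E (child z b) ≤ E z)
    (hT : ∀ z, gen z < J → T z ≤ ∑ b, T (child z b))
    (hgood : ∀ z, gen z ≤ J → E z ≤ X (gen z) → T z ≤ a₀ * X (gen z))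
    (hlast : ∀ z, gen z = J → E z ≤ X J) (z : ι) (hz : gen z ≤ J) :
    T z ≤ (a₀ + 2 * (Fintype.card β * q * a₀)) * max (E z) (X (gen z)) := by
  classical
  have hq0 : 0 ≤ q := by linarith
  set n : ℝ := (Fintype.card β : ℝ)
  set b : ℝ := n * q * a₀ with hb
  have hb0 : 0 ≤ b := by positivity
  -- The induction from the leaves needs the credit -b·X: at a bad node it pays for the good
  -- children.
  have key : ∀ i : ℕ, ∀ z, gen z + i = J → X (gen z) < E z → T z ≤ 2 * b * E z - b * X (gen z) := by
    intro i
    induction i with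
    | zero =>
      intro z hzJ hbad
      rw [add_zero] at hzJ
      have := hlast z hzJ
      rw [hzJ] at hbad
      linarith
    | succ i ih =>
      intro z hzJ hbad
      have hlt : gen z < J := by omega
      have hXz := hX0 (gen z)
      -- If some child is bad, its credit is b·q·X, while the good children cost at most n·a₀·q·X =
      -- b·X in total; q ≥ 2 leaves the credit b·X. If all are good, T ≤ b·X, and X < E at z itself
      -- suffices.
      by_cases hch : ∃ β₀, X (gen (child z β₀)) < E (child z β₀)
      · obtain ⟨β₀, hβ₀⟩ := hch
        have h1 : ∀ β', T (child z β') ≤ 2 * b * E (child z β')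
            + (a₀ * (q * X (gen z)) - if β' = β₀ then b * (q * X (gen z)) else 0) := by
          intro β'
          have hg' : gen (child z β') = gen z + 1 := hgen z β'
          have hE' : 0 ≤ 2 * b * E (child z β') := mul_nonneg (by positivity) (hE0 _)
          have hA : 0 ≤ a₀ * (q * X (gen z)) := mul_nonneg ha₀ (mul_nonneg hq0 hXz)
          have hB : 0 ≤ b * (q * X (gen z)) := mul_nonneg hb0 (mul_nonneg hq0 hXz)
          by_cases hbad' : X (gen (child z β')) < E (child z β')
          · have h2 := ih (child z β') (by omega) hbad'
            rw [hg', hX] at h2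
            split_ifs <;> linarith
          · have h2 := hgood (child z β') (by omega) (not_lt.1 hbad')
            rw [hg', hX] at h2
            rw [if_neg (by rintro rfl; exact hbad' hβ₀)]
            linarith
        have h3 := (hT z hlt).trans (Finset.sum_le_sum fun β' _ => h1 β')
        rw [Finset.sum_add_distrib, Finset.sum_sub_distrib, Finset.sum_ite_eq' Finset.univ β₀,
          if_pos (Finset.mem_univ _), Finset.sum_const, nsmul_eq_mul, Finset.card_univ,
          ← Finset.mul_sum] at h3
        have h4 := mul_le_mul_of_nonneg_left (hE z hlt) (by positivity : 0 ≤ 2 * b)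
        have h5 : n * (a₀ * (q * X (gen z))) = b * X (gen z) := by rw [hb]; ring
        have h6 : b * X (gen z) * 2 ≤ b * X (gen z) * q :=
          mul_le_mul_of_nonneg_left hq (mul_nonneg hb0 hXz)
        linarith
      · push Not at hch
        have h1 : ∀ β', T (child z β') ≤ a₀ * (q * X (gen z)) := by
          intro β'
          have := hgood (child z β') (by rw [hgen]; omega) (hch β')
          rwa [hgen, hX] at this
        have h2 : T z ≤ b * X (gen z) := by
          refine (hT z hlt).trans ((Finset.sum_le_sum fun β' _ => h1 β').trans (le_of_eq ?_))
          rw [Finset.sum_const, nsmul_eq_mul, Finset.card_univ, hb]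
          ring
        nlinarith
  have hm1 := le_max_left (E z) (X (gen z))
  have hm2 := le_max_right (E z) (X (gen z))
  have hm0 : 0 ≤ max (E z) (X (gen z)) := (hE0 z).trans hm1
  by_cases hbad : X (gen z) < E z
  · have h1 := key (J - gen z) z (by omega) hbad
    have h2 : 0 ≤ b * X (gen z) := mul_nonneg hb0 (hX0 _)
    nlinarith [mul_le_mul_of_nonneg_left hm1 hb0, mul_nonneg ha₀ hm0]
  · have h1 := hgood z hz (not_lt.1 hbad)
    nlinarith [mul_le_mul_of_nonneg_left hm2 ha₀, mul_nonneg hb0 hm0]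

/-! ### Dyadic cubes -/

/-- The index of a dyadic cube in the unit cube: its generation and its position. -/
abbrev DyadicIndex (d : ℕ) : Type := Σ j : ℕ, Fin d → Fin (2 ^ j)

/-- The side of the dyadic cubes of generation `j`. -/
def dyadicSide (j : ℕ) : ℝ := ((2 : ℝ) ^ j)⁻¹

/-- The corner of a dyadic cube. -/
def dyadicCorner {d : ℕ} (z : DyadicIndex d) : Fin d → ℝ :=
  fun l => ((z.2 l : ℕ) : ℝ) * dyadicSide z.1

/-- The dyadic cube with index `z`. -/
def dyadicBox {d : ℕ} (z : DyadicIndex d) : Set (Fin d → ℝ) :=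
  box (dyadicCorner z) (dyadicSide z.1)

/-- The children of a dyadic cube. -/
def dyadicChild {d : ℕ} (z : DyadicIndex d) (b : Fin d → Fin 2) : DyadicIndex d :=
  ⟨z.1 + 1, fun l => ⟨2 * (z.2 l : ℕ) + (b l : ℕ), by
    have h1 := (z.2 l).2
    have h2 := (b l).2
    rw [pow_succ]
    omega⟩⟩

lemma dyadicSide_pos (j : ℕ) : 0 < dyadicSide j := by unfold dyadicSide; positivity

/-- In this form, passing to a child appends one binary digit per coordinate, so the partition into
children is arithmetic of floors modulo 2. -/
lemma mem_dyadicBox {d : ℕ} {z : DyadicIndex d} {p : Fin d → ℝ} :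
    p ∈ dyadicBox z ↔ ∀ l, 0 ≤ p l ∧ ⌊p l * 2 ^ z.1⌋₊ = (z.2 l : ℕ) := by
  have h2 : (0 : ℝ) < 2 ^ z.1 := by positivity
  rw [dyadicBox, mem_box]
  refine forall_congr' fun l => ?_
  simp only [dyadicCorner, dyadicSide]
  have e : ((z.2 l : ℕ) : ℝ) * (2 ^ z.1)⁻¹ + (2 ^ z.1)⁻¹ = (((z.2 l : ℕ) : ℝ) + 1) / 2 ^ z.1 := by
    rw [add_div, div_eq_mul_inv, one_div]
  rw [e, ← div_eq_mul_inv, div_le_iff₀ h2, lt_div_iff₀ h2]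
  constructor
  · rintro ⟨h3, h4⟩
    have h5 : 0 ≤ p l := by
      by_contra hc
      have : p l * 2 ^ z.1 < 0 := mul_neg_of_neg_of_pos (not_le.1 hc) h2
      linarith [Nat.cast_nonneg (α := ℝ) (z.2 l : ℕ)]
    exact ⟨h5, (Nat.floor_eq_iff (by positivity)).2 ⟨h3, h4⟩⟩
  · rintro ⟨h3, h4⟩
    exact (Nat.floor_eq_iff (by positivity)).1 h4

lemma floor_mul_two_div_two {u : ℝ} : ⌊u * 2⌋₊ / 2 = ⌊u⌋₊ := by
  have := Nat.floor_div_natCast (u * 2) 2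
  rw [← this]
  congr 1
  push_cast
  ring

lemma dyadicBox_eq_iUnion {d : ℕ} (z : DyadicIndex d) :
    dyadicBox z = ⋃ b, dyadicBox (dyadicChild z b) := by
  ext p
  simp only [Set.mem_iUnion, mem_dyadicBox, dyadicChild]
  constructor
  · intro h
    refine ⟨fun l => ⟨⌊p l * 2 ^ (z.1 + 1)⌋₊ % 2, Nat.mod_lt _ (by norm_num)⟩, fun l => ⟨(h l).1, ?_⟩⟩
    have h1 : ⌊p l * 2 ^ (z.1 + 1)⌋₊ / 2 = (z.2 l : ℕ) := by
      rw [← (h l).2, pow_succ, ← mul_assoc, floor_mul_two_div_two]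
    rw [← h1]
    exact (Nat.div_add_mod _ 2).symm
  · rintro ⟨b, h⟩ l
    refine ⟨(h l).1, ?_⟩
    have h1 := (h l).2
    rw [← floor_mul_two_div_two, mul_assoc, ← pow_succ, h1]
    have := (b l).2
    omega

lemma pairwise_disjoint_dyadicChild {d : ℕ} (z : DyadicIndex d) :
    Pairwise (Function.onFun Disjoint fun b => dyadicBox (dyadicChild z b)) := by
  intro b b' hb
  rw [Function.onFun, Set.disjoint_left]
  intro p hp hp'
  rw [mem_dyadicBox] at hp hp'
  refine hb (funext fun l => Fin.ext ?_)
  have h1 := (hp l).2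
  have h2 := (hp' l).2
  simp only [dyadicChild] at h1 h2
  omega

lemma lintegral_dyadicBox {d : ℕ} (z : DyadicIndex d) (F : (Fin d → ℝ) → ℝ≥0∞) :
    ∫⁻ x in dyadicBox z, F x = ∑ b, ∫⁻ x in dyadicBox (dyadicChild z b), F x := by
  rw [dyadicBox_eq_iUnion, lintegral_iUnion (s := fun b => dyadicBox (dyadicChild z b))
    (fun b => measurableSet_box _ _)
    (pairwise_disjoint_dyadicChild z), tsum_fintype]

lemma localEnergy_dyadicBox {d k : ℕ} (g : (Fin d → ℝ) → ℝ) (z : DyadicIndex d) :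
    localEnergy k g (dyadicBox z) = ∑ b, localEnergy k g (dyadicBox (dyadicChild z b)) := by
  simp only [localEnergy]
  rw [Finset.sum_comm]
  exact Finset.sum_congr rfl fun i _ => lintegral_dyadicBox z _

lemma dyadicCorner_nonneg {d : ℕ} (z : DyadicIndex d) (l : Fin d) : 0 ≤ dyadicCorner z l :=
  mul_nonneg (Nat.cast_nonneg _) (dyadicSide_pos _).le

lemma dyadicCorner_add_le {d : ℕ} (z : DyadicIndex d) (l : Fin d) :
    dyadicCorner z l + dyadicSide z.1 ≤ 1 := by
  have h1 : ((z.2 l : ℕ) : ℝ) + 1 ≤ 2 ^ z.1 := by exact_mod_cast (z.2 l).2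
  have h2 : (0 : ℝ) < 2 ^ z.1 := by positivity
  simp only [dyadicCorner, dyadicSide]
  rw [← add_one_mul, ← div_eq_mul_inv, div_le_one h2]
  exact h1

lemma dyadicBox_subset {d : ℕ} (z : DyadicIndex d) : dyadicBox z ⊆ unitCube d :=
  box_subset_unitCube (dyadicCorner_nonneg z) (dyadicCorner_add_le z)

lemma exists_mem_dyadicBox {d : ℕ} {p : Fin d → ℝ} (hp : p ∈ unitCube d) (J : ℕ) :
    ∃ z : DyadicIndex d, z.1 = J ∧ p ∈ dyadicBox z := by
  have h : ∀ l, 0 ≤ p l ∧ p l < 1 := fun l => hp l (Set.mem_univ l)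
  refine ⟨⟨J, fun l => ⟨⌊p l * 2 ^ J⌋₊, ?_⟩⟩, rfl, mem_dyadicBox.2 fun l => ⟨(h l).1, rfl⟩⟩
  have h1 : (0 : ℝ) < 2 ^ J := by positivity
  rw [Nat.floor_lt (mul_nonneg (h l).1 h1.le)]
  push_cast
  exact mul_lt_of_lt_one_left h1 (h l).2

/-! ### The interpolation inequality -/

/-- The critical exponent. -/
def critExp (k d : ℕ) : ℝ := (4 * k + 2 * d) / d

/-- Good dyadic cubes are those with energy at most ρ² side^{-2k}, where the local estimate reduces
to |g| ≲ ρ side^{-d/2}. The finest generation gives the supremum, and the stopping-time bound at the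
root gives the critical integral. -/
theorem exists_interpolation {k d : ℕ} (hd : 0 < d) (hk : (d : ℝ) / 2 < k)
    {𝓑 : Set (Cube d)} (h𝓑 : IsNormal 𝓑) :
    ∃ C > 0, ∃ K > 0, ∀ (m : ℕ) (g : (Fin d → ℝ) → ℝ) (ρ D : ℝ), MemHk0 k g → 0 < ρ → ρ ≤ D →
      mrNorm 𝓑 (sample m g) ≤ ρ * (m : ℝ) ^ ((d : ℝ) / 2) → normHk k g ≤ D →
      K * (D / ρ) ^ (1 / k : ℝ) ≤ m →
      (∀ x ∈ unitCube d, |g x| ≤ C * (ρ * (D / ρ) ^ ((d : ℝ) / (2 * k)))) ∧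
      ∫⁻ x, ‖g x‖ₑ ^ critExp k d ∂torusMeasure d
        ≤ ENNReal.ofReal (C * (ρ ^ critExp k d * (D / ρ) ^ (2 : ℝ))) := by
  obtain ⟨C, hC, K, hK, hloc⟩ := exists_local_estimate hd hk h𝓑
  have hd' : (0 : ℝ) < d := by exact_mod_cast hd
  have hk0 : (0 : ℝ) < k := lt_trans (by positivity) hk
  have hk1 : 1 ≤ k := by exact_mod_cast hk0
  set p := critExp k d with hp
  have hp0 : 0 < p := by rw [hp, critExp]; positivity
  set a₀ : ℝ := (2 * C) ^ p with ha₀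
  have ha₀p : 0 < a₀ := by positivity
  set A : ℝ := a₀ + 2 * (Fintype.card (Fin d → Fin 2) * (4 ^ k : ℝ) * a₀) with hA
  have hAp : 0 < A := by positivity
  set B : ℝ := 2 * C * 2 ^ ((d : ℝ) / 2) with hB
  have hBp : 0 < B := by positivity
  refine ⟨A + B, by positivity, 2 * K, by positivity, ?_⟩
  intro m g ρ D hg hρ hρD hmr hnorm hm
  have hD : 0 < D := hρ.trans_le hρD
  set v : ℝ := (D / ρ) ^ (1 / k : ℝ) with hv
  have hDρ : 1 ≤ D / ρ := by rwa [one_le_div hρ]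
  have hv1 : 1 ≤ v := Real.one_le_rpow hDρ (by positivity)
  -- With J = n + 1, 2^J > v makes every cube of generation J good. Also 2^J ≤ 2v, and the doubled
  -- constant 2K keeps these cubes coarse enough for the local estimate.
  obtain ⟨n, hn1, hn2⟩ := exists_nat_pow_near hv1 (by norm_num : (1 : ℝ) < 2)
  set J := n + 1 with hJ
  have hJ2 : (2 : ℝ) ^ J ≤ 2 * v := by rw [hJ, pow_succ]; linarith
  have hvk : v ^ k = D / ρ := by
    rw [hv, ← Real.rpow_natCast, ← Real.rpow_mul (by positivity), one_div,
      inv_mul_cancel₀ hk0.ne', Real.rpow_one]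
  set X : ℕ → ℝ := fun j => ρ ^ 2 * (4 ^ k) ^ j with hX
  have hXpos : ∀ j, 0 < X j := fun j => by simp only [hX]; positivity
  have hXsqrt : ∀ j, Real.sqrt (X j) = ρ * (dyadicSide j) ^ (-(k : ℝ)) := by
    intro j
    have : X j = (ρ * (dyadicSide j) ^ (-(k : ℝ))) ^ 2 := by
      simp only [hX, dyadicSide]
      rw [Real.rpow_neg (by positivity), Real.inv_rpow (by positivity), inv_inv,
        Real.rpow_natCast, mul_pow]
      congr 1
      rw [← pow_mul, ← pow_mul, ← pow_mul, show (4 : ℝ) = 2 ^ 2 by norm_num, ← pow_mul]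
      congr 1
      ring
    rw [this, Real.sqrt_sq (mul_nonneg hρ.le (Real.rpow_nonneg (dyadicSide_pos j).le _))]
  have hEfin : ∀ z : DyadicIndex d, localEnergy k g (dyadicBox z) ≠ ⊤ := fun z =>
    ne_top_of_le_ne_top (by rw [localEnergy_unitCube hg]; exact ENNReal.ofReal_ne_top)
      (localEnergy_mono g (dyadicBox_subset z))
  set E : DyadicIndex d → ℝ := fun z => (localEnergy k g (dyadicBox z)).toReal with hE
  have hElast : ∀ z : DyadicIndex d, E z ≤ D ^ 2 := by
    intro z
    have h1 := localEnergy_mono (k := k) g (dyadicBox_subset z)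
    rw [localEnergy_unitCube hg] at h1
    refine (ENNReal.toReal_le_of_le_ofReal (sq_nonneg _) h1).trans ?_
    exact pow_le_pow_left₀ (normHk_nonneg g) hnorm 2
  have hDX : D ^ 2 ≤ X J := by
    have h1 : D ≤ ρ * (2 ^ J) ^ k := by
      have := pow_le_pow_left₀ (by positivity) hn2.le k
      rw [hvk, div_le_iff₀ hρ] at this
      linarith
    calc D ^ 2 ≤ (ρ * (2 ^ J) ^ k) ^ 2 := pow_le_pow_left₀ hD.le h1 2
      _ = X J := by
        simp only [hX]
        rw [mul_pow, show (4 : ℝ) = 2 ^ 2 by norm_num]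
        congr 1
        rw [← pow_mul, ← pow_mul, ← pow_mul, ← pow_mul]
        congr 1
        ring
  have hmJ : ∀ j ≤ J, K ≤ m * dyadicSide j := by
    intro j hj
    have h1 : (2 : ℝ) ^ j ≤ 2 ^ J := pow_le_pow_right₀ (by norm_num) hj
    have h2 : K * 2 ^ j ≤ m := by
      have : K * 2 ^ j ≤ K * (2 * v) := mul_le_mul_of_nonneg_left (h1.trans hJ2) hK.le
      linarith
    rw [dyadicSide, ← div_eq_mul_inv, le_div_iff₀ (by positivity)]
    exact h2
  have hpt : ∀ z : DyadicIndex d, z.1 ≤ J → E z ≤ X z.1 → ∀ x ∈ dyadicBox z,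
      |g x| ≤ 2 * C * (ρ * dyadicSide z.1 ^ (-((d : ℝ) / 2))) := by
    intro z hz hEz x hx
    have hs := dyadicSide_pos z.1
    have h1 := hloc m g ρ hg hρ.le hmr (dyadicCorner z) (dyadicSide z.1) hs
      (dyadicCorner_nonneg z) (dyadicCorner_add_le z) (hmJ _ hz) x hx
    have h2 : Real.sqrt (localEnergy k g (box (dyadicCorner z) (dyadicSide z.1))).toReal
        ≤ ρ * (dyadicSide z.1) ^ (-(k : ℝ)) := by
      rw [← hXsqrt]
      exact Real.sqrt_le_sqrt hEz
    have h3 : dyadicSide z.1 ^ ((k : ℝ) - d / 2) * (ρ * (dyadicSide z.1) ^ (-(k : ℝ)))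
        = ρ * dyadicSide z.1 ^ (-((d : ℝ) / 2)) := by
      rw [mul_left_comm, ← Real.rpow_add hs]
      congr 2
      ring
    have h4 := mul_le_mul_of_nonneg_left h2 (Real.rpow_nonneg hs.le ((k : ℝ) - d / 2))
    rw [h3] at h4
    refine h1.trans ?_
    nlinarith
  have hsup : ∀ x ∈ unitCube d, |g x| ≤ (A + B) * (ρ * (D / ρ) ^ ((d : ℝ) / (2 * k))) := by
    intro x hx
    obtain ⟨z, hzJ, hxz⟩ := exists_mem_dyadicBox hx J
    have h1 := hpt z hzJ.le (by rw [hzJ]; exact (hElast z).trans hDX) x hxz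
    rw [hzJ] at h1
    have h2 : dyadicSide J ^ (-((d : ℝ) / 2)) ≤ 2 ^ ((d : ℝ) / 2) * (D / ρ) ^ ((d : ℝ) / (2 * k)) := by
      rw [dyadicSide, Real.rpow_neg (by positivity), Real.inv_rpow (by positivity), inv_inv]
      calc ((2 : ℝ) ^ J) ^ ((d : ℝ) / 2) ≤ (2 * v) ^ ((d : ℝ) / 2) :=
            Real.rpow_le_rpow (by positivity) hJ2 (by positivity)
        _ = _ := by
            rw [Real.mul_rpow (by norm_num) (by positivity), hv, ← Real.rpow_mul (by positivity)]
            congr 2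
            field_simp
    calc |g x| ≤ 2 * C * (ρ * dyadicSide J ^ (-((d : ℝ) / 2))) := h1
      _ ≤ 2 * C * (ρ * (2 ^ ((d : ℝ) / 2) * (D / ρ) ^ ((d : ℝ) / (2 * k)))) := by gcongr
      _ = B * (ρ * (D / ρ) ^ ((d : ℝ) / (2 * k))) := by rw [hB]; ring
      _ ≤ (A + B) * (ρ * (D / ρ) ^ ((d : ℝ) / (2 * k))) := by gcongr; linarith
  refine ⟨hsup, ?_⟩
  · set I : DyadicIndex d → ℝ≥0∞ := fun z => ∫⁻ x in dyadicBox z, ‖g x‖ₑ ^ p with hI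
    have hIle : ∀ (z : DyadicIndex d) (M : ℝ), 0 ≤ M → (∀ x ∈ dyadicBox z, |g x| ≤ M) →
        I z ≤ ENNReal.ofReal (M ^ p * dyadicSide z.1 ^ (d : ℝ)) := by
      intro z M hM hb
      calc I z ≤ ∫⁻ _x in dyadicBox z, ENNReal.ofReal (M ^ p) := by
            refine setLIntegral_mono' (measurableSet_box _ _) fun x hx => ?_
            rw [Real.enorm_eq_ofReal_abs, ENNReal.ofReal_rpow_of_nonneg (abs_nonneg _) hp0.le]
            exact ENNReal.ofReal_le_ofReal (Real.rpow_le_rpow (abs_nonneg _) (hb x hx) hp0.le)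
        _ = _ := by
            rw [setLIntegral_const, dyadicBox, volume_box, ENNReal.ofReal_mul (by positivity),
              Real.rpow_natCast, ENNReal.ofReal_pow (dyadicSide_pos _).le]
    have hIfin : ∀ z, I z ≠ ⊤ := fun z => ne_top_of_le_ne_top ENNReal.ofReal_ne_top
      (hIle z _ (by positivity) fun x hx => hsup x (dyadicBox_subset z hx))
    -- Dividing by ρ^{p-2} makes the bound on good cubes proportional to the threshold X.
    set T : DyadicIndex d → ℝ := fun z => (I z).toReal / ρ ^ (p - 2) with hT
    have hρp : 0 < ρ ^ (p - 2) := by positivity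
    have hgoodT : ∀ z : DyadicIndex d, z.1 ≤ J → E z ≤ X z.1 → T z ≤ a₀ * X z.1 := by
      intro z hz hEz
      have hs := dyadicSide_pos z.1
      have h1 := hIle z _ (by positivity) (hpt z hz hEz)
      have h2 := ENNReal.toReal_le_of_le_ofReal (by positivity) h1
      simp only [hT]
      rw [div_le_iff₀ hρp]
      refine h2.trans (le_of_eq ?_)
      rw [Real.mul_rpow (by positivity) (by positivity), Real.mul_rpow hρ.le (by positivity),
        ← Real.rpow_mul hs.le, mul_assoc, mul_assoc, ← Real.rpow_add hs, ha₀, mul_assoc]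
      congr 1
      have e1 : X z.1 = ρ ^ (2 : ℝ) * dyadicSide z.1 ^ (-(2 * k : ℝ)) := by
        rw [← Real.sq_sqrt (hXpos z.1).le, hXsqrt, mul_pow, ← Real.rpow_natCast, ← Real.rpow_natCast,
          ← Real.rpow_mul hs.le]
        push_cast
        rw [neg_mul, mul_comm (k : ℝ)]
      -- This identity determines the critical exponent p.
      have e2 : -((d : ℝ) / 2) * p + d = -(2 * k : ℝ) := by
        rw [hp, critExp]
        field_simp
        ring
      rw [e1, e2, mul_right_comm, ← Real.rpow_add hρ]
      congr 2
      ring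
    have hroot : dyadicBox (⟨0, fun _ => 0⟩ : DyadicIndex d) = unitCube d := by
      refine Set.Subset.antisymm (dyadicBox_subset _) fun x hx => ?_
      refine mem_dyadicBox.2 fun l => ⟨(hx l (Set.mem_univ l)).1, ?_⟩
      rw [pow_zero, mul_one]
      exact Nat.floor_eq_zero.2 (hx l (Set.mem_univ l)).2
    have htree := tree_bound (dyadicChild (d := d)) (fun z => z.1) (fun z b => rfl) (T := T)
      (E := E) (X := X) (q := 4 ^ k) (a₀ := a₀) (J := J)
      (by
        calc (2 : ℝ) ≤ 4 ^ 1 := by norm_num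
          _ ≤ 4 ^ k := pow_le_pow_right₀ (by norm_num) hk1) ha₀p.le (fun j => (hXpos j).le)
      (fun j => by simp only [hX]; ring) (fun z => ENNReal.toReal_nonneg)
      (fun z _ => by
        simp only [hE]
        rw [← ENNReal.toReal_sum fun b _ => hEfin _, ← localEnergy_dyadicBox])
      (fun z _ => by
        simp only [hT]
        rw [← Finset.sum_div, ← ENNReal.toReal_sum fun b _ => hIfin _, ← lintegral_dyadicBox])
      hgoodT (fun z hz => (hElast z).trans hDX) ⟨0, fun _ => 0⟩ (Nat.zero_le _)
    have hmax : max (E ⟨0, fun _ => 0⟩) (X 0) ≤ D ^ 2 := by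
      refine max_le (hElast _) ?_
      simp only [hX, pow_zero, mul_one]
      exact pow_le_pow_left₀ hρ.le hρD 2
    have h1 : T ⟨0, fun _ => 0⟩ ≤ A * D ^ 2 :=
      htree.trans (mul_le_mul_of_nonneg_left hmax hAp.le)
    simp only [hT] at h1
    rw [div_le_iff₀ hρp] at h1
    have h2 : ∫⁻ x, ‖g x‖ₑ ^ p ∂torusMeasure d = I ⟨0, fun _ => 0⟩ := by
      simp only [hI]
      rw [hroot, torusMeasure]
    rw [h2, ← ENNReal.ofReal_toReal (hIfin _)]
    refine ENNReal.ofReal_le_ofReal (h1.trans ?_)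
    have e : D ^ 2 * ρ ^ (p - 2) = ρ ^ p * (D / ρ) ^ (2 : ℝ) := by
      rw [Real.div_rpow hD.le hρ.le, Real.rpow_sub hρ, ← Real.rpow_natCast]
      push_cast
      ring
    rw [mul_assoc, e]
    gcongr
    linarith


/-- The interpolation inequality in `L^q`, for all `q`. -/
theorem exists_interpolation_eLpNorm {k d : ℕ} (hd : 0 < d) (hk : (d : ℝ) / 2 < k)
    {𝓑 : Set (Cube d)} (h𝓑 : IsNormal 𝓑) (q : ℝ≥0∞) (hq : 1 ≤ q) :
    ∃ C > 0, ∃ K > 0, ∀ (m : ℕ) (g : (Fin d → ℝ) → ℝ) (ρ D : ℝ), MemHk0 k g → 0 < ρ → ρ ≤ D →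
      mrNorm 𝓑 (sample m g) ≤ ρ * (m : ℝ) ^ ((d : ℝ) / 2) → normHk k g ≤ D →
      K * (D / ρ) ^ (1 / k : ℝ) ≤ m →
      eLpNorm g q (torusMeasure d)
        ≤ ENNReal.ofReal (C * (ρ * (D / ρ) ^ (1 - 2 * vartheta k d q))) := by
  obtain ⟨C, hC, K, hK, hint⟩ := exists_interpolation hd hk h𝓑
  have hd' : (0 : ℝ) < d := by exact_mod_cast hd
  have hk0 : (0 : ℝ) < k := lt_trans (by positivity) hk
  set p := critExp k d with hp
  have hp0 : 0 < p := by rw [hp, critExp]; positivity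
  -- Up to p the bound at p suffices, the torus having total mass 1; this is why the exponent is
  -- constant in that range.
  rcases le_or_gt q (ENNReal.ofReal p) with hqp | hqp
  · have hϑ : 1 - 2 * vartheta k d q = 2 / p := by
      rw [vartheta, if_pos (show q ≤ ENNReal.ofReal ((4 * k + 2 * d) / d) from hqp), hp, critExp]
      field_simp
      ring
    refine ⟨C ^ (1 / p), by positivity, K, hK, fun m g ρ D hg hρ hρD hmr hn hm => ?_⟩
    have hD : 0 < D := hρ.trans_le hρD
    have h1 := (hint m g ρ D hg hρ hρD hmr hn hm).2
    refine (eLpNorm_le_eLpNorm_of_exponent_le hqp hg.continuous.aestronglyMeasurable).trans ?_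
    rw [eLpNorm_eq_lintegral_rpow_enorm_toReal (by simpa using hp0) ENNReal.ofReal_ne_top,
      ENNReal.toReal_ofReal hp0.le]
    refine (ENNReal.rpow_le_rpow h1 (by positivity)).trans (le_of_eq ?_)
    rw [ENNReal.ofReal_rpow_of_nonneg (by positivity) (by positivity), hϑ,
      Real.mul_rpow hC.le (by positivity), Real.mul_rpow (by positivity) (by positivity),
      ← Real.rpow_mul hρ.le, ← Real.rpow_mul (by positivity), mul_one_div_cancel hp0.ne',
      Real.rpow_one]
    congr 4
    ring
  · have hϑ : 1 - 2 * vartheta k d q = d / (2 * k) - d * (q⁻¹).toReal / k := by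
      rw [vartheta, if_neg (not_le.2 (show ENNReal.ofReal ((4 * k + 2 * d) / d) < q from hqp))]
      field_simp
      ring
    rcases eq_or_ne q ⊤ with rfl | hqt
    · refine ⟨C, hC, K, hK, fun m g ρ D hg hρ hρD hmr hn hm => ?_⟩
      have hD : 0 < D := hρ.trans_le hρD
      have h1 := (hint m g ρ D hg hρ hρD hmr hn hm).1
      rw [hϑ]
      simp only [ENNReal.inv_top, ENNReal.toReal_zero, mul_zero, zero_div, sub_zero]
      rw [eLpNorm_exponent_top]
      refine eLpNormEssSup_le_of_ae_bound ?_
      filter_upwards [ae_mem_unitCube d] with x hx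
      exact h1 x hx
    · obtain ⟨s, hs⟩ : ∃ s, s = q.toReal := ⟨_, rfl⟩
      have hps : p < s := by
        rw [hs]
        exact (ENNReal.ofReal_lt_iff_lt_toReal hp0.le hqt).1 hqp
      have hs0 : 0 < s := hp0.trans hps
      refine ⟨(C ^ (s - p) * C) ^ (1 / s), by positivity, K, hK,
        fun m g ρ D hg hρ hρD hmr hn hm => ?_⟩
      have hD : 0 < D := hρ.trans_le hρD
      obtain ⟨h1, h2⟩ := hint m g ρ D hg hρ hρD hmr hn hm
      set M := C * (ρ * (D / ρ) ^ ((d : ℝ) / (2 * k))) with hM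
      have hM0 : 0 < M := by positivity
      -- Split |g|^s = |g|^{s-p} |g|^p and bound the first factor by the supremum.
      have h3 : ∫⁻ x, ‖g x‖ₑ ^ s ∂torusMeasure d
          ≤ ENNReal.ofReal (M ^ (s - p)) * ∫⁻ x, ‖g x‖ₑ ^ p ∂torusMeasure d := by
        rw [← lintegral_const_mul _ (by have := hg.continuous.measurable.enorm; fun_prop)]
        refine lintegral_mono_ae ?_
        filter_upwards [ae_mem_unitCube d] with x hx
        rw [Real.enorm_eq_ofReal_abs, ENNReal.ofReal_rpow_of_nonneg (abs_nonneg _) hs0.le,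
          ENNReal.ofReal_rpow_of_nonneg (abs_nonneg _) hp0.le, ← ENNReal.ofReal_mul (by positivity)]
        refine ENNReal.ofReal_le_ofReal ?_
        rcases (abs_nonneg (g x)).eq_or_lt with h0 | h0
        · rw [← h0, Real.zero_rpow hs0.ne', Real.zero_rpow hp0.ne', mul_zero]
        · have e : |g x| ^ s = |g x| ^ (s - p) * |g x| ^ p := by
            rw [← Real.rpow_add h0, sub_add_cancel]
          rw [e]
          exact mul_le_mul_of_nonneg_right (Real.rpow_le_rpow h0.le (h1 x hx) (by linarith))
            (by positivity)
      rw [eLpNorm_eq_lintegral_rpow_enorm_toReal (by rintro rfl; simp at hq) hqt, ← hs]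
      refine (ENNReal.rpow_le_rpow (h3.trans (mul_le_mul_right h2 _))
        (by positivity)).trans (le_of_eq ?_)
      rw [← ENNReal.ofReal_mul (by positivity),
        ENNReal.ofReal_rpow_of_nonneg (by positivity) (by positivity), hϑ]
      congr 1
      have hR : 0 < D / ρ := by positivity
      set R := D / ρ
      have hqi : (q⁻¹).toReal = 1 / s := by rw [ENNReal.toReal_inv, ← hs, one_div]
      rw [hqi]
      have e1 : M ^ (s - p) * (C * (ρ ^ p * R ^ (2 : ℝ)))
          = C ^ (s - p) * C * (ρ ^ s * R ^ ((d : ℝ) / (2 * k) * (s - p) + 2)) := by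
        rw [hM, Real.mul_rpow hC.le (by positivity), Real.mul_rpow hρ.le (by positivity),
          ← Real.rpow_mul hR.le, Real.rpow_add hR, show ρ ^ s = ρ ^ (s - p) * ρ ^ p by
            rw [← Real.rpow_add hρ, sub_add_cancel]]
        ring
      rw [e1, Real.mul_rpow (by positivity) (by positivity),
        Real.mul_rpow (x := ρ ^ s) (by positivity) (by positivity), ← Real.rpow_mul hρ.le,
        ← Real.rpow_mul hR.le, mul_one_div_cancel hs0.ne', Real.rpow_one]
      congr 3
      rw [hp, critExp]
      field_simp
      ring

/-! ### The multiresolution norm of the noise -/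

/-- The grid points in a box of indices. -/
def indexBox {d m : ℕ} (ab : Fin d → Fin (m + 1) × Fin (m + 1)) : Finset (Fin d → Fin m) :=
  Finset.univ.filter fun τ => ∀ l, ((ab l).1 : ℕ) ≤ (τ l : ℕ) ∧ (τ l : ℕ) < ((ab l).2 : ℕ)

/-- Whatever the size of 𝓑, its cubes cut out at most (m+1)^{2d} distinct sets of grid points: each
is given by two rounded endpoints per axis. -/
lemma exists_gridIn_eq_indexBox {d m : ℕ} (hm : 0 < m) (B : Cube d) :
    ∃ ab : Fin d → Fin (m + 1) × Fin (m + 1), gridIn m B = indexBox ab := by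
  have hm' : (0 : ℝ) < m := by exact_mod_cast hm
  have hle : ∀ u : ℝ, u ≤ 1 → ⌈(m : ℝ) * u⌉₊ < m + 1 := by
    intro u hu
    rw [Nat.lt_succ_iff, Nat.ceil_le]
    exact mul_le_of_le_one_right hm'.le hu
  refine ⟨fun l => (⟨⌈(m : ℝ) * B.corner l⌉₊, hle _ (by
      linarith [B.corner_add_side_le l, B.side_pos])⟩,
    ⟨⌈(m : ℝ) * (B.corner l + B.side)⌉₊, hle _ (B.corner_add_side_le l)⟩), ?_⟩
  ext τ
  rw [mem_gridIn, indexBox, Finset.mem_filter]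
  simp only [Finset.mem_univ, true_and, Cube.toSet, Set.mem_pi, Set.mem_univ, true_imp_iff,
    gridPoint, Set.mem_Ico]
  refine forall_congr' fun l => ?_
  rw [Nat.ceil_le, Nat.lt_ceil, le_div_iff₀ hm', div_lt_iff₀ hm', mul_comm (B.corner l),
    mul_comm (B.corner l + B.side)]

/-- The sum over S is sub-Gaussian with variance proxy |S|σ², so the normalisation by √|S| removes
the dependence on S. The strict inequality makes the event empty for S = ∅. -/
lemma measure_abs_sum_gt_le {Ω : Type*} [MeasurableSpace Ω] {P : Measure Ω}
    [IsProbabilityMeasure P] {ι : Type*} {ξ : ι → Ω → ℝ} {σ : ℝ≥0} (hσ : 0 < σ)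
    (hindep : iIndepFun ξ P) (hsub : ∀ τ, HasSubgaussianMGF (ξ τ) (σ ^ 2) P) (S : Finset ι)
    {γ : ℝ} (hγ : 0 ≤ γ) :
    P.real {ω | γ * Real.sqrt (S.card : ℝ) < |∑ τ ∈ S, ξ τ ω|}
      ≤ 2 * Real.exp (-γ ^ 2 / (2 * σ ^ 2)) := by
  rcases S.eq_empty_or_nonempty with rfl | hS
  · simp only [Finset.card_empty, Nat.cast_zero, Real.sqrt_zero, mul_zero, Finset.sum_empty,
      abs_zero, lt_self_iff_false, Set.ofPred_false, measureReal_empty]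
    positivity
  have hc : (0 : ℝ) < S.card := by exact_mod_cast hS.card_pos
  have hσ' : (0 : ℝ) < σ := by exact_mod_cast hσ
  have h1 := HasSubgaussianMGF.sum_of_iIndepFun hindep (c := fun _ => σ ^ 2) (s := S)
    fun i _ => hsub i
  have hpos : 0 ≤ γ * Real.sqrt (S.card : ℝ) := by positivity
  have e : -(γ * Real.sqrt (S.card : ℝ)) ^ 2 / (2 * ((∑ _i ∈ S, σ ^ 2 : ℝ≥0) : ℝ))
      = -γ ^ 2 / (2 * σ ^ 2) := by
    rw [mul_pow, Real.sq_sqrt hc.le]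
    push_cast
    rw [Finset.sum_const, nsmul_eq_mul]
    field_simp
  have h2 := h1.measure_ge_le hpos
  have h3 := h1.neg.measure_ge_le hpos
  rw [e] at h2 h3
  have hsub' : {ω | γ * Real.sqrt (S.card : ℝ) < |∑ τ ∈ S, ξ τ ω|}
      ⊆ {ω | γ * Real.sqrt (S.card : ℝ) ≤ ∑ τ ∈ S, ξ τ ω}
        ∪ {ω | γ * Real.sqrt (S.card : ℝ) ≤ (-fun ω => ∑ τ ∈ S, ξ τ ω) ω} := by
    intro ω hω
    rcases lt_abs.1 (show γ * Real.sqrt (S.card : ℝ) < |∑ τ ∈ S, ξ τ ω| from hω) with h | h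
    · exact Or.inl h.le
    · exact Or.inr h.le
  calc _ ≤ _ := measureReal_mono hsub'
    _ ≤ _ := measureReal_union_le _ _
    _ ≤ _ := by linarith

theorem measure_mrNorm_gt_le {Ω : Type*} [MeasurableSpace Ω] {P : Measure Ω}
    [IsProbabilityMeasure P] {d m : ℕ} (hm : 0 < m) (𝓑 : Set (Cube d))
    {ξ : (Fin d → Fin m) → Ω → ℝ} {σ : ℝ≥0} (hσ : 0 < σ)
    (hindep : iIndepFun ξ P) (hsub : ∀ τ, HasSubgaussianMGF (ξ τ) (σ ^ 2) P)
    {γ : ℝ} (hγ : 0 ≤ γ) :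
    P {ω | γ < mrNorm 𝓑 fun τ => ξ τ ω}
      ≤ ENNReal.ofReal (((m : ℝ) + 1) ^ (2 * d) * (2 * Real.exp (-γ ^ 2 / (2 * σ ^ 2)))) := by
  have hsubset : {ω | γ < mrNorm 𝓑 fun τ => ξ τ ω}
      ⊆ ⋃ ab : Fin d → Fin (m + 1) × Fin (m + 1),
        {ω | γ * Real.sqrt ((indexBox ab).card : ℝ) < |∑ τ ∈ indexBox ab, ξ τ ω|} := by
    intro ω hω
    by_contra hc
    simp only [Set.mem_iUnion, Set.mem_ofPred_eq, not_exists, not_lt] at hc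
    refine (not_lt.2 (mrNorm_le hγ fun B _ => ?_)) hω
    obtain ⟨ab, hab⟩ := exists_gridIn_eq_indexBox hm B
    rw [hab]
    exact hc ab
  refine (measure_mono hsubset).trans ((measure_iUnion_fintype_le _ _).trans ?_)
  have h1 : ∀ ab : Fin d → Fin (m + 1) × Fin (m + 1),
      P {ω | γ * Real.sqrt ((indexBox ab).card : ℝ) < |∑ τ ∈ indexBox ab, ξ τ ω|}
        ≤ ENNReal.ofReal (2 * Real.exp (-γ ^ 2 / (2 * σ ^ 2))) := by
    intro ab
    rw [← ofReal_measureReal]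
    exact ENNReal.ofReal_le_ofReal (measure_abs_sum_gt_le hσ hindep hsub (indexBox ab) hγ)
  refine (Finset.sum_le_sum fun ab _ => h1 ab).trans (le_of_eq ?_)
  rw [Finset.sum_const, nsmul_eq_mul, Finset.card_univ,
    ENNReal.ofReal_mul (p := ((m : ℝ) + 1) ^ (2 * d)) (by positivity)]
  congr 1
  rw [Fintype.card_fun, Fintype.card_prod, Fintype.card_fin, Fintype.card_fin,
    ENNReal.ofReal_pow (by positivity), ENNReal.ofReal_add (by positivity) (by norm_num)]
  push_cast
  simp only [ENNReal.ofReal_natCast, ENNReal.ofReal_one]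
  rw [← sq, ← pow_mul]

/-- At r = 1/2 both sides are multiples of log n and the constants decide; for r > 1/2 the extra
factor (log n)^{2r-1} tends to infinity. -/
lemma eventually_threshold {d : ℕ} (hd : 0 < d) {σ A r Cγ : ℝ} (hσ : 0 < σ) (hr : 1 / 2 ≤ r)
    (hCγ : 0 < Cγ) (hCγ' : r = 1 / 2 → σ * Real.sqrt A < Cγ) (hA : 0 ≤ A) :
    ∀ᶠ m : ℕ in atTop, A * Real.log ((m : ℝ) ^ d) * σ ^ 2
      ≤ (Cγ * Real.log ((m : ℝ) ^ d) ^ r) ^ 2 := by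
  have hlog : Tendsto (fun m : ℕ => Real.log ((m : ℝ) ^ d)) atTop atTop :=
    Real.tendsto_log_atTop.comp ((tendsto_pow_atTop hd.ne').comp tendsto_natCast_atTop_atTop)
  rcases hr.eq_or_lt with h | h
  · have hc := hCγ' h.symm
    filter_upwards [hlog.eventually_ge_atTop 0] with m hm
    rw [mul_pow, ← h, ← Real.sqrt_eq_rpow, Real.sq_sqrt hm]
    have h1 : (σ * Real.sqrt A) ^ 2 ≤ Cγ ^ 2 := pow_le_pow_left₀ (by positivity) hc.le 2
    rw [mul_pow, Real.sq_sqrt hA] at h1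
    nlinarith
  · have hpos : 0 < 2 * r - 1 := by linarith
    have h1 := ((tendsto_rpow_atTop hpos).comp hlog).eventually_ge_atTop (A * σ ^ 2 / Cγ ^ 2)
    filter_upwards [h1, hlog.eventually_gt_atTop 0] with m hm1 hm2
    simp only [Function.comp] at hm1
    rw [div_le_iff₀ (by positivity)] at hm1
    have e : (Cγ * Real.log ((m : ℝ) ^ d) ^ r) ^ 2
        = Real.log ((m : ℝ) ^ d) ^ (2 * r - 1) * Cγ ^ 2 * Real.log ((m : ℝ) ^ d) := by
      rw [mul_pow, ← Real.rpow_natCast (_ ^ r), ← Real.rpow_mul hm2.le, Real.rpow_sub hm2,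
        Real.rpow_one]
      field_simp
      congr 2
    rw [e]
    nlinarith

/-- The union bound has about m^{2d} terms, each at most 2m^{-(5d/2+k)}, leaving m^{-(d/2+k)}. This
is summable because d/2 + k > d ≥ 1, and this half of Borel-Cantelli needs no independence across m.
-/
theorem ae_eventually_mrNorm_le {Ω : Type*} [MeasurableSpace Ω] (P : Measure Ω)
    [IsProbabilityMeasure P] {k d : ℕ} (hd : 0 < d) (hk : (d : ℝ) / 2 < k) (𝓑 : Set (Cube d))
    {σ : ℝ≥0} (hσ : 0 < σ) {ξ : (m : ℕ) → (Fin d → Fin m) → Ω → ℝ}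
    (hindep : ∀ m, iIndepFun (ξ m) P) (hsub : ∀ m τ, HasSubgaussianMGF (ξ m τ) (σ ^ 2) P)
    {r : ℝ} (hr : 1 / 2 ≤ r) {Cγ : ℝ} (hCγ : 0 < Cγ)
    (hCγ' : r = 1 / 2 → (σ : ℝ) * Real.sqrt (5 + 2 * k / d) < Cγ) :
    ∀ᵐ ω ∂P, ∀ᶠ m : ℕ in atTop,
      mrNorm 𝓑 (fun τ => ξ m τ ω) ≤ Cγ * Real.log ((m : ℝ) ^ d) ^ r := by
  have hσ' : (0 : ℝ) < σ := by exact_mod_cast hσ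
  have hd' : (0 : ℝ) < d := by exact_mod_cast hd
  have hd1 : (1 : ℝ) ≤ d := by exact_mod_cast hd
  obtain ⟨M, hM⟩ := eventually_atTop.1
    (eventually_threshold hd hσ' hr hCγ hCγ' (by positivity))
  set s : ℕ → Set Ω := fun m => {ω | Cγ * Real.log ((m : ℝ) ^ d) ^ r < mrNorm 𝓑 fun τ => ξ m τ ω}
  -- The shift by M + 1 ensures both m ≥ M, for the threshold, and m ≥ 1, for a nonempty grid.
  have hsum : ∑' m, P (s (m + (M + 1))) ≠ ⊤ := by
    have hbound : ∀ m : ℕ, P (s (m + (M + 1)))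
        ≤ ENNReal.ofReal (2 * 4 ^ d * ((m : ℝ) + 1) ^ (-((d : ℝ) / 2 + k))) := by
      intro m
      set j := m + (M + 1) with hj
      have hj0 : 0 < j := by omega
      have hj1 : (1 : ℝ) ≤ j := by exact_mod_cast hj0
      have hjp : (0 : ℝ) < j := by linarith
      have hlog0 : 0 ≤ Real.log ((j : ℝ) ^ d) := Real.log_nonneg (one_le_pow₀ hj1)
      refine (measure_mrNorm_gt_le hj0 𝓑 hσ (hindep j) (hsub j) (by positivity)).trans
        (ENNReal.ofReal_le_ofReal ?_)
      have h1 := hM j (by omega)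
      have h2 : Real.exp (-(Cγ * Real.log ((j : ℝ) ^ d) ^ r) ^ 2 / (2 * σ ^ 2))
          ≤ (j : ℝ) ^ (-((5 * d + 2 * k : ℝ) / 2)) := by
        rw [Real.rpow_def_of_pos hjp]
        refine Real.exp_le_exp.2 ?_
        rw [div_le_iff₀ (by positivity)]
        rw [Real.log_pow] at h1 ⊢
        have e : (5 + 2 * (k : ℝ) / d) * (d * Real.log j) = (5 * d + 2 * k) * Real.log j := by
          field_simp
        rw [e] at h1
        linarith
      have h3 : ((j : ℝ) + 1) ^ (2 * d) ≤ 4 ^ d * (j : ℝ) ^ (2 * d : ℝ) := by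
        calc ((j : ℝ) + 1) ^ (2 * d) ≤ (2 * j) ^ (2 * d) :=
              pow_le_pow_left₀ (by positivity) (by linarith) _
          _ = 4 ^ d * (j : ℝ) ^ (2 * d : ℝ) := by
              rw [mul_pow, pow_mul, show (2 : ℝ) ^ 2 = 4 by norm_num, ← Real.rpow_natCast (j : ℝ)]
              push_cast
              rfl
      calc ((j : ℝ) + 1) ^ (2 * d) * (2 * Real.exp (-(Cγ * Real.log ((j : ℝ) ^ d) ^ r) ^ 2
            / (2 * σ ^ 2)))
          ≤ 4 ^ d * (j : ℝ) ^ (2 * d : ℝ) * (2 * (j : ℝ) ^ (-((5 * d + 2 * k : ℝ) / 2))) := by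
            gcongr
        _ = 2 * 4 ^ d * (j : ℝ) ^ (-((d : ℝ) / 2 + k)) := by
            rw [show -((d : ℝ) / 2 + k) = 2 * d + -((5 * d + 2 * k : ℝ) / 2) by ring,
              Real.rpow_add hjp]
            ring
        _ ≤ 2 * 4 ^ d * ((m : ℝ) + 1) ^ (-((d : ℝ) / 2 + k)) := by
            have : (m : ℝ) + 1 ≤ j := by rw [hj]; push_cast; linarith [Nat.cast_nonneg (α := ℝ) M]
            refine mul_le_mul_of_nonneg_left ?_ (by positivity)
            exact Real.rpow_le_rpow_of_nonpos (by positivity) this (by linarith)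
    have hs : Summable fun m : ℕ => 2 * 4 ^ d * ((m : ℝ) + 1) ^ (-((d : ℝ) / 2 + k)) := by
      refine Summable.mul_left _ ?_
      have h1 : Summable fun n : ℕ => (n : ℝ) ^ (-((d : ℝ) / 2 + k)) :=
        Real.summable_nat_rpow.2 (by linarith)
      simpa using (summable_nat_add_iff 1).2 h1
    exact ne_top_of_le_ne_top hs.tsum_ofReal_ne_top (ENNReal.tsum_le_tsum hbound)
  have hae := ae_eventually_notMem hsum
  filter_upwards [hae] with ω hω
  rw [← map_add_atTop_eq_nat (M + 1), eventually_map]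
  filter_upwards [hω] with m hm
  exact not_lt.1 hm

/-! ### The convergence rate -/

lemma tendsto_natCast_pow_atTop {d : ℕ} (hd : 0 < d) :
    Tendsto (fun m : ℕ => (m : ℝ) ^ d) atTop atTop :=
  (tendsto_pow_atTop hd.ne').comp tendsto_natCast_atTop_atTop

/-- Supplies ρ ≤ D for the interpolation: since μ < 1/2, the logarithm is beaten by n^{1/2-μ}. -/
lemma eventually_scale_le {d : ℕ} (hd : 0 < d) {r μ a M : ℝ} (hμ : μ < 1 / 2) (ha : 0 < a)
    (hM : 0 < M) : ∀ᶠ m : ℕ in atTop,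
      a * Real.log ((m : ℝ) ^ d) ^ r * ((m : ℝ) ^ d) ^ (-(1 / 2) : ℝ)
        ≤ M * ((m : ℝ) ^ d) ^ (-μ) := by
  have h1 := (isLittleO_log_rpow_rpow_atTop r (by linarith : 0 < 1 / 2 - μ)).bound
    (by positivity : 0 < M / a)
  have h2 : ∀ᶠ x : ℝ in atTop, a * Real.log x ^ r * x ^ (-(1 / 2) : ℝ) ≤ M * x ^ (-μ) := by
    filter_upwards [h1, eventually_gt_atTop 0] with x hx hx0
    rw [Real.norm_eq_abs, Real.norm_eq_abs, abs_of_pos (Real.rpow_pos_of_pos hx0 _)] at hx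
    have h3 := (le_abs_self _).trans hx
    have e : x ^ (-μ) = x ^ (1 / 2 - μ) * x ^ (-(1 / 2) : ℝ) := by
      rw [← Real.rpow_add hx0]
      congr 1
      ring
    rw [e, ← mul_assoc]
    refine mul_le_mul_of_nonneg_right ?_ (by positivity)
    rw [div_mul_eq_mul_div, le_div_iff₀ ha] at h3
    linarith
  exact (tendsto_natCast_pow_atTop hd).eventually h2

/-- Supplies the resolution condition of the interpolation: the left side grows like m^{d/(2k)}, and
d/(2k) < 1. -/
lemma eventually_resolution_le {k d : ℕ} (hd : 0 < d) (hk : (d : ℝ) / 2 < k) {K b : ℝ}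
    (hb : 0 < b) : ∀ᶠ m : ℕ in atTop,
      K * (b * ((m : ℝ) ^ d) ^ (1 / 2 : ℝ)) ^ (1 / k : ℝ) ≤ m := by
  have hk0 : (0 : ℝ) < k := lt_of_le_of_lt (by positivity) hk
  have hpos : 0 < 1 - (d : ℝ) / (2 * k) := by
    rw [sub_pos, div_lt_one (by positivity)]
    linarith
  have h1 := ((tendsto_rpow_atTop hpos).comp tendsto_natCast_atTop_atTop).eventually_ge_atTop
    (K * b ^ (1 / k : ℝ))
  filter_upwards [h1, eventually_gt_atTop 0] with m hm hm0
  have hm' : (0 : ℝ) < m := by exact_mod_cast hm0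
  simp only [Function.comp] at hm
  rw [Real.mul_rpow hb.le (by positivity), ← Real.rpow_natCast, ← Real.rpow_mul hm'.le,
    ← Real.rpow_mul hm'.le]
  have e : (m : ℝ) = (m : ℝ) ^ (1 - (d : ℝ) / (2 * k)) * (m : ℝ) ^ ((d : ℝ) * (1 / 2) * (1 / k)) := by
    rw [← Real.rpow_add hm']
    conv_lhs => rw [← Real.rpow_one (m : ℝ)]
    congr 1
    field_simp
    ring
  conv_rhs => rw [e]
  rw [← mul_assoc]
  exact mul_le_mul_of_nonneg_right hm (by positivity)

/-- The bound ρ (D/ρ)^{1-2ϑ} equals ρ^{2ϑ} D^{1-2ϑ}, which is where the exponents of n and log n in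
the rate come from. -/
lemma rate_cancel {n L a M C μ r ϑ : ℝ} (hn : 0 < n) (hL : 0 < L) (ha : 0 < a) (hM : 0 < M) :
    n ^ (μ * (1 - 2 * ϑ) + ϑ) * L ^ (-(2 * r * ϑ)) *
      (C * (a * L ^ r * n ^ (-(1 / 2) : ℝ) *
        (M * n ^ (-μ) / (a * L ^ r * n ^ (-(1 / 2) : ℝ))) ^ (1 - 2 * ϑ)))
      = C * (a * (M / a) ^ (1 - 2 * ϑ)) := by
  have e1 : M * n ^ (-μ) / (a * L ^ r * n ^ (-(1 / 2) : ℝ))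
      = M / a * (L ^ (-r) * n ^ (1 / 2 - μ)) := by
    rw [Real.rpow_neg hL.le, show (1 / 2 - μ : ℝ) = -μ - -(1 / 2) by ring, Real.rpow_sub hn]
    have h1 : 0 < L ^ r := by positivity
    have h2 : 0 < n ^ (-(1 / 2) : ℝ) := by positivity
    field_simp
  rw [e1, Real.mul_rpow (by positivity) (by positivity), Real.mul_rpow (by positivity)
    (by positivity), ← Real.rpow_mul hL.le, ← Real.rpow_mul hn.le]
  have e2 : L ^ (-(2 * r * ϑ)) * L ^ r * L ^ (-r * (1 - 2 * ϑ)) = 1 := by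
    rw [← Real.rpow_add hL, ← Real.rpow_add hL,
      show -(2 * r * ϑ) + r + -r * (1 - 2 * ϑ) = 0 by ring, Real.rpow_zero]
  have e3 : n ^ (μ * (1 - 2 * ϑ) + ϑ) * n ^ (-(1 / 2) : ℝ) * n ^ ((1 / 2 - μ) * (1 - 2 * ϑ))
      = 1 := by
    rw [← Real.rpow_add hn, ← Real.rpow_add hn,
      show μ * (1 - 2 * ϑ) + ϑ + -(1 / 2) + (1 / 2 - μ) * (1 - 2 * ϑ) = 0 by ring, Real.rpow_zero]
  calc _ = (L ^ (-(2 * r * ϑ)) * L ^ r * L ^ (-r * (1 - 2 * ϑ))) *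
        (n ^ (μ * (1 - 2 * ϑ) + ϑ) * n ^ (-(1 / 2) : ℝ) * n ^ ((1 / 2 - μ) * (1 - 2 * ϑ))) *
        (C * (a * (M / a) ^ (1 - 2 * ϑ))) := by ring
    _ = _ := by rw [e2, e3, one_mul, one_mul]

end

end MIND

/-! ### Assembly of the almost sure rate. -/

theorem mainTheorem2 {Ω : Type*} [MeasurableSpace Ω] (P : Measure Ω) [IsProbabilityMeasure P]
    (k d : ℕ) (hd : 0 < d) (hk : (d : ℝ) / 2 < k)
    (q : ℝ≥0∞) (hq : 1 ≤ q)
    (𝓑 : Set (MIND.Cube d)) (h𝓑 : MIND.IsNormal 𝓑)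
    (f : (Fin d → ℝ) → ℝ) (hf : MIND.MemHk0 k f)
    (σ : ℝ≥0) (hσ : 0 < σ)
    -- for each sample size `n = m ^ d`, the noise is i.i.d. sub-Gaussian with parameter `σ`
    (ξ : (m : ℕ) → (Fin d → Fin m) → Ω → ℝ)
    (hξ_meas : ∀ m τ, Measurable (ξ m τ))
    (hξ_indep : ∀ m, iIndepFun (ξ m) P)
    (hξ_ident : ∀ m τ τ', IdentDistrib (ξ m τ) (ξ m τ') P P)
    (hξ_subG : ∀ m τ, HasSubgaussianMGF (ξ m τ) (σ ^ 2) P)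
    (r : ℝ) (hr : 1 / 2 ≤ r) (Cγ : ℝ) (hCγ : 0 < Cγ)
    (hCγ' : r = 1 / 2 → (σ : ℝ) * Real.sqrt (5 + 2 * k / d) < Cγ)
    (μ : ℝ) (hμ0 : 0 ≤ μ) (hμ : μ < 1 / 2)
    (hsource : (fun m : ℕ => MIND.sourceDefect k m 𝓑 f r)
      =O[atTop] fun m : ℕ => ((m : ℝ) ^ d) ^ (-μ))
    (fhat : ℕ → Ω → (Fin d → ℝ) → ℝ)
    (hfhat : ∀ m, 0 < m → ∀ ω, MIND.IsMIND k 𝓑 (fun τ => MIND.sample m f τ + ξ m τ ω)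
      (Cγ * Real.log ((m : ℝ) ^ d) ^ r) (fhat m ω)) :
    ∃ C : ℝ≥0, ∀ᵐ ω ∂P,
      limsup (fun m : ℕ =>
        ENNReal.ofReal
          (((m : ℝ) ^ d) ^ (μ * (1 - 2 * MIND.vartheta k d q) + MIND.vartheta k d q)
            * Real.log ((m : ℝ) ^ d) ^ (-(2 * r * MIND.vartheta k d q)))
          * eLpNorm (fun x => fhat m ω x - f x) q (MIND.torusMeasure d)) atTop ≤ (C : ℝ≥0∞) := by
  obtain ⟨C, hC, K, hK, hint⟩ := MIND.exists_interpolation_eLpNorm hd hk h𝓑 q hq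
  obtain ⟨c, hc, hsrc⟩ := hsource.exists_pos
  -- Here c bounds the source defect relative to n^{-μ}, and the added 1 pays for using
  -- near-minimisers with slack n^{-μ}.
  set M : ℝ := 2 * (1 + Real.sqrt Cγ) * (c + 1) with hM
  have hMpos : 0 < M := by positivity
  have ha : 0 < 2 * Cγ := by positivity
  refine ⟨Real.toNNReal (C * (2 * Cγ * (M / (2 * Cγ)) ^ (1 - 2 * MIND.vartheta k d q))), ?_⟩
  have hlog : Tendsto (fun m : ℕ => Real.log ((m : ℝ) ^ d)) atTop atTop :=
    Real.tendsto_log_atTop.comp (MIND.tendsto_natCast_pow_atTop hd)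
  filter_upwards [MIND.ae_eventually_mrNorm_le P hd hk 𝓑 hσ hξ_indep hξ_subG hr hCγ hCγ'] with ω hω
  refine limsup_le_of_le (by isBoundedDefault) ?_
  filter_upwards [hω, hsrc.bound, hlog.eventually_ge_atTop 1, eventually_gt_atTop 0,
    MIND.eventually_scale_le hd (r := r) hμ ha hMpos,
    MIND.eventually_resolution_le (K := K) hd hk (by positivity : 0 < M / (2 * Cγ))]
    with m hξ hs hL hm0 hscale hres
  have hm1 : (1 : ℝ) ≤ m := by exact_mod_cast hm0
  have hn1 : (1 : ℝ) ≤ (m : ℝ) ^ d := one_le_pow₀ hm1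
  set n : ℝ := (m : ℝ) ^ d with hn
  set L : ℝ := Real.log n with hLdef
  have hn0 : 0 < n := by linarith
  have hL0 : 0 < L := by linarith
  obtain ⟨hS, hD⟩ := MIND.IsMIND.normHk_sub_le_sourceDefect hCγ hL0 hf hξ (hfhat m hm0 ω)
  have hD' : MIND.normHk k (fhat m ω - f) ≤ M * n ^ (-μ) := by
    refine (hD (n ^ (-μ)) (by positivity)).trans ?_
    rw [Real.norm_eq_abs, Real.norm_eq_abs, abs_of_pos (by positivity : 0 < n ^ (-μ))] at hs
    have h1 := (le_abs_self _).trans hs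
    rw [hM, mul_assoc _ (c + 1)]
    refine mul_le_mul_of_nonneg_left ?_ (by positivity)
    linarith
  set ρ : ℝ := 2 * Cγ * L ^ r * n ^ (-(1 / 2) : ℝ) with hρ
  have hρ0 : 0 < ρ := by positivity
  have hmr : MIND.mrNorm 𝓑 (MIND.sample m (fhat m ω - f)) ≤ ρ * (m : ℝ) ^ ((d : ℝ) / 2) := by
    refine hS.trans (le_of_eq ?_)
    have e : (m : ℝ) ^ ((d : ℝ) / 2) = n ^ (1 / 2 : ℝ) := by
      rw [hn, ← Real.rpow_natCast, ← Real.rpow_mul (by linarith)]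
      congr 1
      ring
    rw [hρ, e, mul_assoc _ (n ^ _), ← Real.rpow_add hn0, neg_add_cancel, Real.rpow_zero, mul_one,
      mul_assoc]
  -- Since n^{-μ} ≤ 1 ≤ L^r, the ratio D/ρ is at most M/(2Cγ) · n^{1/2}.
  have hKm : K * (M * n ^ (-μ) / ρ) ^ (1 / k : ℝ) ≤ m := by
    refine le_trans ?_ hres
    refine mul_le_mul_of_nonneg_left (Real.rpow_le_rpow (by positivity) ?_ (by positivity)) hK.le
    rw [div_le_iff₀ hρ0, hρ]
    have h1 : n ^ (-μ) ≤ 1 := Real.rpow_le_one_of_one_le_of_nonpos hn1 (by linarith)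
    have h2 : 1 ≤ L ^ r := Real.one_le_rpow hL (by linarith)
    have h3 : n ^ (1 / 2 : ℝ) * n ^ (-(1 / 2) : ℝ) = 1 := by
      rw [← Real.rpow_add hn0, add_neg_cancel, Real.rpow_zero]
    calc M * n ^ (-μ) ≤ M * L ^ r := mul_le_mul_of_nonneg_left (h1.trans h2) hMpos.le
      _ = M * L ^ r * (n ^ (1 / 2 : ℝ) * n ^ (-(1 / 2) : ℝ)) := by rw [h3, mul_one]
      _ = _ := by field_simp
  have hfin := hint m (fhat m ω - f) ρ (M * n ^ (-μ)) ((hfhat m hm0 ω).1.sub hf) hρ0 hscale hmr hD' hKm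
  refine (mul_le_mul_right hfin _).trans (le_of_eq ?_)
  rw [← ENNReal.ofReal_mul (by positivity), hρ, MIND.rate_cancel hn0 hL0 ha hMpos]
  rfl
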